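/- **Model.** A ball is a point that moves in the plane in a straight line with constant velocity until it meets a component. Components are: plane *walls* (segments with rational end points); *one-way gates* (segments with rational start and end point; a ball that moves to the right-hand side of the directed segment passes without change, a ball that moves to the left-hand side is reflected as by a wall); *moving walls* (a segment with rational end points that, from a rational starting time on, is translated in a rational direction; its displacement is a rational function of time with rational coefficients during $[0,t_1)$, it moves back uniformly to its initial location during $[t_1,t_2)$, and this is repeated with period $t_2$). All collisions are perfectly elastic: if the wall has velocity $\vec w$ at the moment of the collision, the relative velocity $\vec u-\vec w$ of the ball is reflected by the law of reflection and $\vec w$ is added again. A *machine* consists of finitely many walls, one-way gates and moving walls (no bumpers, no parabolic walls). A *pushdown automaton* is deterministic, has finite sets of states, input letters and stack symbols, may make moves that read no input, and has below its stack a bottom symbol that is never removed; in each step it replaces the top symbol by a word (or, if only the bottom symbol is left, puts a word on top of it); it halts when no transition applies. Stack symbols and the bottom symbol are written as pairwise different blocks of $\ell$ bits (in an arbitrary fixed way). The *time offset* $\Delta$ of a stack is the offset of its sequence of bits, where the empty sequence of bits has offset $0$ and pushing a bit $b$ changes $\Delta$ to $(\Delta+b)/4$. **Lemma.** Let $M$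 be a pushdown automaton, with a fixed binary block code for its stack symbols. (1) There is a constant $C$ such that for every rational speed $v>0$ and every input word $w$ there are a machine, a rational $T\ge 1$, and pairwise different rational points ("ports") $p(q,i)$ for all states $q$ and all $0\le i\le |w|$ with the following property. For every initial stack with offset $\Delta_0$, let the ball start at time $0$ in the point $p(q_0,|w|)-(v\Delta_0,0)$ with velocity $(v,0)$, where $q_0$ is the initial state. Consider the run of $M$ on $w$ with this initial stack; let $q_n$, $i_n$, $\Delta_n$ be the state, the length of the remaining input and the offset of the stack after $n$ steps. Then, for every $n$ for which the $n$-th configuration exists, the ball is in $p(q_n,i_n)$ with velocity $(v,0)$ at time $nT+\Delta_n$; there are at most $C$ reflections between two consecutive of these events; and the ball is in a port at no other time. (In particular $M$ reaches state $q$ with remaining input of length $i$ if and only if the ball reaches the target $p(q,i)$.) (2) For every real $v>0$ and all sufficiently large $d$, two accelerating walls double the time offset, and two accelerating walls halve it: Let two vertical walls rest at $x=d$ and $x=-d$ until the times $d/v$ and $3d/v$, respectively, and let the $j$-th wall move from then on horizontally with speed $\tau\, a_j(\tau)$ at $\tau$ time units after its start. There are continuous functions $a_1,a_2$ on $[0,\infty)$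 with $a_2(t)=\frac12 a_1(t/2)$ such that for every $s\in[0,2]$ a ball that is in the origin at time $s$ with velocity $(v,0)$ is again in the origin with velocity $(v,0)$ at time $2s+4d/v$, after exactly two reflections. There are also continuous functions $a_1,a_2$ with $a_1(t)=\frac12 a_2(t/2)$ such that the same holds with the time $s/2+4d/v$. (3) For every rational $v>0$ there are a machine, rational numbers $T\ge 2$ and $c$, rational points $x$, $y_0$, $y_1$, where $y_0$ and $y_1$ do not lie on the same horizontal line, and numbers $k_0$, $k_1$ such that for every integer $n\ge0$: a ball that is in $x$ with velocity $(v,0)$ at time $nT+s$ with $s\in[0,\frac12)$ is in $y_0$ with velocity $(v,0)$ at time $nT+s+c$ after $k_0$ reflections; if $s\in[1,\frac32)$, it is in $y_1$ with velocity $(v,0)$ at time $nT+(s-1)+c$ after $k_1$ reflections. -/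

import Mathlib

noncomputable section

namespace Pinball

/-! ### Plane geometry -/

/-- Points and vectors of the Euclidean plane, in coordinates. -/
abbrev Plane := ℝ × ℝ

def dot (u w : Plane) : ℝ := u.1 * w.1 + u.2 * w.2

/-- Positive iff `w` points to the left of `u`. -/
def cross (u w : Plane) : ℝ := u.1 * w.2 - u.2 * w.1

/-- A normal vector of a line with direction `d`. -/
def normal (d : Plane) : Plane := (-d.2, d.1)

/-- Velocity after a perfectly elastic collision of a ball of velocity `u` with a wall of
direction `d` that has velocity `w` at that moment: the relative velocity `u - w` is reflected
at the wall, and `w` is added again. -/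
def reflect (d w u : Plane) : Plane :=
  u - (2 * dot (u - w) (normal d) / dot (normal d) (normal d)) • normal d

/-- A point with rational coordinates as a point of the plane. -/
def toPlane (p : ℚ × ℚ) : Plane := ((p.1 : ℝ), (p.2 : ℝ))

/-! ### Scenes and the motion of the ball -/

/-- A straight wall that is translated in the course of time: initial end points, translation
and velocity at time `t`. -/
structure MovingSegment where
  fst : Plane
  snd : Plane
  shift : ℝ → Plane
  vel : ℝ → Plane

/-- The points of the wall at time `t`. -/
def MovingSegment.at (m : MovingSegment) (t : ℝ) : Set Plane :=
  segment ℝ (m.fst + m.shift t) (m.snd + m.shift t)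

/-- Finitely many (stationary or moving) walls, and finitely many one-way gates, given by start
and end position. -/
structure Scene where
  walls : List MovingSegment
  gates : List (Plane × Plane)

/-- A ball that is in `x` at time `t` with velocity `u` meets a component that changes its
velocity to `u'`. A one-way gate opens in the clockwise direction, i.e. towards the right side
of the segment from start to end: a ball that moves to the right side passes through without any
change, a ball that moves to the left side is reflected as by a stationary wall. -/
def Scene.Hits (S : Scene) (t : ℝ) (x u u' : Plane) : Prop :=
  (∃ m ∈ S.walls, x ∈ m.at t ∧ u' = reflect (m.snd - m.fst) (m.vel t) u) ∨
  (∃ g ∈ S.gates, x ∈ segment ℝ g.1 g.2 ∧ 0 < cross (g.2 - g.1) u ∧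
    u' = reflect (g.2 - g.1) 0 u)

/-- A ball with its position and velocity at some time. -/
structure Ball where
  time : ℝ
  pos : Plane
  vel : Plane

/-- Position at time `t` under free motion. -/
def Ball.posAt (b : Ball) (t : ℝ) : Plane := b.pos + (t - b.time) • b.vel

/-- The ball flies undisturbed during the time set `I`. -/
def Scene.Free (S : Scene) (b : Ball) (I : Set ℝ) : Prop :=
  ∀ t ∈ I, ∀ u', ¬ S.Hits t (b.posAt t) b.vel u'

/-- `b'` is the state of the ball right after the first reflection that follows the state `b`.
A simultaneous collision with components that would change the velocity in different ways
(a corner) has no successor. -/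
def Scene.Bounce (S : Scene) (b b' : Ball) : Prop :=
  b.time < b'.time ∧ b'.pos = b.posAt b'.time ∧ S.Free b (Set.Ioo b.time b'.time) ∧
  S.Hits b'.time b'.pos b.vel b'.vel ∧
  ∀ u', S.Hits b'.time b'.pos b.vel u' → u' = b'.vel

/-- `S.After b₀ k b`: `b` is the state right after the `k`-th reflection of a ball that starts
in state `b₀` (the starting state for `k = 0`). -/
inductive Scene.After (S : Scene) (b₀ : Ball) : ℕ → Ball → Prop
  | zero : Scene.After S b₀ 0 b₀
  | succ {k : ℕ} {b b' : Ball} :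
      Scene.After S b₀ k b → S.Bounce b b' → Scene.After S b₀ (k + 1) b'

/-- The ball that starts in state `b₀` is in `x` with velocity `u` at time `t`, after exactly `k`
reflections. -/
def Scene.BallAt (S : Scene) (b₀ : Ball) (k : ℕ) (t : ℝ) (x u : Plane) : Prop :=
  ∃ b : Ball, S.After b₀ k b ∧ b.time ≤ t ∧ S.Free b (Set.Ioc b.time t) ∧
    x = b.posAt t ∧ u = b.vel

/-! ### Pinball machines with rational data: walls, one-way gates, moving walls -/

/-- A nondegenerate segment with rational start and end position. -/
structure RatSegment where
  fst : ℚ × ℚ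
  snd : ℚ × ℚ
  ne : fst ≠ snd

/-- A moving wall: initial location, direction of the movement, time when the movement starts,
a rational function `num / den` with rational coefficients that describes the displacement
during `[0, t₁)`; during `[t₁, t₂)` the wall moves back (uniformly) to its initial location.
After that the movement is repeated periodically. -/
structure MovingWall where
  loc : RatSegment
  dir : ℚ × ℚ
  start : ℚ
  start_nonneg : 0 ≤ start
  num : Polynomial ℚ
  den : Polynomial ℚ
  t₁ : ℚ
  t₂ : ℚ
  t₁_pos : 0 < t₁
  t₁_lt : t₁ < t₂
  den_ne : ∀ τ : ℝ, 0 ≤ τ → τ ≤ t₁ → Polynomial.aeval τ den ≠ 0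
  num_zero : num.eval 0 = 0

namespace MovingWall

variable (W : MovingWall)

/-- The movement function. -/
def move (τ : ℝ) : ℝ := Polynomial.aeval τ W.num / Polynomial.aeval τ W.den

/-- Time since the beginning of the current period. -/
def phase (t : ℝ) : ℝ := (t - W.start) - W.t₂ * ⌊(t - W.start) / W.t₂⌋

/-- Displacement at time `t`, as a multiple of `dir`. -/
def disp (t : ℝ) : ℝ :=
  if t < W.start then 0
  else if W.phase t < W.t₁ then W.move (W.phase t)
  else W.move W.t₁ * ((W.t₂ - W.phase t) / (W.t₂ - W.t₁))

/-- Speed at time `t`, as a multiple of `dir`. -/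
def speed (t : ℝ) : ℝ :=
  if t < W.start then 0
  else if W.phase t < W.t₁ then deriv W.move (W.phase t)
  else -(W.move W.t₁ / (W.t₂ - W.t₁))

def toMovingSegment : MovingSegment where
  fst := toPlane W.loc.fst
  snd := toPlane W.loc.snd
  shift t := W.disp t • toPlane W.dir
  vel t := W.speed t • toPlane W.dir

end MovingWall

def RatSegment.toMovingSegment (s : RatSegment) : MovingSegment where
  fst := toPlane s.fst
  snd := toPlane s.snd
  shift _ := 0
  vel _ := 0

/-- A pinball machine that consists of plane walls, one-way gates and moving walls only. -/
structure Machine where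
  walls : List RatSegment
  gates : List RatSegment
  movingWalls : List MovingWall

def Machine.toScene (P : Machine) : Scene where
  walls := P.walls.map RatSegment.toMovingSegment ++
    P.movingWalls.map MovingWall.toMovingSegment
  gates := P.gates.map fun g => (toPlane g.fst, toPlane g.snd)

/-! ### Pushdown automata -/

/-- Deterministic pushdown automata with states `Q`, input alphabet `A` and stack alphabet `Γ`.
Below the stack symbols there is a bottom symbol that is never removed. `δ q x X` is the
transition in state `q` that reads the input letter `x` (`none`: no input is read) when the top
of the stack is `X` (`none`: the bottom symbol); it gives the new state and the word that
replaces `X` (that is put on top of the bottom symbol). -/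
structure PDA (Q A Γ : Type*) where
  δ : Q → Option A → Option Γ → Option (Q × List Γ)
  start : Q
  det : ∀ q X, δ q none X ≠ none → ∀ a, δ q (some a) X = none

/-- State, remaining input, and stack (top first, without the bottom symbol). -/
structure Config (Q A Γ : Type*) where
  state : Q
  input : List A
  stack : List Γ

namespace PDA

variable {Q A Γ : Type*} (M : PDA Q A Γ)

/-- One step; `none` if there is no transition. -/
def step (c : Config Q A Γ) : Option (Config Q A Γ) :=
  match M.δ c.state none c.stack.head? with
  | some r => some ⟨r.1, c.input, r.2 ++ c.stack.tail⟩
  | none =>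
    match c.input with
    | [] => none
    | a :: w =>
      (M.δ c.state (some a) c.stack.head?).map fun r => ⟨r.1, w, r.2 ++ c.stack.tail⟩

/-- The configuration after `n` steps, if the automaton has not halted before. -/
def run (c : Config Q A Γ) : ℕ → Option (Config Q A Γ)
  | 0 => some c
  | n + 1 => (run c n).bind M.step

end PDA

/-! ### The stack as a time offset -/

/-- The time offset of a stack of bits: the empty stack has offset `0`, and pushing the bit `b`
changes the offset `Δ` to `(Δ + b) / 4`. -/
def bitsOffset : List Bool → ℝ
  | [] => 0
  | b :: l => ((if b then 1 else 0) + bitsOffset l) / 4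

/-- The time offset of a stack whose symbols (and bottom symbol `none`) are written as blocks of
`ℓ` bits. -/
def stackOffset {Γ : Type*} {ℓ : ℕ} (code : Option Γ ↪ (Fin ℓ → Bool)) (s : List Γ) : ℝ :=
  bitsOffset ((s.map some ++ [none]).flatMap fun X => List.ofFn (code X))

/-- The scene `S` simulates the automaton `M` on the input `w` (with any initial stack), where
the stack is represented by the time offset of a ball of speed `v`.
`port q i` is the point that stands for state `q` and a remaining input of length `i`.
The ball enters at time `0` on the horizontal ray through the port of the initial state, so far
behind the port that it arrives there with the time offset of the initial stack. Then
(1) the ball passes the port of the `n`-th configuration, with velocity `(v, 0)`, at time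
`n * T + Δ`, where `Δ` is the offset of the `n`-th stack;
(2) there are at most `C` reflections between two consecutive of these events;
(3) the ball is in a port at no other time. -/
def Simulates {Q A Γ : Type*} (S : Scene) (M : PDA Q A Γ) {ℓ : ℕ}
    (code : Option Γ ↪ (Fin ℓ → Bool)) (v : ℚ) (w : List A) (T : ℚ)
    (port : Q → ℕ → ℚ × ℚ) (C : ℕ) : Prop :=
  ∀ s₀ : List Γ,
    let c₀ : Config Q A Γ := ⟨M.start, w, s₀⟩
    let b₀ : Ball :=
      ⟨0, toPlane (port M.start w.length) - (stackOffset code s₀ * v, 0), ((v : ℝ), 0)⟩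
    ∃ κ : ℕ → ℕ,
      (∀ n c, M.run c₀ n = some c →
        S.BallAt b₀ (κ n) (n * T + stackOffset code c.stack)
          (toPlane (port c.state c.input.length)) ((v : ℝ), 0)) ∧
      (∀ n, κ n ≤ κ (n + 1) ∧ κ (n + 1) ≤ κ n + C) ∧
      (∀ q i, i ≤ w.length → ∀ k t u, S.BallAt b₀ k t (toPlane (port q i)) u →
        ∃ n c, M.run c₀ n = some c ∧ c.state = q ∧ c.input.length = i ∧
          t = n * T + stackOffset code c.stack)

/-! ### Two accelerating walls -/

/-- A vertical wall that rests at `x = p` until time `σ`; from then on it moves horizontally, and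
`τ` time units after `σ` it has the speed `τ * a τ`. -/
def acceleratingWall (p σ : ℝ) (a : ℝ → ℝ) : MovingSegment where
  fst := (p, -1)
  snd := (p, 1)
  shift t := (∫ x in (0 : ℝ)..max (t - σ) 0, x * a x, 0)
  vel t := (max (t - σ) 0 * a (max (t - σ) 0), 0)

/-- Two accelerating walls at `x = d` and `x = -d`. They start to move at the times `d / v` and
`3 * d / v`, when a ball of speed `v` that leaves the origin to the right at time `0` reaches
them. -/
def twoWalls (v d : ℝ) (a₁ a₂ : ℝ → ℝ) : Scene where
  walls := [acceleratingWall d (d / v) a₁, acceleratingWall (-d) (3 * d / v) a₂]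
  gates := []

end Pinball

end

/-!
A pinball machine simulates a pushdown automaton by delaying the ball. The ball runs to the right on
horizontal lanes, one for every pair of a state and a number of remaining letters; the stack is the
time offset with which it passes the port of its lane. Replacing the top symbol of the stack is an
affine map `Δ ↦ lam * Δ + β` of the offset, where `lam` is a power of `4` and both numbers depend
only on the symbol and on the word that replaces it (`stackOffset_replace`). The top symbol can be
recognized from the offset, because different symbols belong to disjoint time windows
(`abs_stackOffset_sub_le_iff`).

Every transition is realized by a module. A *shutter*, a wall that slides along its own direction,
stands in the way of the ball exactly during the time window of its symbol and deflects it upwards.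
A way up, to the left, down and back to the right brings the ball to its new lane, which it joins at
a one-way gate; the length of the way is chosen such that the ball arrives in time for the constant
`β`. At the two upper corners, *telescopes* turn the ball and scale its offset by `lam`.

A telescope consists of three moving walls with quadratic displacements. They are parallel, at an
angle of `45` degrees to the motion of the ball, so they scale the delay of one component of the
motion, and the perpendicular component is not affected; the second telescope, with a perpendicular
axis, scales that one. In one dimension the task is to find walls such that a ball on
`t ↦ -(t - s)` leaves on `t ↦ t - lam * s - c`. If the offset is written as
`s = τ + ε * τ ^ 2 / 2`, then all meeting times can be taken to be affine in `τ`, all velocities are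
affine in `τ`, and the conditions become polynomial identities that can be solved explicitly
(`Telescope.ofParam`, `nonempty_telescope`). A small `ε` separates the time windows in which the
three walls are used.

`Placement.transit` is the passage through a telescope, `Layout.track_module` the passage through a
module, with eight reflections. Since the motion is deterministic (`Scene.BallAt.unique`), following
the ball from port to port also shows that it is in a port at no other time
(`Layout.ballAt_of_events`, `exists_simulation`).

For two accelerating walls, with `e = (lam - 1) * v / (8 * d)`, a ball with the offset `s` meets
the first wall `s + e * s ^ 2` time units after the start of this wall, where the wall has the
displacement `v * e * s ^ 2`, and the second wall makes the same movement on a scale that is `lam`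
times as large (`twoWalls_scale`). The separation of two ranges of offsets needs only a shutter and
a wall at rest (`exists_separator`).
-/

noncomputable section

namespace Pinball

/-! ### Trajectories -/

@[simp] theorem Ball.posAt_time (b : Ball) : b.posAt b.time = b.pos := by
  simp [Ball.posAt]

theorem Ball.posAt_restart (b : Ball) (t t' : ℝ) :
    (⟨t, b.posAt t, b.vel⟩ : Ball).posAt t' = b.posAt t' := by
  ext <;> simp [Ball.posAt] <;> ring

namespace Scene

variable {S : Scene}

theorem BallAt.fly {b : Ball} {t : ℝ} (h : b.time ≤ t) (hf : S.Free b (Set.Ioc b.time t)) :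
    S.BallAt b 0 t (b.posAt t) b.vel :=
  ⟨b, .zero, h, hf, rfl, rfl⟩

theorem After.time_le {b₀ b : Ball} {k : ℕ} (h : S.After b₀ k b) : b₀.time ≤ b.time := by
  induction h with
  | zero => exact le_rfl
  | succ _ hb ih => exact ih.trans hb.1.le

theorem BallAt.time_le {b₀ : Ball} {k : ℕ} {t : ℝ} {x u : Plane} (h : S.BallAt b₀ k t x u) :
    b₀.time ≤ t := by
  obtain ⟨b, hb, h, -⟩ := h
  exact hb.time_le.trans h

/-- The motion of the ball may be restarted from any intermediate state. -/
theorem BallAt.trans {b₀ : Ball} {k k' : ℕ} {t t' : ℝ} {x u x' u' : Plane}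
    (h : S.BallAt b₀ k t x u) (h' : S.BallAt ⟨t, x, u⟩ k' t' x' u') :
    S.BallAt b₀ (k + k') t' x' u' := by
  obtain ⟨b, hb, hbt, hfree, rfl, rfl⟩ := h
  obtain ⟨c, hc, hct, hcfree, rfl, rfl⟩ := h'
  have key : ∀ (j : ℕ) (c : Ball), S.After ⟨t, b.posAt t, b.vel⟩ j c →
      (j = 0 ∧ c = ⟨t, b.posAt t, b.vel⟩) ∨ S.After b₀ (k + j) c := by
    intro j c hc
    induction hc with
    | zero => exact .inl ⟨rfl, rfl⟩
    | @succ j d d' _ hdd ih =>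
      right
      rcases ih with ⟨rfl, rfl⟩ | ih
      · obtain ⟨h1, h2, h3, h4, h5⟩ := hdd
        refine .succ hb ⟨hbt.trans_lt h1, ?_, ?_, h4, h5⟩
        · rw [h2, Ball.posAt_restart]
        · intro s hs u'
          rcases le_or_gt s t with hst | hst
          · exact hfree s ⟨hs.1, hst⟩ u'
          · have := h3 s ⟨hst, hs.2⟩ u'
            rwa [Ball.posAt_restart] at this
      · exact .succ ih hdd
  rcases key k' c hc with ⟨rfl, rfl⟩ | hc'
  · refine ⟨b, hb, hbt.trans hct, ?_, Ball.posAt_restart _ _ _, rfl⟩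
    intro s hs u'
    rcases le_or_gt s t with hst | hst
    · exact hfree s ⟨hs.1, hst⟩ u'
    · have := hcfree s ⟨hst, hs.2⟩ u'
      rwa [Ball.posAt_restart] at this
  · exact ⟨c, hc', hct, hcfree, rfl, rfl⟩

theorem Bounce.unique {b c c' : Ball} (h : S.Bounce b c) (h' : S.Bounce b c') : c = c' := by
  have ht : ∀ {c c' : Ball}, S.Bounce b c → S.Bounce b c' → ¬ c.time < c'.time := by
    intro c c' h h' hlt
    refine h'.2.2.1 c.time ⟨h.1, hlt⟩ c.vel ?_
    rw [← h.2.1]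
    exact h.2.2.2.1
  have hte : c.time = c'.time := le_antisymm (not_lt.1 (ht h' h)) (not_lt.1 (ht h h'))
  have hp : c.pos = c'.pos := by rw [h.2.1, h'.2.1, hte]
  have hv : c.vel = c'.vel := by
    refine h'.2.2.2.2 c.vel ?_
    rw [← hte, ← hp]
    exact h.2.2.2.1
  cases c; cases c'
  simp_all

theorem After.unique {b₀ b b' : Ball} {k : ℕ} (h : S.After b₀ k b) (h' : S.After b₀ k b') :
    b = b' := by
  induction h generalizing b' with
  | zero => cases h'; rfl
  | succ _ hb ih =>
    cases h' with
    | succ h1 h2 =>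
      rw [← ih h1] at h2
      exact hb.unique h2

theorem After.exists_bounce {b₀ b' : Ball} {k k' : ℕ} (h : S.After b₀ k' b') (hk : k < k') :
    ∃ b c, S.After b₀ k b ∧ S.Bounce b c ∧ c.time ≤ b'.time := by
  induction h with
  | zero => omega
  | @succ j d d' h1 h2 ih =>
    rcases Nat.lt_succ_iff_lt_or_eq.1 hk with hk | rfl
    · obtain ⟨b, c, hb, hc, hle⟩ := ih hk
      exact ⟨b, c, hb, hc, hle.trans h2.1.le⟩
    · exact ⟨d, d', h1, h2, le_rfl⟩

/-- The motion of the ball is deterministic. -/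
theorem BallAt.unique {b₀ : Ball} {k k' : ℕ} {t : ℝ} {x u x' u' : Plane}
    (h : S.BallAt b₀ k t x u) (h' : S.BallAt b₀ k' t x' u') : x = x' := by
  have hlt : ∀ {k k' : ℕ} {x u x' u' : Plane}, S.BallAt b₀ k t x u → S.BallAt b₀ k' t x' u' →
      ¬ k < k' := by
    rintro k k' x u x' u' ⟨b, hb, -, hf, -⟩ ⟨b', hb', hbt', -⟩ hk
    obtain ⟨c, c', hc, hcc, hle⟩ := hb'.exists_bounce hk
    obtain rfl := hb.unique hc
    refine hf c'.time ⟨hcc.1, hle.trans hbt'⟩ c'.vel ?_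
    rw [← hcc.2.1]
    exact hcc.2.2.2.1
  obtain rfl : k = k' := le_antisymm (not_lt.1 (hlt h' h)) (not_lt.1 (hlt h h'))
  obtain ⟨b, hb, -, -, rfl, -⟩ := h
  obtain ⟨b', hb', -, -, rfl, -⟩ := h'
  rw [hb.unique hb']

/-- The ball that starts in state `b` is in state `b'` after `k` reflections, and in between it
stays outside of `Z`. -/
def Track (S : Scene) (Z : Set Plane) (b : Ball) (k : ℕ) (b' : Ball) : Prop :=
  S.BallAt b k b'.time b'.pos b'.vel ∧
    ∀ t ∈ Set.Ioo b.time b'.time, ∃ j x u, S.BallAt b j t x u ∧ x ∉ Z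

theorem Track.trans {Z : Set Plane} {b b' b'' : Ball} {k k' : ℕ} (h : S.Track Z b k b')
    (hZ : b'.pos ∉ Z) (h' : S.Track Z b' k' b'') : S.Track Z b (k + k') b'' := by
  refine ⟨h.1.trans h'.1, fun t ht => ?_⟩
  rcases lt_trichotomy t b'.time with hlt | rfl | hlt
  · exact h.2 t ⟨ht.1, hlt⟩
  · exact ⟨k, _, _, h.1, hZ⟩
  · obtain ⟨j, x, u, hj, hx⟩ := h'.2 t ⟨hlt, ht.2⟩
    exact ⟨_, x, u, h.1.trans hj, hx⟩

theorem Track.fly {Z : Set Plane} {b : Ball} {t : ℝ} (h : b.time ≤ t)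
    (hf : S.Free b (Set.Ioc b.time t)) (hZ : ∀ s ∈ Set.Ioo b.time t, b.posAt s ∉ Z) :
    S.Track Z b 0 ⟨t, b.posAt t, b.vel⟩ :=
  ⟨.fly h hf, fun s hs => ⟨0, _, _, .fly hs.1.le fun r hr => hf r ⟨hr.1, hr.2.trans hs.2.le⟩,
    hZ s hs⟩⟩

/-- A straight piece of the trajectory that ends with a reflection at time `t₁`. -/
theorem bounce_of_leg {b : Ball} {t₁ : ℝ} {u' : Plane} (ht : b.time < t₁)
    (hw : ∀ t ∈ Set.Ioc b.time t₁, ∀ m ∈ S.walls, b.posAt t ∈ m.at t →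
      t = t₁ ∧ reflect (m.snd - m.fst) (m.vel t) b.vel = u')
    (hg : ∀ t ∈ Set.Ioc b.time t₁, ∀ g ∈ S.gates, b.posAt t ∈ segment ℝ g.1 g.2 →
      0 < cross (g.2 - g.1) b.vel → t = t₁ ∧ reflect (g.2 - g.1) 0 b.vel = u')
    (hit : (∃ m ∈ S.walls, b.posAt t₁ ∈ m.at t₁) ∨
      ∃ g ∈ S.gates, b.posAt t₁ ∈ segment ℝ g.1 g.2 ∧ 0 < cross (g.2 - g.1) b.vel) :
    S.Bounce b ⟨t₁, b.posAt t₁, u'⟩ := by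
  refine ⟨ht, rfl, ?_, ?_, ?_⟩
  · rintro t ⟨h1, h2⟩ u (⟨m, hm, hx, -⟩ | ⟨g, hgm, hx, hc, -⟩)
    · exact h2.ne (hw t ⟨h1, h2.le⟩ m hm hx).1
    · exact h2.ne (hg t ⟨h1, h2.le⟩ g hgm hx hc).1
  · rcases hit with ⟨m, hm, hx⟩ | ⟨g, hgm, hx, hc⟩
    · exact .inl ⟨m, hm, hx, (hw t₁ ⟨ht, le_rfl⟩ m hm hx).2.symm⟩
    · exact .inr ⟨g, hgm, hx, hc, (hg t₁ ⟨ht, le_rfl⟩ g hgm hx hc).2.symm⟩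
  · rintro u (⟨m, hm, hx, rfl⟩ | ⟨g, hgm, hx, hc, rfl⟩)
    · exact (hw t₁ ⟨ht, le_rfl⟩ m hm hx).2
    · exact (hg t₁ ⟨ht, le_rfl⟩ g hgm hx hc).2

theorem BallAt.bounce {b b' : Ball} (h : S.Bounce b b') :
    S.BallAt b 1 b'.time b'.pos b'.vel :=
  ⟨b', .succ .zero h, le_rfl, by simp [Free], by simp, rfl⟩

theorem Track.bounce {Z : Set Plane} {b b' : Ball} (h : S.Bounce b b')
    (hZ : ∀ s ∈ Set.Ioo b.time b'.time, b.posAt s ∉ Z) : S.Track Z b 1 b' :=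
  ⟨.bounce h, fun s hs => ⟨0, _, _,
    .fly hs.1.le fun r hr => h.2.2.1 r ⟨hr.1, hr.2.trans_lt hs.2⟩, hZ s hs⟩⟩

theorem free_of_forall {b : Ball} {I : Set ℝ}
    (hw : ∀ t ∈ I, ∀ m ∈ S.walls, b.posAt t ∉ m.at t)
    (hg : ∀ t ∈ I, ∀ g ∈ S.gates, b.posAt t ∈ segment ℝ g.1 g.2 → ¬ 0 < cross (g.2 - g.1) b.vel) :
    S.Free b I := by
  rintro t ht u (⟨m, hm, hx, -⟩ | ⟨g, hgm, hx, hc, -⟩)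
  · exact hw t ht m hm hx
  · exact hg t ht g hgm hx hc

end Scene

theorem reflect_smul {c : ℝ} (hc : c ≠ 0) (d w u : Plane) :
    reflect (c • d) w u = reflect d w u := by
  have h1 : normal (c • d) = c • normal d := by ext <;> simp [normal]
  have h2 : ∀ a : Plane, dot a (c • normal d) = c * dot a (normal d) := by
    intro a; simp [dot]; ring
  have h3 : dot (c • normal d) (normal d) = c * dot (normal d) (normal d) := by
    simp [dot]; ring
  rw [reflect, reflect, h1, h2, h2, h3, smul_smul]
  congr 2
  rcases eq_or_ne (dot (normal d) (normal d)) 0 with h0 | h0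
  · simp [h0]
  · field_simp

/-! ### Walls with quadratic displacement -/

/-- A moving wall in parametric form: the segment `base + l • d` for `lo ≤ l ≤ hi`, which is
displaced by `(β * τ + γ * τ ^ 2) • dir` at the time `τ ∈ [0, t₁)` of each period. -/
structure Bar where
  base : ℚ × ℚ
  d : ℚ × ℚ
  d_ne : d ≠ 0
  lo : ℚ
  hi : ℚ
  lo_lt : lo < hi
  dir : ℚ × ℚ
  start : ℚ
  start_nonneg : 0 ≤ start
  β : ℚ
  γ : ℚ
  t₁ : ℚ
  t₂ : ℚ
  t₁_pos : 0 < t₁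
  t₁_lt : t₁ < t₂

namespace Bar

variable (B : Bar)

open Polynomial in
/-- The bar as a component of a pinball machine. -/
def wall : MovingWall where
  loc :=
    { fst := B.base + B.lo • B.d
      snd := B.base + B.hi • B.d
      ne := by
        intro h
        have h' : (B.lo - B.hi) • B.d = 0 := by
          rw [sub_smul, add_left_cancel h, sub_self]
        rcases smul_eq_zero.1 h' with h0 | h0
        · exact (sub_neg.2 B.lo_lt).ne h0
        · exact B.d_ne h0 }
  dir := B.dir
  start := B.start
  start_nonneg := B.start_nonneg
  num := C B.β * X + C B.γ * X ^ 2
  den := 1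
  t₁ := B.t₁
  t₂ := B.t₂
  t₁_pos := B.t₁_pos
  t₁_lt := B.t₁_lt
  den_ne := by simp
  num_zero := by simp

/-- The points of the bar at time `t`. -/
def pts (t : ℝ) : Set Plane := B.wall.toMovingSegment.at t

theorem move_eq : B.wall.move = fun τ : ℝ => B.β * τ + B.γ * τ ^ 2 := by
  funext τ
  simp [MovingWall.move, wall]

theorem t₂_pos : (0 : ℝ) < B.t₂ := by exact_mod_cast B.t₁_pos.trans B.t₁_lt

theorem phase_eq (n : ℕ) {τ : ℝ} (h0 : 0 ≤ τ) (h1 : τ < B.t₁) :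
    B.wall.phase (B.start + n * B.t₂ + τ) = τ := by
  have h2 := B.t₂_pos
  have h3 : (B.t₁ : ℝ) < B.t₂ := by exact_mod_cast B.t₁_lt
  have hfl : ⌊((B.start : ℝ) + n * B.t₂ + τ - B.start) / B.t₂⌋ = n := by
    rw [Int.floor_eq_iff]
    constructor
    · rw [le_div_iff₀ h2]; push_cast; linarith
    · rw [div_lt_iff₀ h2]; push_cast; linarith
  show (B.start : ℝ) + n * B.t₂ + τ - B.start - B.t₂ *
    ⌊((B.start : ℝ) + n * B.t₂ + τ - B.start) / B.t₂⌋ = τ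
  rw [hfl]
  push_cast
  ring

theorem not_lt_start (n : ℕ) {τ : ℝ} (h0 : 0 ≤ τ) :
    ¬ (B.start : ℝ) + n * B.t₂ + τ < B.wall.start := by
  have := mul_nonneg (Nat.cast_nonneg (α := ℝ) n) B.t₂_pos.le
  show ¬ (B.start : ℝ) + n * B.t₂ + τ < B.start
  linarith

theorem disp_eq (n : ℕ) {τ : ℝ} (h0 : 0 ≤ τ) (h1 : τ < B.t₁) :
    B.wall.disp (B.start + n * B.t₂ + τ) = B.β * τ + B.γ * τ ^ 2 := by
  rw [MovingWall.disp, if_neg (B.not_lt_start n h0), B.phase_eq n h0 h1,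
    if_pos (show τ < (B.wall.t₁ : ℝ) from h1), move_eq]

theorem speed_eq (n : ℕ) {τ : ℝ} (h0 : 0 ≤ τ) (h1 : τ < B.t₁) :
    B.wall.speed (B.start + n * B.t₂ + τ) = B.β + 2 * B.γ * τ := by
  rw [MovingWall.speed, if_neg (B.not_lt_start n h0), B.phase_eq n h0 h1,
    if_pos (show τ < (B.wall.t₁ : ℝ) from h1), move_eq]
  have : HasDerivAt (fun τ : ℝ => B.β * τ + B.γ * τ ^ 2) (B.β * 1 + B.γ * (2 * τ ^ 1 * 1)) τ := by
    refine ((hasDerivAt_id τ).const_mul (B.β : ℝ)).add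
      ((HasDerivAt.congr_deriv ((hasDerivAt_id τ).pow 2) ?_).const_mul (B.γ : ℝ))
    simp
  rw [this.deriv]
  ring

/-- At any time, also while the wall moves back, its displacement lies between `0` and a value
that the movement function takes. -/
theorem exists_disp_eq (t : ℝ) : ∃ θ ∈ Set.Icc (0 : ℝ) 1, ∃ τ ∈ Set.Icc (0 : ℝ) B.t₁,
    B.wall.disp t = θ * (B.β * τ + B.γ * τ ^ 2) := by
  have h1 : (0 : ℝ) < B.t₁ := by exact_mod_cast B.t₁_pos
  have h2 := B.t₂_pos
  have h3 : (B.t₁ : ℝ) < B.t₂ := by exact_mod_cast B.t₁_lt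
  have hph : 0 ≤ B.wall.phase t ∧ B.wall.phase t < B.t₂ := by
    have e : B.wall.phase t = (t - B.start) - B.t₂ * ⌊(t - B.start) / B.t₂⌋ := rfl
    have ha := Int.floor_le ((t - B.start) / B.t₂)
    have hb := Int.lt_floor_add_one ((t - B.start) / B.t₂)
    rw [le_div_iff₀ h2] at ha
    rw [div_lt_iff₀ h2] at hb
    rw [e]
    constructor <;> linarith
  rw [MovingWall.disp]
  split_ifs with ha hb
  · exact ⟨0, by simp, 0, ⟨le_rfl, h1.le⟩, by simp⟩
  · exact ⟨1, by simp, _, ⟨hph.1, le_of_lt hb⟩, by rw [move_eq, one_mul]⟩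
  · have hb' : (B.t₁ : ℝ) ≤ B.wall.phase t := not_lt.1 hb
    refine ⟨(B.t₂ - B.wall.phase t) / (B.t₂ - B.t₁), ⟨?_, ?_⟩, B.t₁, ⟨h1.le, le_rfl⟩, ?_⟩
    · exact div_nonneg (by linarith) (by linarith)
    · rw [div_le_one (by linarith)]; linarith
    · rw [move_eq, mul_comm]; rfl

theorem mem_pts {B : Bar} {t : ℝ} {x : Plane} : x ∈ B.pts t ↔ ∃ l ∈ Set.Icc (B.lo : ℝ) B.hi,
    x = (B.base.1 + l * B.d.1 + B.wall.disp t * B.dir.1,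
      B.base.2 + l * B.d.2 + B.wall.disp t * B.dir.2) := by
  have hlt : (B.lo : ℝ) < B.hi := by exact_mod_cast B.lo_lt
  have key : B.pts t = segment ℝ
      ((B.base.1 + B.lo * B.d.1 + B.wall.disp t * B.dir.1,
        B.base.2 + B.lo * B.d.2 + B.wall.disp t * B.dir.2) : Plane)
      (B.base.1 + B.hi * B.d.1 + B.wall.disp t * B.dir.1,
        B.base.2 + B.hi * B.d.2 + B.wall.disp t * B.dir.2) := by
    simp only [Bar.pts, MovingSegment.at, MovingWall.toMovingSegment]
    congr 1 <;> ext <;> simp [toPlane, wall]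
  rw [key, segment_eq_image]
  constructor
  · rintro ⟨θ, ⟨h0, h1⟩, rfl⟩
    refine ⟨B.lo + θ * (B.hi - B.lo), ⟨by nlinarith, by nlinarith⟩, ?_⟩
    ext <;> simp <;> ring
  · rintro ⟨l, ⟨h0, h1⟩, rfl⟩
    have hne : (B.hi : ℝ) - B.lo ≠ 0 := by linarith
    refine ⟨(l - B.lo) / (B.hi - B.lo), ⟨div_nonneg (by linarith) (by linarith), ?_⟩, ?_⟩
    · rw [div_le_one (by linarith)]; linarith
    · ext <;> simp <;> field_simp <;> ring

theorem reflect_eq (t : ℝ) (u : Plane) :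
    reflect (B.wall.toMovingSegment.snd - B.wall.toMovingSegment.fst)
      (B.wall.toMovingSegment.vel t) u =
    reflect (toPlane B.d) (B.wall.speed t * B.dir.1, B.wall.speed t * B.dir.2) u := by
  have hne : (B.hi : ℝ) - B.lo ≠ 0 := by
    have : (B.lo : ℝ) < B.hi := by exact_mod_cast B.lo_lt
    linarith
  have e : B.wall.toMovingSegment.snd - B.wall.toMovingSegment.fst =
      ((B.hi : ℝ) - B.lo) • toPlane B.d := by
    ext <;> simp [MovingWall.toMovingSegment, toPlane, wall] <;> ring
  have e' : B.wall.toMovingSegment.vel t = (B.wall.speed t * B.dir.1, B.wall.speed t * B.dir.2) := by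
    ext <;> simp [MovingWall.toMovingSegment, toPlane, wall]
  rw [e, e', reflect_smul hne]

end Bar

/-! ### Telescopes: scaling a time offset with three walls -/

/-- A wall on a line, with a quadratic motion near the time `D`: at time `D + x` it is at
`α + β * x + γ * x ^ 2`. -/
structure QuadWall where
  D : ℚ
  α : ℚ
  β : ℚ
  γ : ℚ

namespace QuadWall

/-- Position at `x` time units after `D`. -/
def pos (w : QuadWall) (x : ℝ) : ℝ := w.α + w.β * x + w.γ * x ^ 2

/-- Velocity at `x` time units after `D`. -/
def vel (w : QuadWall) (x : ℝ) : ℝ := w.β + 2 * w.γ * x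

/-- A ball on the line that moves on `t ↦ p + u * t` meets the wall at a time `t` with
`|t - D| ≤ K`, and moves on `t ↦ p' + u' * t` afterwards. By `transversal` there is no other
meeting within the time `2 * R`. -/
structure Turn (w : QuadWall) (R K p u p' u' t : ℝ) : Prop where
  near : |t - w.D| ≤ K
  hit : w.pos (t - w.D) = p + u * t
  vel_eq : u' = 2 * w.vel (t - w.D) - u
  cont : p' + u' * t = p + u * t
  transversal : 2 * R * |(w.γ : ℝ)| < |w.vel (t - w.D) - u|

variable {w : QuadWall} {R K p u p' u' t : ℝ}

theorem Turn.pos_sub (h : w.Turn R K p u p' u' t) (t' : ℝ) : w.pos (t' - w.D) - (p + u * t') =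
    (t' - t) * ((w.vel (t - w.D) - u) + w.γ * (t' - t)) := by
  have := h.hit
  simp only [pos, vel] at *
  linear_combination this

theorem Turn.pos_sub' (h : w.Turn R K p u p' u' t) (t' : ℝ) : w.pos (t' - w.D) - (p' + u' * t') =
    (t' - t) * (-(w.vel (t - w.D) - u) + w.γ * (t' - t)) := by
  have h1 := h.hit
  have h2 := h.cont
  have h3 := h.vel_eq
  subst h3
  simp only [pos, vel] at *
  linear_combination h1 - h2

theorem Turn.abs_lt (h : w.Turn R K p u p' u' t) (hKR : K ≤ R) {t' : ℝ} (ht' : |t' - w.D| ≤ R) :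
    |(w.γ : ℝ) * (t' - t)| < |w.vel (t - w.D) - u| := by
  refine lt_of_le_of_lt ?_ h.transversal
  rw [abs_mul, mul_comm]
  refine mul_le_mul_of_nonneg_right ?_ (abs_nonneg _)
  have h1 := abs_le.1 (h.near.trans hKR)
  have h2 := abs_le.1 ht'
  rw [abs_le]
  constructor <;> linarith

/-- Before the meeting, the ball does not meet the wall. -/
theorem Turn.ne_before (h : w.Turn R K p u p' u' t) (hKR : K ≤ R) {t' : ℝ}
    (ht' : |t' - w.D| ≤ R) (hne : t' ≠ t) : w.pos (t' - w.D) ≠ p + u * t' := by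
  have h1 := h.abs_lt hKR ht'
  rw [← sub_ne_zero, h.pos_sub]
  refine mul_ne_zero (sub_ne_zero.2 hne) fun h0 => ?_
  rw [show w.vel (t - w.D) - u = -(w.γ * (t' - t)) by linarith, abs_neg] at h1
  exact lt_irrefl _ h1

/-- After the meeting, the ball does not meet the wall a second time. -/
theorem Turn.ne_after (h : w.Turn R K p u p' u' t) (hKR : K ≤ R) {t' : ℝ}
    (ht' : |t' - w.D| ≤ R) (hne : t' ≠ t) : w.pos (t' - w.D) ≠ p' + u' * t' := by
  have h1 := h.abs_lt hKR ht'
  rw [← sub_ne_zero, h.pos_sub']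
  refine mul_ne_zero (sub_ne_zero.2 hne) fun h0 => ?_
  rw [show w.vel (t - w.D) - u = w.γ * (t' - t) by linarith] at h1
  exact lt_irrefl _ h1

end QuadWall

/-- Three walls on a line that scale the time offset of a ball of speed `1` by the factor `lam`:
a ball that moves on `t ↦ -(t - s)` for some `s ∈ [0, 1/2]` meets the three walls one after the
other, and moves on `t ↦ t - lam * s - c` in the end. The walls are used in disjoint time windows
of radius `R = K + 2 * lam + 3` around their times `D`. -/
structure Telescope (lam : ℚ) where
  w₁ : QuadWall
  w₂ : QuadWall
  w₃ : QuadWall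
  K : ℚ
  c : ℚ
  K_nonneg : 0 ≤ K
  D₁_nonneg : 0 ≤ w₁.D
  gap₁ : w₁.D + 2 * (K + 2 * lam + 3) ≤ w₂.D
  gap₂ : w₂.D + 2 * (K + 2 * lam + 3) ≤ w₃.D
  path : ∀ s ∈ Set.Icc (0 : ℝ) (1 / 2), ∃ t₁ t₂ t₃ p₁ u₁ p₂ u₂ : ℝ,
    w₁.Turn (K + 2 * lam + 3) K s (-1) p₁ u₁ t₁ ∧
    w₂.Turn (K + 2 * lam + 3) K p₁ u₁ p₂ u₂ t₂ ∧
    w₃.Turn (K + 2 * lam + 3) K p₂ u₂ (-lam * s - c) 1 t₃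

/-- Three walls at rest. -/
def Telescope.rest : Telescope 1 where
  w₁ := ⟨0, 0, 0, 0⟩
  w₂ := ⟨12, 12, 0, 0⟩
  w₃ := ⟨24, 0, 0, 0⟩
  K := 1
  c := 24
  K_nonneg := by norm_num
  D₁_nonneg := le_rfl
  gap₁ := by norm_num
  gap₂ := by norm_num
  path := by
    rintro s ⟨h0, h1⟩
    refine ⟨s, s + 12, s + 24, -s, 1, s + 24, -1, ?_, ?_, ?_⟩
    all_goals
      constructor <;> simp [QuadWall.pos, QuadWall.vel] <;>
        first | (rw [abs_le]; constructor <;> linarith) | linarith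

open Filter Topology in
theorem eventually_mul_lt (A : ℚ) {c : ℚ} (hc : 0 < c) : ∀ᶠ δ in 𝓝[>] (0 : ℚ), δ * A < c := by
  have : Tendsto (fun δ : ℚ => δ * A) (𝓝[>] 0) (𝓝 (0 * A)) :=
    ((continuous_id.mul continuous_const).tendsto 0).mono_left nhdsWithin_le_nhds
  rw [zero_mul] at this
  exact this.eventually (gt_mem_nhds hc)

/-- The quadratic solution of the equations for three walls, with a small parameter `ε`. The ball
with time offset `s = τ + ε * τ ^ 2 / 2` meets the walls at the times `τ`, `D₂ + r * τ` and
`D₃ + μ * τ`, where `D₂ = g / ε` and `D₃ = D₂ + g' / ε`. Since its velocity after the first two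
reflections is affine in `τ`, the three meeting conditions are polynomial identities of degree `2`
in `τ`; they are solved by rational functions `r`, `μ`, `b`, `g` and `g'` of `lam`. The bounds `c0` to `c3` make `ε` so small that the ball crosses the walls
transversally, and `c5`, `c6` make the walls so far apart in time that their windows are
disjoint. -/
def Telescope.ofParam (lam ε r μ b g g' : ℚ) (h3 : 3 - lam ≠ 0) (h13 : 1 - 3 * lam ≠ 0)
    (hlam : 0 < lam) (hε : ε ≠ 0) (hr : r = 3 * (3 - lam) / 8)
    (hμ : μ = lam * (lam - 3) / (1 - 3 * lam)) (hb : b = 4 * (1 - lam) / (3 - lam))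
    (hg : g = (11 - 9 * lam) / 16) (hg' : g' = (3 - lam) ^ 2 / (16 * (1 - 3 * lam)))
    (R : ℚ) (hR : R = 1 + |r| + |μ| + 2 * lam + 3)
    (c0 : |ε| ≤ 1 / 2)
    (c1 : |ε| * R < 1 / 2)
    (c2 : |ε| * (2 * R * |(2 * r - 3 / 2) / r ^ 2| + |b - 2|) < |b - 1|)
    (c3 : |ε| * (2 * R * |(b - 1) / (2 * μ)|) < |b - 1| / 2)
    (c5 : 2 * R ≤ g / ε) (c6 : 2 * R ≤ g' / ε) : Telescope lam where
  w₁ := ⟨0, 0, 0, ε / 2⟩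
  w₂ := ⟨g / ε, g / ε, b, ε * ((2 * r - 3 / 2) / r ^ 2)⟩
  w₃ := ⟨g / ε + g' / ε, g / ε + (2 * b - 1) * (g' / ε), b, ε * ((b - 1) / (2 * μ))⟩
  K := 1 + |r| + |μ|
  c := -(3 - lam) / (8 * ε)
  K_nonneg := by positivity
  D₁_nonneg := le_rfl
  gap₁ := by rw [← hR]; simpa using c5
  gap₂ := by rw [← hR]; simpa using c6
  path := by
    rintro s ⟨hs0, hs1⟩
    have e0 : |(ε : ℝ)| ≤ 1 / 2 := by
      have h := (Rat.cast_le (K := ℝ)).2 c0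
      push_cast at h; exact h
    have e0' := abs_le.1 e0
    have ea0 : 0 ≤ |(ε : ℝ)| := abs_nonneg _
    have hRR : ((1 + |r| + |μ| : ℚ) : ℝ) + 2 * lam + 3 = (R : ℝ) := by rw [hR]; push_cast; ring
    have hR0 : (0 : ℝ) ≤ R := by
      have : (0 : ℚ) ≤ R := by rw [hR]; positivity
      exact_mod_cast this
    -- the parameter of the ball exists by the intermediate value theorem
    obtain ⟨τ, ⟨hτ0, hτ1⟩, hτ⟩ : ∃ τ ∈ Set.Icc (0 : ℝ) 1, τ + ε * τ ^ 2 / 2 = s := by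
      have hc : ContinuousOn (fun τ : ℝ => τ + ε * τ ^ 2 / 2) (Set.Icc 0 1) := by fun_prop
      refine intermediate_value_Icc zero_le_one hc ⟨?_, ?_⟩
      · simpa using hs0
      · show s ≤ 1 + ε * 1 ^ 2 / 2
        linarith [e0'.1]
    have hετ : |(ε : ℝ) * τ| ≤ |(ε : ℝ)| := by
      rw [abs_mul, abs_of_nonneg hτ0]
      exact mul_le_of_le_one_right ea0 hτ1
    have hετ' := abs_le.1 (hετ.trans e0)
    have k1 : (|(ε : ℝ)| * R : ℝ) < 1 / 2 := by
      have h := (Rat.cast_lt (K := ℝ)).2 c1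
      push_cast at h; exact h
    have k2 : |(ε : ℝ)| * (2 * R * |(2 * (r : ℝ) - 3 / 2) / r ^ 2| + |(b : ℝ) - 2|) <
        |(b : ℝ) - 1| := by
      have h := (Rat.cast_lt (K := ℝ)).2 c2
      push_cast at h; exact h
    have k3 : |(ε : ℝ)| * (2 * R * |((b : ℝ) - 1) / (2 * μ)|) < |(b : ℝ) - 1| / 2 := by
      have h := (Rat.cast_lt (K := ℝ)).2 c3
      push_cast at h; exact h
    have hε' : (ε : ℝ) ≠ 0 := by exact_mod_cast hε
    have h3' : (3 : ℝ) - lam ≠ 0 := by exact_mod_cast h3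
    have h13' : (1 : ℝ) - 3 * lam ≠ 0 := by exact_mod_cast h13
    have h3'' : (lam : ℝ) - 3 ≠ 0 := by intro h; apply h3'; linarith
    have hl' : (lam : ℝ) ≠ 0 := by exact_mod_cast hlam.ne'
    have hr' : (r : ℝ) = 3 * (3 - lam) / 8 := by rw [hr]; push_cast; ring
    have hμ' : (μ : ℝ) = lam * (lam - 3) / (1 - 3 * lam) := by rw [hμ]; push_cast; ring
    have hb' : (b : ℝ) = 4 * (1 - lam) / (3 - lam) := by rw [hb]; push_cast; ring
    have hgr : (g : ℝ) = (11 - 9 * lam) / 16 := by rw [hg]; push_cast; ring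
    have hgr' : (g' : ℝ) = (3 - lam) ^ 2 / (16 * (1 - 3 * lam)) := by rw [hg']; push_cast; ring
    have hr0 : (r : ℝ) ≠ 0 := by
      rw [hr']; exact div_ne_zero (mul_ne_zero (by norm_num) h3') (by norm_num)
    have hμ0 : (μ : ℝ) ≠ 0 := by
      rw [hμ']; exact div_ne_zero (mul_ne_zero hl' h3'') h13'
    have hb1 : (b : ℝ) - 1 = (1 - 3 * lam) / (3 - lam) := by rw [hb']; field_simp; ring
    have f1 : ((b : ℝ) - 1) * μ = -lam := by
      rw [hb1, hμ', show (lam : ℝ) - 3 = -(3 - lam) by ring]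
      generalize (3 : ℝ) - lam = k at *
      generalize (1 : ℝ) - 3 * lam = m at *
      field_simp
    have f2 : ((b : ℝ) - 1) * g' = (3 - lam) / 16 := by
      rw [hb1, hgr']
      generalize (3 : ℝ) - lam = k at *
      generalize (1 : ℝ) - 3 * lam = m at *
      field_simp
    have f3 : ((b : ℝ) - 1) * r = 3 * (1 - 3 * lam) / 8 := by
      rw [hb1, hr']
      generalize (3 : ℝ) - lam = k at *
      field_simp
    have q1 : (ε : ℝ) * (g / ε) = g := mul_div_cancel₀ _ hε'
    have q2 : (ε : ℝ) * (g' / ε) = g' := mul_div_cancel₀ _ hε'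
    have near : ∀ x : ℝ, |x| ≤ 1 + |(r : ℝ)| + |(μ : ℝ)| → |x * τ| ≤ 1 + |(r : ℝ)| + |(μ : ℝ)| := by
      intro x hx
      rw [abs_mul, abs_of_nonneg hτ0]
      exact (mul_le_of_le_one_right (abs_nonneg x) hτ1).trans hx
    have hrn := abs_nonneg (r : ℝ)
    have hμn := abs_nonneg (μ : ℝ)
    have vel2 : (b : ℝ) + 2 * (ε * ((2 * r - 3 / 2) / r ^ 2)) * (r * τ) = b * (1 + ε * τ) := by
      rw [hb', hr']; field_simp; ring
    have vel3 : (b : ℝ) + 2 * (ε * ((b - 1) / (2 * μ))) * (μ * τ) = b + ε * τ * (b - 1) := by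
      field_simp
    refine ⟨τ, g / ε + r * τ, g / ε + g' / ε + μ * τ,
      ε * τ ^ 2 / 2 - (1 + 2 * ε * τ) * τ, 1 + 2 * ε * τ,
      ε * τ ^ 2 / 2 + (1 + 2 * ε * τ) * (g / ε + r * τ - τ) -
        (2 * b - 1 + ε * τ * (2 * b - 2)) * (g / ε + r * τ),
      2 * b - 1 + ε * τ * (2 * b - 2), ?_, ?_, ?_⟩
    · rw [hRR]
      constructor
      · push_cast
        have := near 1 (by rw [abs_one]; linarith)
        simpa using this
      · simp only [QuadWall.pos]; push_cast; linear_combination hτ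
      · simp only [QuadWall.vel]; push_cast; ring
      · linear_combination hτ
      · simp only [QuadWall.vel]
        push_cast
        rw [abs_div, abs_of_pos (show (0 : ℝ) < 2 by norm_num)]
        refine lt_of_lt_of_le ?_ (le_abs_self _)
        linarith [hετ'.1]
    · rw [hRR]
      constructor
      · push_cast
        have := near r (by linarith)
        simpa using this
      · simp only [QuadWall.pos]; push_cast
        rw [add_sub_cancel_left, hb', hr', hgr]; field_simp; ring
      · simp only [QuadWall.vel]; push_cast
        rw [add_sub_cancel_left, vel2]; ring
      · ring
      · simp only [QuadWall.vel]
        push_cast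
        rw [add_sub_cancel_left, vel2, abs_mul]
        have h1 : |(b : ℝ) - 1| ≤ |(b : ℝ) * (1 + ε * τ) - (1 + 2 * ε * τ)| +
            |(ε : ℝ)| * |(b : ℝ) - 2| := by
          have : (b : ℝ) - 1 = ((b : ℝ) * (1 + ε * τ) - (1 + 2 * ε * τ)) - ε * τ * (b - 2) := by
            ring
          rw [this]
          refine (abs_sub _ _).trans ?_
          rw [abs_mul ((ε : ℝ) * τ)]
          have := mul_le_mul_of_nonneg_right hετ (abs_nonneg ((b : ℝ) - 2))
          linarith
        nlinarith [h1, k2]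
    · rw [hRR]
      constructor
      · push_cast
        have := near μ (by linarith)
        simpa using this
      · simp only [QuadWall.pos]; push_cast
        rw [add_sub_cancel_left, show ((ε : ℝ) * ((b - 1) / (2 * μ))) * (μ * τ) ^ 2 =
          ε * ((b - 1) * μ) * τ ^ 2 / 2 by field_simp]
        linear_combination (-(τ + ε * τ ^ 2 * (3 / 2))) * f1 + (2 * τ + 2 * ε * τ ^ 2) * f3 -
          2 * τ * f2 - 2 * τ * q1 - 2 * τ * (b - 1) * q2 - 2 * τ * hgr - 2 * ε * τ ^ 2 * hr'
      · simp only [QuadWall.vel]; push_cast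
        rw [add_sub_cancel_left, vel3]; ring
      · push_cast
        have hc : -(3 - (lam : ℝ)) / (8 * ε) = -2 * (b - 1) * (g' / ε) := by
          rw [show -2 * ((b : ℝ) - 1) * (g' / ε) = -2 * ((b - 1) * g') / ε by ring, f2]
          field_simp
          norm_num
        rw [← hτ, hc]
        linear_combination (-(2 * τ + 2 * ε * τ ^ 2)) * f1 + (2 * τ + 2 * ε * τ ^ 2) * f3 -
          2 * τ * f2 - 2 * τ * q1 - 2 * τ * (b - 1) * q2 - 2 * τ * hgr - 2 * ε * τ ^ 2 * hr'
      · simp only [QuadWall.vel]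
        push_cast
        rw [add_sub_cancel_left, vel3, abs_mul]
        have h1 : (b : ℝ) + ε * τ * (b - 1) - (2 * b - 1 + ε * τ * (2 * b - 2)) =
            -((b - 1) * (1 + ε * τ)) := by ring
        rw [h1, abs_neg, abs_mul]
        have h2 : (1 : ℝ) / 2 ≤ |1 + (ε : ℝ) * τ| :=
          le_trans (by linarith [hετ'.1]) (le_abs_self _)
        have h3 := mul_le_mul_of_nonneg_left h2 (abs_nonneg ((b : ℝ) - 1))
        linarith

open Filter Topology in
/-- The quadratic solution fails at the zeros of the denominators and where the times of the three
walls do not increase; the powers of `4`, except for `1`, are far from these values of `lam`. -/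
theorem nonempty_telescope {lam : ℚ} (hlam : 0 < lam) (h : lam = 1 ∨ lam ≤ 1 / 4 ∨ 4 ≤ lam) :
    Nonempty (Telescope lam) := by
  rcases h with rfl | h
  · exact ⟨.rest⟩
  have h3 : 3 - lam ≠ 0 := by intro h0; rcases h with h | h <;> linarith
  have h13 : 1 - 3 * lam ≠ 0 := by intro h0; rcases h with h | h <;> linarith
  set r := 3 * (3 - lam) / 8 with hr
  set μ := lam * (lam - 3) / (1 - 3 * lam) with hμ
  set b := 4 * (1 - lam) / (3 - lam) with hb
  set g := (11 - 9 * lam) / 16 with hg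
  set g' := (3 - lam) ^ 2 / (16 * (1 - 3 * lam)) with hg'
  set R := 1 + |r| + |μ| + 2 * lam + 3 with hR
  have hb1 : 0 < |b - 1| := by
    rw [abs_pos, hb, div_sub_one h3]
    refine div_ne_zero ?_ h3
    convert h13 using 1
    ring
  have hg0 : 0 < |g| := by
    rw [abs_pos, hg]
    intro h0
    rcases h with h | h <;> linarith
  have hg0' : 0 < |g'| := by
    rw [abs_pos, hg']
    exact div_ne_zero (pow_ne_zero _ h3) (mul_ne_zero (by norm_num) h13)
  obtain ⟨δ, c0, c1, c2, c3, c5, c6, hδ⟩ := ((eventually_mul_lt 1 (c := 1 / 2) (by norm_num)).and <|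
    (eventually_mul_lt R (c := 1 / 2) (by norm_num)).and <|
    (eventually_mul_lt (2 * R * |(2 * r - 3 / 2) / r ^ 2| + |b - 2|) hb1).and <|
    (eventually_mul_lt (2 * R * |(b - 1) / (2 * μ)|) (half_pos hb1)).and <|
    (eventually_mul_lt (2 * R) hg0).and <| (eventually_mul_lt (2 * R) hg0').and <|
    eventually_mem_nhdsWithin).exists
  have hδ : 0 < δ := hδ
  -- the sign of the parameter makes the times of the walls increase
  obtain ⟨ε, hε, h1, h2⟩ : ∃ ε : ℚ, |ε| = δ ∧ g / ε = |g| / δ ∧ g' / ε = |g'| / δ := by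
    rcases h with h | h
    · have : 0 ≤ g := by rw [hg]; linarith
      have : 0 ≤ g' := div_nonneg (sq_nonneg _) (by linarith)
      exact ⟨δ, abs_of_pos hδ, by rw [abs_of_nonneg ‹0 ≤ g›], by rw [abs_of_nonneg this]⟩
    · have : g ≤ 0 := by rw [hg]; linarith
      have : g' ≤ 0 := div_nonpos_of_nonneg_of_nonpos (sq_nonneg _) (by linarith)
      refine ⟨-δ, by rw [abs_neg, abs_of_pos hδ], ?_, ?_⟩
      · rw [abs_of_nonpos ‹g ≤ 0›, div_neg, neg_div]
      · rw [abs_of_nonpos this, div_neg, neg_div]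
  have hε0 : ε ≠ 0 := by
    rintro rfl
    rw [abs_zero] at hε
    exact hδ.ne hε
  subst hε
  refine ⟨.ofParam lam ε r μ b g g' h3 h13 hlam hε0 hr hμ hb hg hg' R hR ?_ c1 c2 c3 ?_ ?_⟩
  · linarith
  · rw [h1, le_div_iff₀ hδ]; linarith
  · rw [h2, le_div_iff₀ hδ]; linarith

/-! ### Telescopes in the plane -/

/-- The point with coordinates `v * η` and `v * ξ` in the frame with origin `O` whose axes have the
directions of `n` and of its rotation by a right angle. -/
def framePt (O n : ℚ × ℚ) (v : ℚ) (η ξ : ℝ) : Plane :=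
  (O.1 + v * (η * n.1 + ξ * n.2) / 2, O.2 + v * (η * n.2 - ξ * n.1) / 2)

/-- The velocity with components `v * u` and `v` in the frame of `framePt`. -/
def frameVel (n : ℚ × ℚ) (v : ℚ) (u : ℝ) : Plane :=
  (v * (u * n.1 + n.2) / 2, v * (u * n.2 - n.1) / 2)

theorem framePt_inj {O n : ℚ × ℚ} (hn : n.1 ^ 2 + n.2 ^ 2 = 2) {v : ℚ} (hv : 0 < v)
    {η ξ η' ξ' : ℝ} (h : framePt O n v η ξ = framePt O n v η' ξ') : η = η' ∧ ξ = ξ' := by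
  have hv' : (v : ℝ) ≠ 0 := by exact_mod_cast hv.ne'
  have hn' : (n.1 : ℝ) ^ 2 + n.2 ^ 2 = 2 := by exact_mod_cast hn
  simp only [framePt, Prod.mk.injEq] at h
  obtain ⟨h1, h2⟩ := h
  have h1' : η * n.1 + ξ * n.2 = η' * n.1 + ξ' * n.2 := by
    apply mul_left_cancel₀ hv'; linarith
  have h2' : η * n.2 - ξ * n.1 = η' * n.2 - ξ' * n.1 := by
    apply mul_left_cancel₀ hv'; linarith
  constructor
  · linear_combination (n.1 * h1' + n.2 * h2') / 2 - (η - η') / 2 * hn'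
  · linear_combination (n.2 * h1' - n.1 * h2') / 2 - (ξ - ξ') / 2 * hn'

theorem abs_framePt_sub_le {O n : ℚ × ℚ} (hn : n.1 ^ 2 + n.2 ^ 2 = 2) {v : ℚ} (hv : 0 < v)
    {η ξ E F : ℝ} (hη : |η| ≤ E) (hξ : |ξ| ≤ F) :
    |(framePt O n v η ξ).1 - O.1| ≤ v * (E + F) ∧ |(framePt O n v η ξ).2 - O.2| ≤ v * (E + F) := by
  have hv' : (0 : ℝ) < v := by exact_mod_cast hv
  have hn' : (n.1 : ℝ) ^ 2 + n.2 ^ 2 = 2 := by exact_mod_cast hn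
  have h1 : |(n.1 : ℝ)| ≤ 2 := abs_le_of_sq_le_sq (by nlinarith [sq_nonneg (n.2 : ℝ)]) (by norm_num)
  have h2 : |(n.2 : ℝ)| ≤ 2 := abs_le_of_sq_le_sq (by nlinarith [sq_nonneg (n.1 : ℝ)]) (by norm_num)
  have hE := (abs_nonneg η).trans hη
  have hF := (abs_nonneg ξ).trans hξ
  have key : ∀ a b : ℝ, |a| ≤ 2 → |b| ≤ 2 → |v * (η * a + ξ * b) / 2| ≤ v * (E + F) := by
    intro a b ha hb
    rw [abs_div, abs_mul, abs_of_pos hv', abs_of_pos (show (0 : ℝ) < 2 by norm_num), mul_div_assoc]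
    refine mul_le_mul_of_nonneg_left ?_ hv'.le
    rw [div_le_iff₀ (by norm_num)]
    refine (abs_add_le _ _).trans ?_
    rw [abs_mul, abs_mul, add_mul]
    exact add_le_add (mul_le_mul hη ha (abs_nonneg _) hE) (mul_le_mul hξ hb (abs_nonneg _) hF)
  constructor
  · have := key n.1 n.2 h1 h2
    simpa [framePt] using this
  · have := key n.2 (-n.1) h2 (by rwa [abs_neg])
    simpa [framePt, sub_eq_add_neg] using this

/-- A telescope that is placed in the plane: origin and axis `n` of its frame, speed `v` of the
ball, time `t₀` when a ball without offset would pass the origin, and period `T`. As `n` has the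
length `√2`, the frame is turned by `45` degrees against the ball that comes in: the walls are
perpendicular to `n`, hence they change the component of the velocity along `n` only, and the other
component of the velocity is constant. Two telescopes with perpendicular axes therefore scale the
two components of the motion independently of each other. -/
structure Placement (lam : ℚ) where
  tel : Telescope lam
  lam_pos : 0 < lam
  O : ℚ × ℚ
  n : ℚ × ℚ
  hn : n.1 ^ 2 + n.2 ^ 2 = 2
  v : ℚ
  hv : 0 < v
  t₀ : ℚ
  T : ℚ
  le_t₀ : tel.K + 2 * lam + 3 ≤ t₀
  lt_T : 2 * (tel.K + 2 * lam + 3) < T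

/-- Radius of the time windows in which the walls of a telescope are used. -/
def Telescope.R {lam : ℚ} (tel : Telescope lam) : ℚ := tel.K + 2 * lam + 3

/-- A bound for the position of the wall during its time window of radius `R`. -/
def QuadWall.bound (w : QuadWall) (R : ℚ) : ℚ := |w.α| + |w.β| * R + |w.γ| * R ^ 2

theorem QuadWall.abs_pos_le (w : QuadWall) {R : ℚ} {x : ℝ} (hx : |x| ≤ R) :
    |w.pos x| ≤ w.bound R := by
  have hR : (0 : ℝ) ≤ R := (abs_nonneg x).trans hx
  have h1 : |(w.β : ℝ) * x| ≤ |(w.β : ℝ)| * R := by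
    rw [abs_mul]; exact mul_le_mul_of_nonneg_left hx (abs_nonneg _)
  have h2 : |(w.γ : ℝ) * x ^ 2| ≤ |(w.γ : ℝ)| * R ^ 2 := by
    rw [abs_mul, abs_pow]
    exact mul_le_mul_of_nonneg_left (pow_le_pow_left₀ (abs_nonneg _) hx 2) (abs_nonneg _)
  simp only [pos, bound]
  push_cast
  exact (abs_add_three _ _ _).trans (by linarith)

theorem QuadWall.bound_nonneg (w : QuadWall) {R : ℚ} (hR : 0 ≤ R) : 0 ≤ w.bound R := by
  unfold bound; positivity

/-- A bound for all coordinates that occur in a telescope. -/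
def Telescope.size {lam : ℚ} (tel : Telescope lam) : ℚ :=
  (tel.w₁.bound tel.R + tel.w₂.bound tel.R + tel.w₃.bound tel.R) + (tel.w₃.D + tel.R) + |tel.c|

namespace Placement

variable {lam : ℚ} (P : Placement lam)

/-- Radius of the time windows in which the walls are used. -/
abbrev R : ℚ := P.tel.R

theorem R_pos : 0 < P.R := by
  have := P.tel.K_nonneg
  have := P.lam_pos
  unfold R Telescope.R; linarith

/-- The bar that realizes a wall of the telescope. It follows the prescribed motion during the time
window of radius `R` around `D`, and moves back in the rest of the period. It is just long enough to be met by a ball that drifts along the wall with a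
delay of at most `lam + 1`: a ball that is near the wall at any other time passes beside it. -/
def bar (w : QuadWall) (hw : 0 ≤ w.D) : Bar where
  base := P.O + (P.v * (w.α - w.β * P.R + w.γ * P.R ^ 2) / 2) • P.n
  d := (P.n.2, -P.n.1)
  d_ne := by
    intro h
    have h1 : P.n.2 = 0 := congrArg Prod.fst h
    have h2 : -P.n.1 = 0 := congrArg Prod.snd h
    have := P.hn
    rw [h1, neg_eq_zero.1 h2] at this
    norm_num at this
  lo := P.v * (w.D - (P.tel.K + lam + 1)) / 2
  hi := P.v * (w.D + (P.tel.K + lam + 1)) / 2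
  lo_lt := by
    have := P.tel.K_nonneg
    have := P.lam_pos
    have := P.hv
    have : P.v * (w.D - (P.tel.K + lam + 1)) < P.v * (w.D + (P.tel.K + lam + 1)) :=
      mul_lt_mul_of_pos_left (by linarith) P.hv
    linarith
  dir := P.n
  start := P.t₀ + w.D - P.R
  start_nonneg := by
    have := P.le_t₀
    unfold R Telescope.R; linarith
  β := P.v * (w.β - 2 * w.γ * P.R) / 2
  γ := P.v * w.γ / 2
  t₁ := 2 * P.R
  t₂ := P.T
  t₁_pos := by linarith [P.R_pos]
  t₁_lt := P.lt_T

section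

variable {P} {w : QuadWall} {hw : 0 ≤ w.D}

/-- The time `t` after the reference time of the `N`-th period. -/
def clock (P : Placement lam) (N : ℕ) (t : ℝ) : ℝ := N * P.T + P.t₀ + t

theorem clock_eq (P : Placement lam) (w : QuadWall) (hw : 0 ≤ w.D) (N : ℕ) (t : ℝ) :
    P.clock N t = (P.bar w hw).start + N * (P.bar w hw).t₂ + (t - w.D + P.R) := by
  simp [clock, bar]; ring

theorem disp_eq (N : ℕ) {t : ℝ} (ht : |t - w.D| < P.R) :
    (P.bar w hw).wall.disp (P.clock N t) = P.v * (w.pos (t - w.D) - w.pos (-P.R)) / 2 := by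
  have h := abs_lt.1 ht
  rw [P.clock_eq w hw, Bar.disp_eq]
  · simp [bar, QuadWall.pos]; ring
  · linarith
  · simp only [bar]; push_cast; linarith

theorem speed_eq (N : ℕ) {t : ℝ} (ht : |t - w.D| < P.R) :
    (P.bar w hw).wall.speed (P.clock N t) = P.v * w.vel (t - w.D) / 2 := by
  have h := abs_lt.1 ht
  rw [P.clock_eq w hw, Bar.speed_eq]
  · simp [bar, QuadWall.vel]; ring
  · linarith
  · simp only [bar]; push_cast; linarith

theorem bar_pt (l D : ℝ) :
    (((P.bar w hw).base.1 + l * (P.bar w hw).d.1 + D * (P.bar w hw).dir.1,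
      (P.bar w hw).base.2 + l * (P.bar w hw).d.2 + D * (P.bar w hw).dir.2) : Plane) =
    framePt P.O P.n P.v (w.pos (-P.R) + 2 * D / P.v) (2 * l / P.v) := by
  have hv' : (P.v : ℝ) ≠ 0 := by exact_mod_cast P.hv.ne'
  ext
  · simp [framePt, bar, QuadWall.pos]; field_simp; ring
  · simp [framePt, bar, QuadWall.pos]; field_simp; ring

/-- A bar can be met by a ball only during its time window, and only in its current position. -/
theorem of_mem_pts {N : ℕ} {t σ η : ℝ} (hσ : |σ| ≤ lam + 1)
    (h : framePt P.O P.n P.v η (t - σ) ∈ (P.bar w hw).pts (P.clock N t)) :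
    |t - w.D| < P.R ∧ η = w.pos (t - w.D) := by
  have hv' : (0 : ℝ) < P.v := by exact_mod_cast P.hv
  obtain ⟨l, ⟨hl, hl'⟩, h⟩ := Bar.mem_pts.1 h
  rw [bar_pt] at h
  obtain ⟨h1, h2⟩ := framePt_inj P.hn P.hv h
  simp only [bar] at hl hl'
  push_cast at hl hl'
  have hσ' := abs_le.1 hσ
  have hl2 : l = P.v * (t - σ) / 2 := by rw [h2]; field_simp
  rw [hl2] at hl hl'
  have a1 : (w.D : ℝ) - (P.tel.K + lam + 1) ≤ t - σ := by
    refine le_of_mul_le_mul_left ?_ hv'; linarith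
  have a2 : t - σ ≤ (w.D : ℝ) + (P.tel.K + lam + 1) := by
    refine le_of_mul_le_mul_left ?_ hv'; linarith
  have ht : |t - w.D| < P.R := by
    rw [abs_lt]
    simp only [R, Telescope.R]
    push_cast
    constructor <;> linarith
  refine ⟨ht, ?_⟩
  rw [h1, disp_eq N ht]
  field_simp
  ring

theorem mem_pts {N : ℕ} {t σ η : ℝ} (hσ : |σ| ≤ lam + 1) (ht : |t - w.D| ≤ P.tel.K)
    (h : η = w.pos (t - w.D)) :
    framePt P.O P.n P.v η (t - σ) ∈ (P.bar w hw).pts (P.clock N t) := by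
  have hv' : (0 : ℝ) < P.v := by exact_mod_cast P.hv
  have hlam : (0 : ℝ) < lam := by exact_mod_cast P.lam_pos
  have htR : |t - w.D| < P.R := by
    refine ht.trans_lt ?_
    simp only [R, Telescope.R]; push_cast; linarith
  have hσ' := abs_le.1 hσ
  have ht' := abs_le.1 ht
  refine Bar.mem_pts.2 ⟨P.v * (t - σ) / 2, ⟨?_, ?_⟩, ?_⟩
  · simp only [bar]; push_cast
    have := mul_le_mul_of_nonneg_left
      (show (w.D : ℝ) - (P.tel.K + lam + 1) ≤ t - σ by linarith) hv'.le
    linarith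
  · simp only [bar]; push_cast
    have := mul_le_mul_of_nonneg_left
      (show t - σ ≤ (w.D : ℝ) + (P.tel.K + lam + 1) by linarith) hv'.le
    linarith
  · rw [bar_pt, disp_eq N htR, h]
    congr 1
    · field_simp; ring
    · field_simp

theorem reflect_bar {N : ℕ} {t : ℝ} (ht : |t - w.D| < P.R) (u : ℝ) :
    reflect ((P.bar w hw).wall.toMovingSegment.snd - (P.bar w hw).wall.toMovingSegment.fst)
      ((P.bar w hw).wall.toMovingSegment.vel (P.clock N t)) (frameVel P.n P.v u) =
    frameVel P.n P.v (2 * w.vel (t - w.D) - u) := by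
  have hn' : (P.n.1 : ℝ) ^ 2 + (P.n.2 : ℝ) ^ 2 = 2 := by exact_mod_cast P.hn
  rw [Bar.reflect_eq, speed_eq N ht]
  have h2 : ∀ a : ℝ, 2 * a / ((P.n.1 : ℝ) * P.n.1 + P.n.2 * P.n.2) = a := by
    intro a
    rw [show (P.n.1 : ℝ) * P.n.1 + P.n.2 * P.n.2 = 2 by linarith]; ring
  have hd : normal (toPlane (P.bar w hw).d) = ((P.n.1 : ℝ), (P.n.2 : ℝ)) := by
    ext <;> simp [normal, toPlane, bar]
  have hdir : (P.bar w hw).dir = P.n := rfl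
  rw [reflect, hd, hdir]
  simp only [dot, h2]
  generalize w.vel (t - w.D) = a
  ext
  · simp [frameVel]
    linear_combination ((P.v : ℝ) * (a - u) * P.n.1 / 2) * hn'
  · simp [frameVel]
    linear_combination ((P.v : ℝ) * (a - u) * P.n.2 / 2) * hn'

theorem exists_of_mem_pts {t : ℝ} {x : Plane} (h : x ∈ (P.bar w hw).pts t) :
    ∃ η ξ : ℝ, x = framePt P.O P.n P.v η ξ ∧ |η| ≤ w.bound P.R ∧ |ξ| ≤ w.D + P.R := by
  have hv' : (0 : ℝ) < P.v := by exact_mod_cast P.hv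
  have hlam : (0 : ℝ) < lam := by exact_mod_cast P.lam_pos
  have hw' : (0 : ℝ) ≤ w.D := by exact_mod_cast hw
  have hR : (0 : ℝ) < P.R := by exact_mod_cast P.R_pos
  obtain ⟨l, ⟨hl, hl'⟩, rfl⟩ := Bar.mem_pts.1 h
  refine ⟨_, _, bar_pt _ _, ?_, ?_⟩
  · obtain ⟨θ, ⟨h0, h1⟩, τ, ⟨h2, h3⟩, hd⟩ := (P.bar w hw).exists_disp_eq t
    simp only [bar] at h3
    push_cast at h3
    have e : w.pos (-P.R) + 2 * (P.bar w hw).wall.disp t / P.v =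
        (1 - θ) * w.pos (-P.R) + θ * w.pos (τ - P.R) := by
      rw [hd]
      simp [bar, QuadWall.pos]
      field_simp
      ring
    have b1 : |w.pos (-P.R)| ≤ w.bound P.R :=
      w.abs_pos_le (by rw [abs_neg, abs_of_pos hR])
    have b2 : |w.pos (τ - P.R)| ≤ w.bound P.R :=
      w.abs_pos_le (abs_le.2 ⟨by linarith, by linarith⟩)
    rw [e]
    refine (abs_add_le _ _).trans ?_
    rw [abs_mul, abs_mul, abs_of_nonneg h0, abs_of_nonneg (sub_nonneg.2 h1)]
    nlinarith
  · simp only [bar] at hl hl'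
    push_cast at hl hl'
    rw [abs_div, abs_of_pos hv', div_le_iff₀ hv', abs_le]
    simp only [R, Telescope.R]
    push_cast
    have hK : (0 : ℝ) ≤ P.tel.K := by exact_mod_cast P.tel.K_nonneg
    constructor <;> nlinarith [mul_pos hv' hlam, mul_nonneg hv'.le hw', mul_nonneg hv'.le hK]

end

theorem D₂_nonneg : 0 ≤ P.tel.w₂.D := by
  have := P.tel.D₁_nonneg
  have := P.tel.gap₁
  have := P.tel.K_nonneg
  have := P.lam_pos
  linarith

theorem D₃_nonneg : 0 ≤ P.tel.w₃.D := by
  have := P.D₂_nonneg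
  have := P.tel.gap₂
  have := P.tel.K_nonneg
  have := P.lam_pos
  linarith

/-- The three walls of the telescope. -/
def bars : List Bar :=
  [P.bar P.tel.w₁ P.tel.D₁_nonneg, P.bar P.tel.w₂ P.D₂_nonneg, P.bar P.tel.w₃ P.D₃_nonneg]

/-- The square around the origin of the frame that contains everything that happens in the
telescope. -/
def box : Set Plane := {z | |z.1 - P.O.1| ≤ (P.v : ℝ) * (P.tel.size - |(P.tel.c : ℝ)|) ∧
  |z.2 - P.O.2| ≤ (P.v : ℝ) * (P.tel.size - |(P.tel.c : ℝ)|)}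

theorem framePt_mem_box {η ξ : ℝ} (hη : |η| ≤ P.tel.w₁.bound P.R + P.tel.w₂.bound P.R +
    P.tel.w₃.bound P.R) (hξ : |ξ| ≤ P.tel.w₃.D + P.R) :
    framePt P.O P.n P.v η ξ ∈ P.box := by
  have h := abs_framePt_sub_le (O := P.O) P.hn P.hv hη hξ
  have e : (P.tel.w₁.bound P.R + P.tel.w₂.bound P.R + P.tel.w₃.bound P.R : ℝ) +
      (P.tel.w₃.D + P.R) = P.tel.size - |(P.tel.c : ℝ)| := by
    simp only [Telescope.size, R]; push_cast; ring
  rw [e] at h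
  exact h

theorem pts_subset_box {B : Bar} (hB : B ∈ P.bars) (t : ℝ) : B.pts t ⊆ P.box := by
  intro x hx
  have hR := P.R_pos
  have b1 : (0 : ℝ) ≤ P.tel.w₁.bound P.R := by exact_mod_cast P.tel.w₁.bound_nonneg hR.le
  have b2 : (0 : ℝ) ≤ P.tel.w₂.bound P.R := by exact_mod_cast P.tel.w₂.bound_nonneg hR.le
  have b3 : (0 : ℝ) ≤ P.tel.w₃.bound P.R := by exact_mod_cast P.tel.w₃.bound_nonneg hR.le
  have g1 : (P.tel.w₁.D : ℝ) + 2 * P.R ≤ P.tel.w₂.D := by exact_mod_cast P.tel.gap₁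
  have g2 : (P.tel.w₂.D : ℝ) + 2 * P.R ≤ P.tel.w₃.D := by exact_mod_cast P.tel.gap₂
  have hR' : (0 : ℝ) < P.R := by exact_mod_cast hR
  simp only [bars, List.mem_cons, List.not_mem_nil, or_false] at hB
  rcases hB with rfl | rfl | rfl <;> obtain ⟨η, ξ, rfl, h1, h2⟩ := exists_of_mem_pts hx <;>
    exact P.framePt_mem_box (by linarith) (by linarith)

end Placement

/-! ### Passage of a ball through a telescope -/

namespace Placement

variable {lam : ℚ} (P : Placement lam)

/-- A ball with coordinates `p + u * t` and `t - σ` at time `t` of the `N`-th period meets the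
telescope during the time set `I` at the time `t₁` only; this changes `u` to `u'`. -/
def Turns (N : ℕ) (σ p u u' : ℝ) (I : Set ℝ) (t₁ : ℝ) : Prop :=
  (∀ t ∈ I, ∀ B ∈ P.bars, framePt P.O P.n P.v (p + u * t) (t - σ) ∈ B.pts (P.clock N t) →
    t = t₁ ∧ reflect (B.wall.toMovingSegment.snd - B.wall.toMovingSegment.fst)
      (B.wall.toMovingSegment.vel (P.clock N t)) (frameVel P.n P.v u) = frameVel P.n P.v u') ∧
  ∃ B ∈ P.bars, framePt P.O P.n P.v (p + u * t₁) (t₁ - σ) ∈ B.pts (P.clock N t₁)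

/-- The passage of a ball through a telescope: the component of its motion along the axis of the
telescope is scaled, the perpendicular component is not affected. -/
theorem exists_path (N : ℕ) {s σ : ℝ} (hs : s ∈ Set.Icc (0 : ℝ) (1 / 2)) (hσ : |σ| ≤ lam + 1) :
    ∃ t₁ t₂ t₃ p₁ u₁ p₂ u₂ : ℝ, t₁ < t₂ ∧ t₂ < t₃ ∧ |t₁| ≤ P.tel.w₁.D + P.R ∧
      t₃ ≤ P.tel.w₃.D + P.R ∧
      p₁ + u₁ * t₁ = s + (-1) * t₁ ∧ p₂ + u₂ * t₂ = p₁ + u₁ * t₂ ∧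
      -lam * s - P.tel.c + 1 * t₃ = p₂ + u₂ * t₃ ∧
      P.Turns N σ s (-1) u₁ (Set.Iic t₁) t₁ ∧
      P.Turns N σ p₁ u₁ u₂ (Set.Ioc t₁ t₂) t₂ ∧
      P.Turns N σ p₂ u₂ 1 (Set.Ioc t₂ t₃) t₃ ∧
      (∀ t, t₃ < t → ∀ B ∈ P.bars,
        framePt P.O P.n P.v (-lam * s - P.tel.c + 1 * t) (t - σ) ∉ B.pts (P.clock N t)) ∧
      framePt P.O P.n P.v (s + (-1) * t₁) (t₁ - σ) ∈ P.box ∧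
      framePt P.O P.n P.v (p₁ + u₁ * t₂) (t₂ - σ) ∈ P.box ∧
      framePt P.O P.n P.v (p₂ + u₂ * t₃) (t₃ - σ) ∈ P.box := by
  obtain ⟨t₁, t₂, t₃, p₁, u₁, p₂, u₂, T₁, T₂, T₃⟩ := P.tel.path s hs
  have hRe : ((P.tel.K : ℝ) + 2 * lam + 3) = P.R := by
    simp only [R, Telescope.R]; push_cast; ring
  rw [hRe] at T₁ T₂ T₃
  have hlam : (0 : ℝ) < lam := by exact_mod_cast P.lam_pos
  have hKR : (P.tel.K : ℝ) ≤ P.R := by rw [← hRe]; linarith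
  have hKR' : (P.tel.K : ℝ) < P.R := by rw [← hRe]; linarith
  have hR : (0 : ℝ) < P.R := by exact_mod_cast P.R_pos
  have d1 : (0 : ℝ) ≤ P.tel.w₁.D := by exact_mod_cast P.tel.D₁_nonneg
  have g1 : (P.tel.w₁.D : ℝ) + 2 * P.R ≤ P.tel.w₂.D := by exact_mod_cast P.tel.gap₁
  have g2 : (P.tel.w₂.D : ℝ) + 2 * P.R ≤ P.tel.w₃.D := by exact_mod_cast P.tel.gap₂
  have b1 : (0 : ℝ) ≤ P.tel.w₁.bound P.R := by exact_mod_cast P.tel.w₁.bound_nonneg P.R_pos.le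
  have b2 : (0 : ℝ) ≤ P.tel.w₂.bound P.R := by exact_mod_cast P.tel.w₂.bound_nonneg P.R_pos.le
  have b3 : (0 : ℝ) ≤ P.tel.w₃.bound P.R := by exact_mod_cast P.tel.w₃.bound_nonneg P.R_pos.le
  have n1 := abs_le.1 T₁.near
  have n2 := abs_le.1 T₂.near
  have n3 := abs_le.1 T₃.near
  have hσ' := abs_le.1 hσ
  have t12 : t₁ < t₂ := by linarith
  have t23 : t₂ < t₃ := by linarith
  -- the walls are used in disjoint time windows
  have window : ∀ {w : QuadWall} {hw : 0 ≤ w.D} {t η : ℝ},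
      framePt P.O P.n P.v η (t - σ) ∈ (P.bar w hw).pts (P.clock N t) →
      (w.D : ℝ) - P.R < t ∧ t < w.D + P.R ∧ η = w.pos (t - w.D) ∧ |t - w.D| ≤ P.R := by
    intro w hw t η h
    obtain ⟨h1, h2⟩ := of_mem_pts hσ h
    have := abs_lt.1 h1
    exact ⟨by linarith, by linarith, h2, h1.le⟩
  refine ⟨t₁, t₂, t₃, p₁, u₁, p₂, u₂, t12, t23, ?_, by linarith, by linarith [T₁.cont], T₂.cont,
    T₃.cont, ⟨?_, ?_⟩, ⟨?_, ?_⟩, ⟨?_, ?_⟩, ?_, ?_, ?_, ?_⟩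
  · rw [abs_le]; constructor <;> linarith
  · intro t ht B hB h
    have ht : t ≤ t₁ := ht
    simp only [bars, List.mem_cons, List.not_mem_nil, or_false] at hB
    rcases hB with rfl | rfl | rfl <;> obtain ⟨w1, w2, w3, w4⟩ := window h
    · by_cases hne : t = t₁
      · refine ⟨hne, ?_⟩
        rw [hne, reflect_bar (T₁.near.trans_lt hKR'), T₁.vel_eq]
      · exact absurd w3.symm (T₁.ne_before hKR w4 hne)
    · linarith
    · linarith
  · exact ⟨_, by simp [bars], mem_pts (hw := P.tel.D₁_nonneg) hσ T₁.near T₁.hit.symm⟩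
  · rintro t ⟨ht, ht'⟩ B hB h
    simp only [bars, List.mem_cons, List.not_mem_nil, or_false] at hB
    rcases hB with rfl | rfl | rfl <;> obtain ⟨w1, w2, w3, w4⟩ := window h
    · exact absurd w3.symm (T₁.ne_after hKR w4 ht.ne')
    · by_cases hne : t = t₂
      · refine ⟨hne, ?_⟩
        rw [hne, reflect_bar (T₂.near.trans_lt hKR'), T₂.vel_eq]
      · exact absurd w3.symm (T₂.ne_before hKR w4 hne)
    · linarith
  · exact ⟨_, by simp [bars], mem_pts (hw := P.D₂_nonneg) hσ T₂.near T₂.hit.symm⟩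
  · rintro t ⟨ht, ht'⟩ B hB h
    simp only [bars, List.mem_cons, List.not_mem_nil, or_false] at hB
    rcases hB with rfl | rfl | rfl <;> obtain ⟨w1, w2, w3, w4⟩ := window h
    · linarith
    · exact absurd w3.symm (T₂.ne_after hKR w4 ht.ne')
    · by_cases hne : t = t₃
      · refine ⟨hne, ?_⟩
        rw [hne, reflect_bar (T₃.near.trans_lt hKR'), T₃.vel_eq]
      · exact absurd w3.symm (T₃.ne_before hKR w4 hne)
  · exact ⟨_, by simp [bars], mem_pts (hw := P.D₃_nonneg) hσ T₃.near T₃.hit.symm⟩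
  · intro t ht B hB h
    simp only [bars, List.mem_cons, List.not_mem_nil, or_false] at hB
    rcases hB with rfl | rfl | rfl <;> obtain ⟨w1, w2, w3, w4⟩ := window h
    · linarith
    · linarith
    · exact absurd w3.symm (T₃.ne_after hKR w4 ht.ne')
  · have h1 := P.tel.w₁.abs_pos_le (T₁.near.trans hKR)
    rw [T₁.hit] at h1
    refine P.framePt_mem_box (by linarith) ?_
    rw [abs_le, ← hRe]; constructor <;> linarith
  · have h1 := P.tel.w₂.abs_pos_le (T₂.near.trans hKR)
    rw [T₂.hit] at h1
    refine P.framePt_mem_box (by linarith) ?_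
    rw [abs_le, ← hRe]; constructor <;> linarith
  · have h1 := P.tel.w₃.abs_pos_le (T₃.near.trans hKR)
    rw [T₃.hit] at h1
    refine P.framePt_mem_box (by linarith) ?_
    rw [abs_le, ← hRe]; constructor <;> linarith

end Placement

namespace Placement

variable {lam : ℚ} (P : Placement lam)

/-- A ball in the frame of a telescope at time `t` of the `N`-th period. -/
def ball (N : ℕ) (σ p u t : ℝ) : Ball :=
  ⟨P.clock N t, framePt P.O P.n P.v (p + u * t) (t - σ), frameVel P.n P.v u⟩

theorem posAt_ball (N : ℕ) (σ p u t t' : ℝ) :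
    (P.ball N σ p u t).posAt (P.clock N t') = framePt P.O P.n P.v (p + u * t') (t' - σ) := by
  ext <;> simp [ball, Ball.posAt, clock, framePt, frameVel] <;> ring

theorem clock_lt {N : ℕ} {t t' : ℝ} : P.clock N t < P.clock N t' ↔ t < t' := by
  simp [clock]

theorem exists_clock (N : ℕ) (t : ℝ) : ∃ t', t = P.clock N t' :=
  ⟨t - (N * P.T + P.t₀), by simp [clock]⟩

theorem clock_inj {N : ℕ} {t t' : ℝ} : P.clock N t = P.clock N t' ↔ t = t' := by
  simp [clock]

theorem convex_box : Convex ℝ P.box := by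
  have h : P.box = (Set.Icc ((P.O.1 : ℝ) - (P.v : ℝ) * (P.tel.size - |(P.tel.c : ℝ)|))
        (P.O.1 + (P.v : ℝ) * (P.tel.size - |(P.tel.c : ℝ)|))) ×ˢ
      (Set.Icc ((P.O.2 : ℝ) - (P.v : ℝ) * (P.tel.size - |(P.tel.c : ℝ)|))
        (P.O.2 + (P.v : ℝ) * (P.tel.size - |(P.tel.c : ℝ)|))) := by
    ext z
    simp only [box, Set.mem_ofPred_eq, Set.mem_prod, Set.mem_Icc, abs_le]
    constructor
    · rintro ⟨⟨h1, h2⟩, h3, h4⟩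
      exact ⟨⟨by linarith, by linarith⟩, by linarith, by linarith⟩
    · rintro ⟨⟨h1, h2⟩, h3, h4⟩
      exact ⟨⟨by linarith, by linarith⟩, by linarith, by linarith⟩
  rw [h]
  exact (convex_Icc _ _).prod (convex_Icc _ _)

variable {P} in
theorem mem_box_of_between {σ p u t₁ t₂ t : ℝ} (h1 : t₁ ≤ t) (h2 : t ≤ t₂)
    (hb1 : framePt P.O P.n P.v (p + u * t₁) (t₁ - σ) ∈ P.box)
    (hb2 : framePt P.O P.n P.v (p + u * t₂) (t₂ - σ) ∈ P.box) :
    framePt P.O P.n P.v (p + u * t) (t - σ) ∈ P.box := by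
  rcases eq_or_lt_of_le (h1.trans h2) with he | hlt
  · rwa [le_antisymm h1 (h2.trans he.ge)] at hb1
  · have hpos : 0 < t₂ - t₁ := sub_pos.2 hlt
    have := P.convex_box hb1 hb2 (a := (t₂ - t) / (t₂ - t₁)) (b := (t - t₁) / (t₂ - t₁))
      (div_nonneg (by linarith) hpos.le) (div_nonneg (by linarith) hpos.le)
      (by field_simp; ring)
    convert this using 1
    ext <;> simp [framePt] <;> field_simp <;> ring

/-- One straight piece of the trajectory of a ball that ends at the telescope. -/
theorem bounce_of_turns {S : Scene} {N : ℕ} {σ p u u' p' t₀ t₁ : ℝ} {I : Set ℝ} (ht : t₀ < t₁)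
    (hI : Set.Ioc t₀ t₁ ⊆ I) (hT : P.Turns N σ p u u' I t₁) (hc : p' + u' * t₁ = p + u * t₁)
    (hw : ∀ B ∈ P.bars, B.wall.toMovingSegment ∈ S.walls)
    (hw0 : ∀ t ∈ Set.Ioc t₀ t₁, ∀ m ∈ S.walls,
      framePt P.O P.n P.v (p + u * t) (t - σ) ∈ m.at (P.clock N t) →
      ∃ B ∈ P.bars, m = B.wall.toMovingSegment)
    (hg0 : ∀ t ∈ Set.Ioc t₀ t₁, ∀ g ∈ S.gates,
      framePt P.O P.n P.v (p + u * t) (t - σ) ∉ segment ℝ g.1 g.2) :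
    S.Bounce (P.ball N σ p u t₀) (P.ball N σ p' u' t₁) := by
  have e : P.ball N σ p' u' t₁ = ⟨P.clock N t₁, (P.ball N σ p u t₀).posAt (P.clock N t₁),
      frameVel P.n P.v u'⟩ := by
    rw [posAt_ball, ← hc]; rfl
  rw [e]
  refine Scene.bounce_of_leg (P.clock_lt.2 ht) ?_ ?_ ?_
  · rintro t ⟨h1, h2⟩ m hm hx
    obtain ⟨t, rfl⟩ := P.exists_clock N t
    have ht' : t ∈ Set.Ioc t₀ t₁ := ⟨P.clock_lt.1 h1, not_lt.1 fun h => h2.not_gt (P.clock_lt.2 h)⟩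
    rw [posAt_ball] at hx
    obtain ⟨B, hB, rfl⟩ := hw0 t ht' m hm hx
    obtain ⟨rfl, hr⟩ := hT.1 t (hI ht') B hB hx
    exact ⟨rfl, hr⟩
  · rintro t ⟨h1, h2⟩ g hg hx
    obtain ⟨t, rfl⟩ := P.exists_clock N t
    have ht' : t ∈ Set.Ioc t₀ t₁ := ⟨P.clock_lt.1 h1, not_lt.1 fun h => h2.not_gt (P.clock_lt.2 h)⟩
    rw [posAt_ball] at hx
    exact absurd hx (hg0 t ht' g hg)
  · obtain ⟨B, hB, hx⟩ := hT.2
    refine .inl ⟨_, hw B hB, ?_⟩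
    rw [posAt_ball]
    exact hx

/-- A ball passes a telescope whose box contains no other components. -/
theorem transit {S : Scene} {Z : Set Plane} (N : ℕ) {s σ : ℝ} (hs : s ∈ Set.Icc (0 : ℝ) (1 / 2))
    (hσ : |σ| ≤ lam + 1) {t₀ : ℝ} (ht₀ : t₀ < -(P.tel.w₁.D + P.R))
    (hw : ∀ B ∈ P.bars, B.wall.toMovingSegment ∈ S.walls)
    (hw0 : ∀ t, t₀ < t → ∀ m ∈ S.walls,
      framePt P.O P.n P.v (s + (-1) * t) (t - σ) ∈ m.at (P.clock N t) →
      ∃ B ∈ P.bars, m = B.wall.toMovingSegment)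
    (hg0 : ∀ t, t₀ < t → ∀ g ∈ S.gates,
      framePt P.O P.n P.v (s + (-1) * t) (t - σ) ∉ segment ℝ g.1 g.2)
    (hz0 : ∀ t, t₀ < t → framePt P.O P.n P.v (s + (-1) * t) (t - σ) ∉ Z)
    (hwb : ∀ z ∈ P.box, ∀ t, ∀ m ∈ S.walls, z ∈ m.at t →
      ∃ B ∈ P.bars, m = B.wall.toMovingSegment)
    (hgb : ∀ z ∈ P.box, ∀ g ∈ S.gates, z ∉ segment ℝ g.1 g.2)
    (hzb : ∀ z ∈ P.box, z ∉ Z) :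
    ∃ t₃ : ℝ, t₃ ≤ P.tel.w₃.D + P.R ∧
      S.Track Z (P.ball N σ s (-1) t₀) 3 (P.ball N σ (-lam * s - P.tel.c) 1 t₃) ∧
      framePt P.O P.n P.v (-lam * s - P.tel.c + 1 * t₃) (t₃ - σ) ∈ P.box ∧
      ∀ t, t₃ < t → ∀ B ∈ P.bars,
        framePt P.O P.n P.v (-lam * s - P.tel.c + 1 * t) (t - σ) ∉ B.pts (P.clock N t) := by
  obtain ⟨t₁, t₂, t₃, p₁, u₁, p₂, u₂, t12, t23, ht₁, ht₃, c1, c2, c3, T₁, T₂, T₃, h3, b1, b2, b3⟩ :=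
    P.exists_path N hs hσ
  have t01 : t₀ < t₁ := ht₀.trans_le (abs_le.1 ht₁).1
  have hb1 : ∀ t ∈ Set.Ioc t₁ t₂, framePt P.O P.n P.v (p₁ + u₁ * t) (t - σ) ∈ P.box :=
    fun t ht => mem_box_of_between ht.1.le ht.2 (c1 ▸ b1) b2
  have hb2 : ∀ t ∈ Set.Ioc t₂ t₃, framePt P.O P.n P.v (p₂ + u₂ * t) (t - σ) ∈ P.box :=
    fun t ht => mem_box_of_between ht.1.le ht.2 (c2 ▸ b2) b3
  have B₁ := P.bounce_of_turns t01 (fun t ht => ht.2) T₁ c1 hw (fun t ht => hw0 t ht.1)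
    (fun t ht => hg0 t ht.1)
  have B₂ := P.bounce_of_turns t12 subset_rfl T₂ c2 hw (fun t ht m => hwb _ (hb1 t ht) _ m)
    (fun t ht => hgb _ (hb1 t ht))
  have B₃ := P.bounce_of_turns t23 subset_rfl T₃ c3 hw (fun t ht m => hwb _ (hb2 t ht) _ m)
    (fun t ht => hgb _ (hb2 t ht))
  have Z₁ : (P.ball N σ p₁ u₁ t₁).pos ∉ Z := by
    refine hzb _ ?_
    show framePt P.O P.n P.v (p₁ + u₁ * t₁) (t₁ - σ) ∈ P.box
    rwa [c1]
  have Z₂ : (P.ball N σ p₂ u₂ t₂).pos ∉ Z := by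
    refine hzb _ ?_
    show framePt P.O P.n P.v (p₂ + u₂ * t₂) (t₂ - σ) ∈ P.box
    rwa [c2]
  refine ⟨t₃, ht₃, ((Scene.Track.bounce B₁ ?_).trans Z₁ (Scene.Track.bounce B₂ ?_)).trans Z₂
    (Scene.Track.bounce B₃ ?_), by rwa [c3], h3⟩
  · rintro t ⟨h1, h2⟩
    obtain ⟨t, rfl⟩ := P.exists_clock N t
    rw [posAt_ball]
    exact hz0 t (P.clock_lt.1 h1)
  · rintro t ⟨h1, h2⟩
    obtain ⟨t, rfl⟩ := P.exists_clock N t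
    rw [posAt_ball]
    exact hzb _ (hb1 t ⟨P.clock_lt.1 h1, (P.clock_lt.1 h2).le⟩)
  · rintro t ⟨h1, h2⟩
    obtain ⟨t, rfl⟩ := P.exists_clock N t
    rw [posAt_ball]
    exact hzb _ (hb2 t ⟨P.clock_lt.1 h1, (P.clock_lt.1 h2).le⟩)

end Placement

/-! ### The circuit -/

/-- The data of a circuit with `N` modules. Ball of speed `v`; horizontal lanes `0, …, J`. The
module `k` takes a ball on the lane `src k` whose time offset differs from `cen k` by at most `h`
to the lane `dst k` and changes its offset `Δ` to `lam k * Δ + β k`. The number `W` bounds all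
lengths that occur locally; with `corr_le` it also bounds the correction of the length of the way
through a module that is needed to arrive in time. -/
structure Layout where
  N : ℕ
  J : ℕ
  v : ℚ
  h : ℚ
  W : ℚ
  src : Fin N → ℕ
  dst : Fin N → ℕ
  cen : Fin N → ℚ
  lam : Fin N → ℚ
  β : Fin N → ℚ
  tel : ∀ k, Telescope (lam k)
  v_pos : 0 < v
  h_pos : 0 < h
  h_le : h ≤ 1 / 2
  src_le : ∀ k, src k ≤ J
  dst_le : ∀ k, dst k ≤ J
  cen_nonneg : ∀ k, 0 ≤ cen k
  cen_le : ∀ k, cen k ≤ 1 / 2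
  lam_pos : ∀ k, 0 < lam k
  J_le : 10 * J + 10 ≤ W
  v_le : v ≤ W
  size_le : ∀ k, v * (tel k).size ≤ W
  corr_le : ∀ k, |v * (β k - (tel k).c) + 10 * (src k + dst k)| ≤ 2 * W

namespace Layout

variable (L : Layout)

/-- Height of a lane. -/
def lane (j : ℕ) : ℚ := 10 * j

/-- The modules use the vertical lines through `(col k, 0)` and `(-col k, 0)`. -/
def col (k : Fin L.N) : ℚ := 4 * L.W * (k + 1)

/-- The module `k` uses the horizontal line at height `row k`. It is chosen in such a way that
the way through the module takes the time `T`, up to the change of the offset. -/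
def row (k : Fin L.N) : ℚ := (8 * L.N + 4) * L.W +
  (L.v * (L.β k - (L.tel k).c) + 10 * (L.src k + L.dst k)) / 2 - 8 * L.W * (k + 1)

/-- The period of the circuit. -/
def T : ℚ := (16 * L.N + 8) * L.W / L.v

theorem W_pos : 0 < L.W := L.v_pos.trans_le L.v_le

theorem W_ge : 10 ≤ L.W := by
  have := L.J_le
  have : (0 : ℚ) ≤ L.J := Nat.cast_nonneg _
  linarith

theorem v_mul_T : L.v * L.T = (16 * L.N + 8) * L.W := by
  unfold T
  exact mul_div_cancel₀ _ L.v_pos.ne'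

theorem lane_le {j : ℕ} (hj : j ≤ L.J) : lane j + 10 ≤ L.W := by
  have := L.J_le
  have : (j : ℚ) ≤ L.J := by exact_mod_cast hj
  unfold lane; linarith

theorem lane_nonneg (j : ℕ) : 0 ≤ lane j := by unfold lane; positivity

theorem col_ge (k : Fin L.N) : 4 * L.W ≤ L.col k := by
  have := L.W_pos
  unfold col
  have : (0 : ℚ) ≤ (k : ℕ) := Nat.cast_nonneg _
  nlinarith

theorem row_ge (k : Fin L.N) : 3 * L.W ≤ L.row k := by
  have := L.W_pos
  have h1 := (abs_le.1 (L.corr_le k)).1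
  have h2 : ((k : ℕ) : ℚ) + 1 ≤ L.N := by exact_mod_cast k.2
  unfold row
  nlinarith

theorem col_row_gap {k k' : Fin L.N} (h : k < k') :
    L.col k + 4 * L.W ≤ L.col k' ∧ L.row k' + 6 * L.W ≤ L.row k := by
  have := L.W_pos
  have h2 : ((k : ℕ) : ℚ) + 1 ≤ (k' : ℕ) := by exact_mod_cast h
  have h1 := (abs_le.1 (L.corr_le k)).1
  have h3 := (abs_le.1 (L.corr_le k')).2
  unfold row col
  constructor <;> nlinarith

theorem size_facts (k : Fin L.N) : L.v * (L.tel k).R ≤ L.W ∧ 0 < (L.tel k).R ∧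
    L.v * (|(L.tel k).c| + ((L.tel k).w₃.D + (L.tel k).R)) ≤ L.W ∧
    0 ≤ (L.tel k).w₁.D ∧ (L.tel k).w₁.D ≤ (L.tel k).w₃.D := by
  have h0 := L.size_le k
  have hv := L.v_pos
  have hK := (L.tel k).K_nonneg
  have hl := L.lam_pos k
  have hR : 0 < (L.tel k).R := by unfold Telescope.R; linarith
  have h1 := (L.tel k).w₁.bound_nonneg hR.le
  have h2 := (L.tel k).w₂.bound_nonneg hR.le
  have h3 := (L.tel k).w₃.bound_nonneg hR.le
  have g0 := (L.tel k).D₁_nonneg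
  have g1 := (L.tel k).gap₁
  have g2 := (L.tel k).gap₂
  have hc := abs_nonneg (L.tel k).c
  unfold Telescope.size at h0
  refine ⟨le_trans ?_ h0, hR, le_trans ?_ h0, g0, by linarith⟩ <;>
    refine mul_le_mul_of_nonneg_left ?_ hv.le <;> linarith

theorem T_ge : 8 ≤ L.T := by
  unfold T
  rw [le_div_iff₀ L.v_pos]
  have := L.v_le
  have := L.W_pos
  have : (0 : ℚ) ≤ L.N := Nat.cast_nonneg _
  nlinarith

/-- The telescope of the module `k` that turns a ball that moves up to the left. -/
def tel₁ (k : Fin L.N) : Placement (L.lam k) where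
  tel := L.tel k
  lam_pos := L.lam_pos k
  O := (L.col k, L.row k)
  n := (-1, -1)
  hn := by norm_num
  v := L.v
  hv := L.v_pos
  t₀ := (L.col k + L.row k - lane (L.src k)) / L.v
  T := L.T
  le_t₀ := by
    have h1 := (L.size_facts k).1
    unfold Telescope.R at h1
    rw [le_div_iff₀ L.v_pos]
    have := L.col_ge k
    have := L.row_ge k
    have := L.lane_le (L.src_le k)
    have := L.W_pos
    linarith
  lt_T := by
    have h1 := (L.size_facts k).1
    unfold Telescope.R at h1
    have h2 := L.v_mul_T
    have hW := L.W_pos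
    have : (0 : ℚ) ≤ L.N := Nat.cast_nonneg _
    refine lt_of_mul_lt_mul_left ?_ L.v_pos.le
    nlinarith

/-- The telescope of the module `k` that turns a ball that moves to the left down. -/
def tel₂ (k : Fin L.N) : Placement (L.lam k) where
  tel := L.tel k
  lam_pos := L.lam_pos k
  O := (-L.col k + L.v * (L.tel k).c / 2, L.row k + L.v * (L.tel k).c / 2)
  n := (1, -1)
  hn := by norm_num
  v := L.v
  hv := L.v_pos
  t₀ := (L.col k + L.row k - lane (L.src k)) / L.v + 2 * L.col k / L.v
  T := L.T
  le_t₀ := by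
    refine (L.tel₁ k).le_t₀.trans ?_
    have := L.col_ge k
    have := L.W_pos
    show (L.col k + L.row k - lane (L.src k)) / L.v ≤ _
    have : 0 ≤ 2 * L.col k / L.v := div_nonneg (by linarith) L.v_pos.le
    linarith
  lt_T := (L.tel₁ k).lt_T

/-- A wall that slides along its own direction, so that it meets a ball on the lane `src k` if
and only if the time offset of the ball is in the window of the module. -/
def shutter (k : Fin L.N) : Bar where
  base := (L.col k, lane (L.src k))
  d := (1, 1)
  d_ne := by simp
  lo := -(1 + L.cen k) - L.h
  hi := -(1 + L.cen k) + L.h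
  lo_lt := by linarith [L.h_pos]
  dir := (1, 1)
  start := L.col k / L.v - 1
  start_nonneg := by
    rw [sub_nonneg, le_div_iff₀ L.v_pos]
    have := L.col_ge k
    have := L.W_pos
    have := L.v_le
    linarith
  β := 1
  γ := 0
  t₁ := 2
  t₂ := L.T
  t₁_pos := two_pos
  t₁_lt := by linarith [L.T_ge]

/-- The gate that turns a ball that moves down to the right, into the lane `dst k`. -/
def gate (k : Fin L.N) : RatSegment where
  fst := (-L.col k + 1, lane (L.dst k) - 1)
  snd := (-L.col k - 1, lane (L.dst k) + 1)
  ne := by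
    intro h
    have h1 : -L.col k + 1 = -L.col k - 1 := congrArg Prod.fst h
    linarith

/-- The moving walls of the module `k`. -/
def bars (k : Fin L.N) : List Bar := L.shutter k :: ((L.tel₁ k).bars ++ (L.tel₂ k).bars)

/-- The pinball machine of the circuit. -/
def machine : Machine where
  walls := []
  gates := (List.finRange L.N).map L.gate
  movingWalls := (List.finRange L.N).flatMap fun k => (L.bars k).map Bar.wall

/-- The scene of the circuit. -/
abbrev scene : Scene := L.machine.toScene

theorem mem_walls {m : MovingSegment} : m ∈ L.scene.walls ↔
    ∃ k, ∃ B ∈ L.bars k, m = B.wall.toMovingSegment := by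
  simp only [scene, Machine.toScene, machine, List.map_nil, List.nil_append, List.mem_map,
    List.mem_flatMap, List.mem_finRange, true_and]
  constructor
  · rintro ⟨_, ⟨k, B, hB, rfl⟩, rfl⟩
    exact ⟨k, B, hB, rfl⟩
  · rintro ⟨k, B, hB, rfl⟩
    exact ⟨_, ⟨k, B, hB, rfl⟩, rfl⟩

theorem mem_gates {g : Plane × Plane} : g ∈ L.scene.gates ↔
    ∃ k, g = (toPlane (L.gate k).fst, toPlane (L.gate k).snd) := by
  simp only [scene, Machine.toScene, machine, List.mem_map, List.mem_finRange, true_and]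
  constructor
  · rintro ⟨_, ⟨k, rfl⟩, rfl⟩
    exact ⟨k, rfl⟩
  · rintro ⟨k, rfl⟩
    exact ⟨_, ⟨k, rfl⟩, rfl⟩

section

variable {L} {k k' : Fin L.N} {z : Plane} {t : ℝ}

theorem mem_shutter (h : z ∈ (L.shutter k).pts t) :
    z.1 - z.2 = L.col k - lane (L.src k) ∧ |z.1 - L.col k| ≤ 2 ∧ |z.2 - lane (L.src k)| ≤ 2 := by
  obtain ⟨l, ⟨h1, h2⟩, rfl⟩ := Bar.mem_pts.1 h
  obtain ⟨θ, ⟨h3, h4⟩, τ, ⟨h5, h6⟩, hd⟩ := (L.shutter k).exists_disp_eq t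
  have c0 : (0 : ℝ) ≤ L.cen k := by exact_mod_cast L.cen_nonneg k
  have c1 : (L.cen k : ℝ) ≤ 1 / 2 := by
    have := (Rat.cast_le (K := ℝ)).2 (L.cen_le k); push_cast at this; exact this
  have c2 : (L.h : ℝ) ≤ 1 / 2 := by
    have := (Rat.cast_le (K := ℝ)).2 L.h_le; push_cast at this; exact this
  rw [hd]
  simp only [shutter] at *
  push_cast at *
  have e1 : 0 ≤ θ * τ := mul_nonneg h3 h5
  have e2 : θ * τ ≤ 2 := by nlinarith
  have e3 : θ * (1 * τ + 0 * τ ^ 2) = θ * τ := by ring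
  rw [e3]
  refine ⟨by ring, ?_, ?_⟩ <;> rw [abs_le] <;> constructor <;> linarith

theorem mem_gate (h : z ∈ segment ℝ (toPlane (L.gate k).fst) (toPlane (L.gate k).snd)) :
    z.1 + z.2 = -L.col k + lane (L.dst k) ∧ |z.1 + L.col k| ≤ 1 ∧ |z.2 - lane (L.dst k)| ≤ 1 := by
  rw [segment_eq_image] at h
  obtain ⟨θ, ⟨h0, h1⟩, rfl⟩ := h
  simp only [gate, toPlane, Prod.smul_mk, Prod.mk_add_mk, smul_eq_mul]
  push_cast
  refine ⟨by ring, ?_, ?_⟩ <;> rw [abs_le] <;> constructor <;> linarith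

theorem mem_box₁ (h : z ∈ (L.tel₁ k).box) : |z.1 - L.col k| ≤ L.W ∧ |z.2 - L.row k| ≤ L.W := by
  have h0 : ((L.v * (L.tel k).size : ℚ) : ℝ) ≤ L.W := by exact_mod_cast L.size_le k
  push_cast at h0
  have hv : (0 : ℝ) < L.v := by exact_mod_cast L.v_pos
  have hc := mul_nonneg hv.le (abs_nonneg ((L.tel k).c : ℝ))
  obtain ⟨h1, h2⟩ := h
  simp only [tel₁] at h1 h2
  constructor <;> linarith

theorem mem_box₂ (h : z ∈ (L.tel₂ k).box) : |z.1 + L.col k| ≤ L.W ∧ |z.2 - L.row k| ≤ L.W := by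
  have h0 : ((L.v * (L.tel k).size : ℚ) : ℝ) ≤ L.W := by exact_mod_cast L.size_le k
  push_cast at h0
  have hv : (0 : ℝ) < L.v := by exact_mod_cast L.v_pos
  have hc := mul_nonneg hv.le (abs_nonneg ((L.tel k).c : ℝ))
  have hc1 := mul_le_mul_of_nonneg_left (le_abs_self ((L.tel k).c : ℝ)) hv.le
  have hc2 := mul_le_mul_of_nonneg_left (neg_abs_le ((L.tel k).c : ℝ)) hv.le
  obtain ⟨h1, h2⟩ := h
  simp only [tel₂] at h1 h2
  push_cast at h1 h2
  rw [abs_le] at *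
  rw [abs_le] at *
  obtain ⟨h1, h1'⟩ := h1
  obtain ⟨h2, h2'⟩ := h2
  refine ⟨⟨?_, ?_⟩, ?_, ?_⟩ <;> linarith

/-- The part of the plane that is reserved for the module `k`. -/
def zone (L : Layout) (k : Fin L.N) : Set Plane :=
  {z | |z.1 - L.col k| ≤ L.W ∨ |z.1 + L.col k| ≤ L.W ∨ |z.2 - L.row k| ≤ L.W}

theorem gaps (h : k ≠ k') : (2 * L.W < |(L.col k : ℝ) - L.col k'|) ∧
    (2 * L.W < |(L.row k : ℝ) - L.row k'|) := by
  have hW : (0 : ℝ) < L.W := by exact_mod_cast L.W_pos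
  rcases lt_or_gt_of_ne h with h | h
  · obtain ⟨h1, h2⟩ := L.col_row_gap h
    have h1' : (L.col k : ℝ) + 4 * L.W ≤ L.col k' := by exact_mod_cast h1
    have h2' : (L.row k' : ℝ) + 6 * L.W ≤ L.row k := by exact_mod_cast h2
    constructor
    · rw [abs_sub_comm]; exact lt_of_lt_of_le (by linarith) (le_abs_self _)
    · exact lt_of_lt_of_le (by linarith) (le_abs_self _)
  · obtain ⟨h1, h2⟩ := L.col_row_gap h
    have h1' : (L.col k' : ℝ) + 4 * L.W ≤ L.col k := by exact_mod_cast h1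
    have h2' : (L.row k : ℝ) + 6 * L.W ≤ L.row k' := by exact_mod_cast h2
    constructor
    · exact lt_of_lt_of_le (by linarith) (le_abs_self _)
    · rw [abs_sub_comm]; exact lt_of_lt_of_le (by linarith) (le_abs_self _)

theorem real_facts (L : Layout) (k : Fin L.N) : (10 : ℝ) ≤ L.W ∧ 4 * (L.W : ℝ) ≤ L.col k ∧
    3 * (L.W : ℝ) ≤ L.row k ∧ (0 : ℝ) < L.v ∧ (L.v : ℝ) ≤ L.W := by
  refine ⟨?_, ?_, ?_, ?_, ?_⟩
  · exact_mod_cast L.W_ge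
  · exact_mod_cast L.col_ge k
  · exact_mod_cast L.row_ge k
  · exact_mod_cast L.v_pos
  · exact_mod_cast L.v_le

theorem lane_facts (L : Layout) {j : ℕ} (hj : j ≤ L.J) : (0 : ℝ) ≤ lane j ∧
    (lane j : ℝ) + 10 ≤ L.W := by
  constructor
  · exact_mod_cast lane_nonneg j
  · exact_mod_cast L.lane_le hj

/-- Coordinates of the points of the components of a module. -/
theorem mem_bars {B : Bar} (hB : B ∈ L.bars k) (h : z ∈ B.pts t) :
    (B = L.shutter k ∧ z.1 - z.2 = L.col k - lane (L.src k) ∧ |z.1 - L.col k| ≤ 2 ∧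
      |z.2 - lane (L.src k)| ≤ 2) ∨
    (B ∈ (L.tel₁ k).bars ∧ |z.1 - L.col k| ≤ L.W ∧ |z.2 - L.row k| ≤ L.W) ∨
    (B ∈ (L.tel₂ k).bars ∧ |z.1 + L.col k| ≤ L.W ∧ |z.2 - L.row k| ≤ L.W) := by
  simp only [bars, List.mem_cons, List.mem_append] at hB
  rcases hB with rfl | hB | hB
  · exact .inl ⟨rfl, mem_shutter h⟩
  · exact .inr (.inl ⟨hB, mem_box₁ ((L.tel₁ k).pts_subset_box hB t h)⟩)
  · exact .inr (.inr ⟨hB, mem_box₂ ((L.tel₂ k).pts_subset_box hB t h)⟩)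

theorem bars_disjoint_zone {B : Bar} (hB : B ∈ L.bars k') (h : z ∈ B.pts t) (hz : z ∈ L.zone k) :
    k' = k := by
  by_contra hne
  obtain ⟨g1, g2⟩ := gaps hne
  obtain ⟨f1, f2, f3, f4, f5⟩ := L.real_facts k
  obtain ⟨-, f2', f3', -, -⟩ := L.real_facts k'
  obtain ⟨l1, l2⟩ := L.lane_facts (L.src_le k')
  rw [lt_abs] at g1 g2
  have hz : |z.1 - L.col k| ≤ L.W ∨ |z.1 + L.col k| ≤ L.W ∨ |z.2 - L.row k| ≤ L.W := hz
  simp only [abs_le] at hz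
  rcases mem_bars hB h with ⟨-, h1, h2, h3⟩ | ⟨-, h2, h3⟩ | ⟨-, h2, h3⟩ <;>
    rw [abs_le] at h2 h3 <;> obtain ⟨h2, h2'⟩ := h2 <;> obtain ⟨h3, h3'⟩ := h3 <;>
    rcases hz with ⟨hz, hz'⟩ | ⟨hz, hz'⟩ | ⟨hz, hz'⟩ <;>
    first | linarith | (rcases g1 with g1 | g1 <;> linarith) | (rcases g2 with g2 | g2 <;> linarith)

theorem gate_disjoint_zone
    (h : z ∈ segment ℝ (toPlane (L.gate k').fst) (toPlane (L.gate k').snd)) (hz : z ∈ L.zone k) :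
    k' = k := by
  by_contra hne
  obtain ⟨g1, g2⟩ := gaps hne
  obtain ⟨f1, f2, f3, f4, f5⟩ := L.real_facts k
  obtain ⟨-, f2', f3', -, -⟩ := L.real_facts k'
  obtain ⟨l1, l2⟩ := L.lane_facts (L.dst_le k')
  rw [lt_abs] at g1 g2
  have hz : |z.1 - L.col k| ≤ L.W ∨ |z.1 + L.col k| ≤ L.W ∨ |z.2 - L.row k| ≤ L.W := hz
  simp only [abs_le] at hz
  obtain ⟨-, h2, h3⟩ := mem_gate h
  rw [abs_le] at h2 h3
  obtain ⟨h2, h2'⟩ := h2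
  obtain ⟨h3, h3'⟩ := h3
  rcases hz with ⟨hz, hz'⟩ | ⟨hz, hz'⟩ | ⟨hz, hz'⟩ <;>
    first | linarith | (rcases g1 with g1 | g1 <;> linarith)

end

end Layout

/-! ### Lanes and shutters -/

namespace Layout

variable (L : Layout)

/-- The ports are the points of the lanes on the vertical axis. -/
def ports : Set Plane := {z | ∃ j ≤ L.J, z = toPlane (0, lane j)}

/-- A ball on the lane `j` at time `t`, which passes the port of the lane at time `n * T + Δ`. -/
def laneBall (n : ℕ) (Δ : ℝ) (j : ℕ) (t : ℝ) : Ball :=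
  ⟨t, ((t - (n * L.T + Δ)) * L.v, lane j), (L.v, 0)⟩

variable {L} {n j : ℕ} {Δ t t' : ℝ} {k : Fin L.N}

theorem posAt_laneBall :
    (L.laneBall n Δ j t).posAt t' = ((t' - (n * L.T + Δ)) * L.v, (lane j : ℝ)) := by
  ext <;> simp [laneBall, Ball.posAt]
  ring

theorem laneBall_port :
    L.laneBall n Δ j (n * L.T + Δ) = ⟨n * L.T + Δ, toPlane (0, lane j), (L.v, 0)⟩ := by
  simp [laneBall, toPlane]

theorem notMem_ports_of_ne {z : Plane} (h : z.1 ≠ 0) : z ∉ L.ports := by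
  rintro ⟨j, -, rfl⟩
  simp [toPlane] at h

theorem notMem_ports_of_zone {z : Plane} (h : z ∈ L.zone k) : z ∉ L.ports := by
  rintro ⟨j, hj, rfl⟩
  obtain ⟨f1, f2, f3, f4, f5⟩ := L.real_facts k
  obtain ⟨l1, l2⟩ := L.lane_facts hj
  have hz : |(((0 : ℚ) : ℝ)) - L.col k| ≤ L.W ∨ |((0 : ℚ) : ℝ) + L.col k| ≤ L.W ∨
    |(lane j : ℝ) - L.row k| ≤ L.W := h
  simp only [abs_le] at hz
  push_cast at hz
  rcases hz with ⟨hz, hz'⟩ | ⟨hz, hz'⟩ | ⟨hz, hz'⟩ <;> linarith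

/-- One-way gates are open for a ball that moves to the right. -/
theorem gate_open {g : Plane × Plane} (hg : g ∈ L.scene.gates) :
    ¬ 0 < cross (g.2 - g.1) ((L.v : ℝ), 0) := by
  obtain ⟨k, rfl⟩ := L.mem_gates.1 hg
  obtain ⟨f1, f2, f3, f4, f5⟩ := L.real_facts k
  simp only [cross, gate, toPlane, Prod.fst_sub, Prod.snd_sub]
  push_cast
  linarith

/-- On a lane, a ball can only be met by the shutters of this lane. -/
theorem lane_walls (hj : j ≤ L.J) {m : MovingSegment} (hm : m ∈ L.scene.walls)
    (h : (((t - (n * L.T + Δ)) * L.v, (lane j : ℝ)) : Plane) ∈ m.at t) :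
    ∃ k, L.src k = j ∧ m = (L.shutter k).wall.toMovingSegment ∧
      t = n * L.T + Δ + L.col k / L.v := by
  obtain ⟨k, B, hB, rfl⟩ := L.mem_walls.1 hm
  obtain ⟨f1, f2, f3, f4, f5⟩ := L.real_facts k
  obtain ⟨l1, l2⟩ := L.lane_facts hj
  rcases mem_bars hB h with ⟨rfl, h1, -, h3⟩ | ⟨-, -, h3⟩ | ⟨-, -, h3⟩
  · have e : L.src k = j := by
      simp only [lane] at h3
      push_cast at h3
      have h3 := abs_le.1 h3
      by_contra hne
      rcases lt_or_gt_of_ne hne with h | h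
      · have : ((L.src k : ℕ) : ℝ) + 1 ≤ j := by exact_mod_cast h
        linarith
      · have : (j : ℝ) + 1 ≤ L.src k := by exact_mod_cast h
        linarith
    refine ⟨k, e, rfl, ?_⟩
    rw [e] at h1
    field_simp
    simp only at h1
    linarith
  · have h3 := (abs_le.1 h3).1
    simp only at h3
    linarith
  · have h3 := (abs_le.1 h3).1
    simp only at h3
    linarith

/-- A shutter meets a ball on its lane if and only if the time offset is in the window. -/
theorem mem_shutter_iff (hΔ : Δ ∈ Set.Icc (0 : ℝ) (1 / 2)) :
    (((L.col k : ℝ), (lane (L.src k) : ℝ)) : Plane) ∈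
      (L.shutter k).pts (n * L.T + Δ + L.col k / L.v) ↔ |Δ - L.cen k| ≤ L.h := by
  have e : (n * L.T + Δ + L.col k / L.v : ℝ) =
      (L.shutter k).start + n * (L.shutter k).t₂ + (Δ + 1) := by
    simp [shutter]; ring
  have hd : (L.shutter k).wall.disp (n * L.T + Δ + L.col k / L.v) = Δ + 1 := by
    rw [e, Bar.disp_eq]
    · simp [shutter]
    · linarith [hΔ.1]
    · simp only [shutter]; push_cast; linarith [hΔ.2]
  rw [Bar.mem_pts, hd, abs_le]
  simp only [shutter, Set.mem_Icc, Prod.mk.injEq]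
  push_cast
  constructor
  · rintro ⟨l, ⟨h1, h2⟩, h3, -⟩
    constructor <;> linarith
  · rintro ⟨h1, h2⟩
    exact ⟨-(Δ + 1), ⟨by linarith, by linarith⟩, by ring, by ring⟩

theorem reflect_shutter (t : ℝ) :
    reflect ((L.shutter k).wall.toMovingSegment.snd - (L.shutter k).wall.toMovingSegment.fst)
      ((L.shutter k).wall.toMovingSegment.vel t) ((L.v : ℝ), 0) = (0, (L.v : ℝ)) := by
  rw [Bar.reflect_eq]
  generalize (L.shutter k).wall.speed t = a
  ext <;> simp [reflect, dot, normal, toPlane, shutter] <;> ring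

/-- If no module of the lane accepts the offset, then the ball stays on the lane. -/
theorem laneBall_free (hj : j ≤ L.J) {I : Set ℝ}
    (h : ∀ s ∈ I, ∀ k, L.src k = j → s = n * L.T + Δ + L.col k / L.v →
      ((L.col k : ℝ), (lane (L.src k) : ℝ)) ∉ (L.shutter k).pts s) :
    L.scene.Free (L.laneBall n Δ j t) I := by
  refine Scene.free_of_forall ?_ fun s hs g hg _ => gate_open hg
  intro s hs m hm hx
  rw [posAt_laneBall] at hx
  obtain ⟨k, hk, rfl, ht⟩ := lane_walls hj hm hx
  refine h s hs k hk ht ?_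
  have hv : (L.v : ℝ) ≠ 0 := (L.real_facts k).2.2.2.1.ne'
  have e : (s - (n * L.T + Δ)) * L.v = (L.col k : ℝ) := by
    rw [ht]; field_simp; ring
  rw [e, ← hk] at hx
  exact hx

theorem laneBall_free_of_le (hj : j ≤ L.J) {I : Set ℝ} (h : ∀ s ∈ I, s ≤ n * L.T + Δ) :
    L.scene.Free (L.laneBall n Δ j t) I := by
  refine laneBall_free hj fun s hs k _ he => ?_
  obtain ⟨f1, f2, f3, f4, f5⟩ := L.real_facts k
  have := h s hs
  have : (0 : ℝ) < L.col k / L.v := div_pos (by linarith) f4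
  linarith

/-- First part of the way through a module: the ball is taken from the lane. -/
theorem track_shutter (hΔ : Δ ∈ Set.Icc (0 : ℝ) (1 / 2)) (hk : |Δ - L.cen k| ≤ L.h)
    (huniq : ∀ k', L.src k' = L.src k → |Δ - L.cen k'| ≤ L.h → k' = k) :
    L.scene.Track L.ports (L.laneBall n Δ (L.src k) (n * L.T + Δ)) 1
      ⟨n * L.T + Δ + L.col k / L.v, (L.col k, lane (L.src k)), (0, L.v)⟩ := by
  obtain ⟨f1, f2, f3, f4, f5⟩ := L.real_facts k
  have hpos : (0 : ℝ) < L.col k / L.v := div_pos (by linarith) f4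
  have e : ((L.col k : ℝ), (lane (L.src k) : ℝ)) =
      (L.laneBall n Δ (L.src k) (n * L.T + Δ)).posAt (n * L.T + Δ + L.col k / L.v) := by
    rw [posAt_laneBall, add_sub_cancel_left, div_mul_cancel₀ _ f4.ne']
  rw [e]
  refine Scene.Track.bounce (Scene.bounce_of_leg ?_ ?_ ?_ ?_) ?_
  · show (n * L.T + Δ : ℝ) < _
    linarith
  · intro t ht m hm hx
    rw [posAt_laneBall] at hx
    obtain ⟨k', hk', rfl, rfl⟩ := lane_walls (L.src_le k) hm hx
    rw [add_sub_cancel_left, div_mul_cancel₀ _ f4.ne', ← hk'] at hx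
    obtain rfl := huniq k' hk' ((mem_shutter_iff hΔ).1 hx)
    exact ⟨rfl, reflect_shutter _⟩
  · intro t ht g hg _ hc
    exact absurd hc (gate_open hg)
  · refine .inl ⟨(L.shutter k).wall.toMovingSegment, L.mem_walls.2 ⟨k, _, by simp [bars], rfl⟩, ?_⟩
    rw [← e]
    exact (mem_shutter_iff hΔ).2 hk
  · rintro s ⟨hs, -⟩
    refine notMem_ports_of_ne ?_
    rw [posAt_laneBall]
    have hs : (n * L.T + Δ : ℝ) < s := hs
    exact (mul_pos (sub_pos.2 hs) f4).ne'

/-- In its zone, a ball can only be met by the components of the module. -/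
theorem zone_walls {z : Plane} (hz : z ∈ L.zone k) {m : MovingSegment} (hm : m ∈ L.scene.walls)
    (h : z ∈ m.at t) :
    (m = (L.shutter k).wall.toMovingSegment ∧ z.1 - z.2 = L.col k - lane (L.src k) ∧
      |z.1 - L.col k| ≤ 2 ∧ |z.2 - lane (L.src k)| ≤ 2) ∨
    ((∃ B ∈ (L.tel₁ k).bars, m = B.wall.toMovingSegment) ∧ |z.1 - L.col k| ≤ L.W ∧
      |z.2 - L.row k| ≤ L.W) ∨
    ((∃ B ∈ (L.tel₂ k).bars, m = B.wall.toMovingSegment) ∧ |z.1 + L.col k| ≤ L.W ∧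
      |z.2 - L.row k| ≤ L.W) := by
  obtain ⟨k', B, hB, rfl⟩ := L.mem_walls.1 hm
  obtain rfl := bars_disjoint_zone hB h hz
  rcases mem_bars hB h with ⟨rfl, h'⟩ | ⟨hB, h'⟩ | ⟨hB, h'⟩
  · exact .inl ⟨rfl, h'⟩
  · exact .inr (.inl ⟨⟨B, hB, rfl⟩, h'⟩)
  · exact .inr (.inr ⟨⟨B, hB, rfl⟩, h'⟩)

theorem zone_gates {z : Plane} (hz : z ∈ L.zone k) {g : Plane × Plane} (hg : g ∈ L.scene.gates)
    (h : z ∈ segment ℝ g.1 g.2) :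
    g = (toPlane (L.gate k).fst, toPlane (L.gate k).snd) ∧ z.1 + z.2 = -L.col k + lane (L.dst k) ∧
      |z.1 + L.col k| ≤ 1 ∧ |z.2 - lane (L.dst k)| ≤ 1 := by
  obtain ⟨k', rfl⟩ := L.mem_gates.1 hg
  obtain rfl := gate_disjoint_zone h hz
  exact ⟨rfl, mem_gate h⟩

theorem framePt_tel₁ (p q : ℝ) : framePt (L.tel₁ k).O (L.tel₁ k).n (L.tel₁ k).v p q =
    (L.col k - L.v * (p + q) / 2, L.row k + L.v * (q - p) / 2) := by
  ext <;> simp only [framePt, tel₁] <;> push_cast <;> ring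

theorem framePt_tel₂ (p q : ℝ) : framePt (L.tel₂ k).O (L.tel₂ k).n (L.tel₂ k).v p q =
    (-L.col k + L.v * ((L.tel k).c + p - q) / 2, L.row k + L.v * ((L.tel k).c - p - q) / 2) := by
  ext <;> simp only [framePt, tel₂] <;> push_cast <;> ring

theorem ball_tel₁ :
    (⟨n * L.T + Δ + L.col k / L.v, (L.col k, lane (L.src k)), (0, L.v)⟩ : Ball) =
    (L.tel₁ k).ball n Δ Δ (-1) (Δ - (L.row k - lane (L.src k)) / L.v) := by
  have hv : (L.v : ℝ) ≠ 0 := (L.real_facts k).2.2.2.1.ne'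
  rw [Placement.ball, framePt_tel₁]
  congr 1
  · simp [Placement.clock, tel₁]; field_simp; ring
  · ext
    · ring
    · simp only; field_simp; ring
  · ext <;> simp [frameVel, tel₁]
    ring

theorem ball_tel₁_tel₂ (q t : ℝ) :
    (L.tel₁ k).ball n Δ (-q - (L.tel k).c) 1 t =
    (L.tel₂ k).ball n q Δ (-1) (t - 2 * L.col k / L.v) := by
  have hv : (L.v : ℝ) ≠ 0 := (L.real_facts k).2.2.2.1.ne'
  rw [Placement.ball, Placement.ball, framePt_tel₁, framePt_tel₂]
  congr 1
  · simp [Placement.clock, tel₁, tel₂]; ring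
  · ext
    · simp only; field_simp; ring
    · simp only; field_simp; ring
  · ext <;> simp [frameVel, tel₁, tel₂]

/-- A ball that reaches the gate at the height of the lane is there at the moment at which a ball
that runs on this lane with the new offset passes the column of the gate. The choice of `row` is
made for this equation. -/
theorem gate_time : ((L.tel₂ k).clock n (L.lam k * Δ + (L.tel k).c +
      (L.row k - lane (L.dst k)) / L.v) - ((n + 1 : ℕ) * L.T + (L.lam k * Δ + L.β k))) * L.v =
    -(L.col k : ℝ) := by
  have hv : (L.v : ℝ) ≠ 0 := (L.real_facts k).2.2.2.1.ne'
  have hT : (L.v : ℝ) * L.T = (16 * L.N + 8) * L.W := by exact_mod_cast L.v_mul_T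
  simp only [Placement.clock, tel₂]
  push_cast
  field_simp
  simp only [row, col, lane]
  push_cast
  linear_combination -hT

end Layout

/-! ### The way through a module -/

namespace Layout

variable {L : Layout} {n j : ℕ} {Δ t t' : ℝ} {k : Fin L.N}

theorem size_facts_real (k : Fin L.N) :
    (L.v : ℝ) * |((L.tel k).c : ℝ)| + L.v * ((L.tel k).w₃.D + (L.tel k).R) ≤ L.W ∧
    (0 : ℝ) ≤ (L.tel k).w₁.D + (L.tel k).R ∧
    (L.v : ℝ) * ((L.tel k).w₁.D + (L.tel k).R) ≤ L.v * ((L.tel k).w₃.D + (L.tel k).R) := by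
  obtain ⟨-, h2, h3, h4, h5⟩ := L.size_facts k
  have hv := L.v_pos
  refine ⟨?_, ?_, ?_⟩
  · rw [← mul_add]; exact_mod_cast h3
  · have : 0 ≤ (L.tel k).w₁.D + (L.tel k).R := by linarith
    exact_mod_cast this
  · have := mul_le_mul_of_nonneg_left
      (show (L.tel k).w₁.D + (L.tel k).R ≤ (L.tel k).w₃.D + (L.tel k).R by linarith) hv.le
    exact_mod_cast this

/-- Second part of the way through a module: up, and through the first telescope. -/
theorem track_tel₁ (hΔ : Δ ∈ Set.Icc (0 : ℝ) (1 / 2)) :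
    ∃ t₃ : ℝ, t₃ ≤ (L.tel k).w₃.D + (L.tel k).R ∧
      L.scene.Track L.ports ⟨n * L.T + Δ + L.col k / L.v, (L.col k, lane (L.src k)), (0, L.v)⟩ 3
        ((L.tel₁ k).ball n Δ (-(L.lam k * Δ) - (L.tel k).c) 1 t₃) ∧
      framePt (L.tel₁ k).O (L.tel₁ k).n (L.tel₁ k).v (-(L.lam k * Δ) - (L.tel k).c + 1 * t₃)
        (t₃ - Δ) ∈ (L.tel₁ k).box ∧
      ∀ t, t₃ < t → ∀ B ∈ (L.tel₁ k).bars,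
        framePt (L.tel₁ k).O (L.tel₁ k).n (L.tel₁ k).v (-(L.lam k * Δ) - (L.tel k).c + 1 * t)
          (t - Δ) ∉ B.pts ((L.tel₁ k).clock n t) := by
  obtain ⟨f1, f2, f3, f4, f5⟩ := L.real_facts k
  obtain ⟨l1, l2⟩ := L.lane_facts (L.src_le k)
  obtain ⟨l3, l4⟩ := L.lane_facts (L.dst_le k)
  obtain ⟨s1, s2, s3⟩ := L.size_facts_real k
  have s4 : 0 ≤ (L.v : ℝ) * |((L.tel k).c : ℝ)| := mul_nonneg f4.le (abs_nonneg _)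
  have hlam : (0 : ℝ) < L.lam k := by exact_mod_cast L.lam_pos k
  have hz0 : ∀ t, framePt (L.tel₁ k).O (L.tel₁ k).n (L.tel₁ k).v (Δ + (-1) * t) (t - Δ) =
      ((L.col k : ℝ), L.row k + L.v * (t - Δ)) := by
    intro t
    rw [framePt_tel₁]
    ext
    · simp only; ring
    · simp only; ring
  have hzone : ∀ t, framePt (L.tel₁ k).O (L.tel₁ k).n (L.tel₁ k).v (Δ + (-1) * t) (t - Δ) ∈
      L.zone k := by
    intro t
    rw [hz0]
    refine .inl ?_
    simp only [sub_self, abs_zero]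
    linarith
  have hbzone : ∀ z ∈ (L.tel₁ k).box, z ∈ L.zone k := fun z hz => .inl (mem_box₁ hz).1
  rw [ball_tel₁]
  refine Exists.elim ((L.tel₁ k).transit (S := L.scene) (Z := L.ports) n hΔ
    (σ := Δ) (t₀ := Δ - (L.row k - lane (L.src k)) / L.v) ?_ ?_ ?_ ?_ ?_ ?_ ?_ ?_ ?_) ?_
  · rw [abs_of_nonneg hΔ.1]; linarith [hΔ.2]
  · show Δ - (L.row k - lane (L.src k)) / L.v < -((L.tel k).w₁.D + (L.tel k).R)
    rw [sub_lt_iff_lt_add, ← sub_lt_iff_lt_add', lt_div_iff₀ f4]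
    have := mul_le_mul_of_nonneg_left hΔ.2 f4.le
    linarith
  · exact fun B hB => L.mem_walls.2 ⟨k, B, by simp [bars, hB], rfl⟩
  · intro t ht m hm hx
    rcases zone_walls (hzone t) hm hx with ⟨-, h, -, -⟩ | ⟨h, -, -⟩ | ⟨-, h, -⟩
    · exfalso
      rw [hz0] at h
      simp only at h
      rw [sub_lt_iff_lt_add', ← sub_lt_iff_lt_add, sub_lt_comm] at ht
      have ht' : (L.row k - lane (L.src k) : ℝ) / L.v > Δ - t := by linarith
      rw [gt_iff_lt, lt_div_iff₀ f4] at ht'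
      linarith
    · exact h
    · exfalso
      rw [hz0] at h
      have h := (abs_le.1 h).2
      simp only at h
      linarith
  · intro t ht g hg hx
    obtain ⟨-, -, h, -⟩ := zone_gates (hzone t) hg hx
    rw [hz0] at h
    have h := (abs_le.1 h).2
    simp only at h
    linarith
  · exact fun t _ => notMem_ports_of_zone (hzone t)
  · intro z hz t m hm hx
    have hb := mem_box₁ hz
    rw [abs_le, abs_le] at hb
    rcases zone_walls (hbzone z hz) hm hx with ⟨-, -, -, h⟩ | ⟨h, -, -⟩ | ⟨-, h, -⟩
    · rw [abs_le] at h
      linarith [hb.2.1, h.2]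
    · exact h
    · rw [abs_le] at h
      linarith [hb.1.1, h.2]
  · intro z hz g hg hx
    have hb := mem_box₁ hz
    obtain ⟨-, -, h, -⟩ := zone_gates (hbzone z hz) hg hx
    rw [abs_le] at hb h
    linarith [hb.1.1, h.2]
  · exact fun z hz => notMem_ports_of_zone (hbzone z hz)
  · rintro t₃ ⟨h1, h2, h3, h4⟩
    refine ⟨t₃, h1, ?_, ?_, ?_⟩
    · convert h2 using 2
      simp [tel₁]
    · convert h3 using 2
      simp [tel₁]
    · intro t ht B hB
      have := h4 t ht B hB
      convert this using 2
      simp [tel₁]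

/-- Third part of the way through a module: to the left, and through the second telescope. -/
theorem track_tel₂ (hΔ : Δ ∈ Set.Icc (0 : ℝ) (1 / 2)) {t₃ : ℝ}
    (ht₃ : t₃ ≤ (L.tel k).w₃.D + (L.tel k).R)
    (hbox : framePt (L.tel₁ k).O (L.tel₁ k).n (L.tel₁ k).v (-(L.lam k * Δ) - (L.tel k).c + 1 * t₃)
        (t₃ - Δ) ∈ (L.tel₁ k).box)
    (hfree : ∀ t, t₃ < t → ∀ B ∈ (L.tel₁ k).bars,
        framePt (L.tel₁ k).O (L.tel₁ k).n (L.tel₁ k).v (-(L.lam k * Δ) - (L.tel k).c + 1 * t)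
          (t - Δ) ∉ B.pts ((L.tel₁ k).clock n t)) :
    ∃ t₆ : ℝ, L.scene.Track L.ports ((L.tel₁ k).ball n Δ (-(L.lam k * Δ) - (L.tel k).c) 1 t₃) 3
        ((L.tel₂ k).ball n (L.lam k * Δ) (-(L.lam k * Δ) - (L.tel k).c) 1 t₆) ∧
      framePt (L.tel₂ k).O (L.tel₂ k).n (L.tel₂ k).v (-(L.lam k * Δ) - (L.tel k).c + 1 * t₆)
        (t₆ - L.lam k * Δ) ∈ (L.tel₂ k).box ∧
      ∀ t, t₆ < t → ∀ B ∈ (L.tel₂ k).bars,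
        framePt (L.tel₂ k).O (L.tel₂ k).n (L.tel₂ k).v (-(L.lam k * Δ) - (L.tel k).c + 1 * t)
          (t - L.lam k * Δ) ∉ B.pts ((L.tel₂ k).clock n t) := by
  obtain ⟨f1, f2, f3, f4, f5⟩ := L.real_facts k
  obtain ⟨l1, l2⟩ := L.lane_facts (L.src_le k)
  obtain ⟨l3, l4⟩ := L.lane_facts (L.dst_le k)
  obtain ⟨s1, s2, s3⟩ := L.size_facts_real k
  have s4 : 0 ≤ (L.v : ℝ) * |((L.tel k).c : ℝ)| := mul_nonneg f4.le (abs_nonneg _)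
  have hlam : (0 : ℝ) < L.lam k := by exact_mod_cast L.lam_pos k
  have hlΔ : 0 ≤ L.lam k * Δ := mul_nonneg hlam.le hΔ.1
  -- the ball moves on a horizontal line close to the row of the module
  have hrow : |(L.row k + L.v * ((t₃ - Δ) - (-(L.lam k * Δ) - (L.tel k).c + 1 * t₃)) / 2 : ℝ) -
      L.row k| ≤ L.W := by
    have := (mem_box₁ hbox).2
    rwa [framePt_tel₁] at this
  have hy : ∀ t, |(framePt (L.tel₂ k).O (L.tel₂ k).n (L.tel₂ k).v (Δ + (-1) * t)
      (t - L.lam k * Δ)).2 - L.row k| ≤ L.W := by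
    intro t
    rw [framePt_tel₂]
    show |(L.row k + L.v * ((L.tel k).c - (Δ + (-1) * t) - (t - L.lam k * Δ)) / 2 : ℝ) -
      L.row k| ≤ L.W
    convert hrow using 2
    ring
  have hzone : ∀ t, framePt (L.tel₂ k).O (L.tel₂ k).n (L.tel₂ k).v (Δ + (-1) * t)
      (t - L.lam k * Δ) ∈ L.zone k := fun t => .inr (.inr (hy t))
  have hbzone : ∀ z ∈ (L.tel₂ k).box, z ∈ L.zone k := fun z hz => .inr (.inl (mem_box₂ hz).1)
  rw [ball_tel₁_tel₂]
  refine Exists.elim ((L.tel₂ k).transit (S := L.scene) (Z := L.ports) n hΔ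
    (σ := L.lam k * Δ) (t₀ := t₃ - 2 * L.col k / L.v) ?_ ?_ ?_ ?_ ?_ ?_ ?_ ?_ ?_) ?_
  · rw [abs_of_nonneg hlΔ]; nlinarith [hΔ.2]
  · show t₃ - 2 * L.col k / L.v < -((L.tel k).w₁.D + (L.tel k).R)
    rw [sub_lt_iff_lt_add, ← sub_lt_iff_lt_add', lt_div_iff₀ f4]
    have := mul_le_mul_of_nonneg_left ht₃ f4.le
    linarith
  · exact fun B hB => L.mem_walls.2 ⟨k, B, by simp [bars, hB], rfl⟩
  · intro t ht m hm hx
    have hy' := abs_le.1 (hy t)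
    rcases zone_walls (hzone t) hm hx with ⟨-, -, -, h⟩ | ⟨⟨B, hB, rfl⟩, -, -⟩ | ⟨h, -, -⟩
    · exfalso
      rw [abs_le] at h
      linarith [hy'.1, h.2]
    · exfalso
      refine hfree (t + 2 * L.col k / L.v) (by linarith) B hB ?_
      have e : (L.tel₁ k).clock n (t + 2 * L.col k / L.v) = (L.tel₂ k).clock n t := by
        simp [Placement.clock, tel₁, tel₂]; ring
      rw [e]
      have hx : _ ∈ B.pts ((L.tel₂ k).clock n t) := hx
      convert hx using 1
      rw [framePt_tel₁, framePt_tel₂]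
      ext
      · simp only; field_simp; ring
      · simp only; ring
    · exact h
  · intro t ht g hg hx
    have hy' := abs_le.1 (hy t)
    obtain ⟨-, -, -, h⟩ := zone_gates (hzone t) hg hx
    rw [abs_le] at h
    linarith [hy'.1, h.2]
  · exact fun t _ => notMem_ports_of_zone (hzone t)
  · intro z hz t m hm hx
    have hb := mem_box₂ hz
    rw [abs_le, abs_le] at hb
    rcases zone_walls (hbzone z hz) hm hx with ⟨-, -, -, h⟩ | ⟨-, h, -⟩ | ⟨h, -, -⟩
    · rw [abs_le] at h
      linarith [hb.2.1, h.2]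
    · rw [abs_le] at h
      linarith [hb.1.2, h.1]
    · exact h
  · intro z hz g hg hx
    have hb := mem_box₂ hz
    obtain ⟨-, -, -, h⟩ := zone_gates (hbzone z hz) hg hx
    rw [abs_le, abs_le] at hb
    rw [abs_le] at h
    linarith [hb.2.1, h.2]
  · exact fun z hz => notMem_ports_of_zone (hbzone z hz)
  · rintro t₆ ⟨h1, h2, h3, h4⟩
    refine ⟨t₆, ?_, ?_, ?_⟩
    · convert h2 using 2
      simp [tel₂]
    · convert h3 using 2
      simp [tel₂]
    · intro t ht B hB
      have := h4 t ht B hB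
      convert this using 2
      simp [tel₂]

/-- Last part of the way through a module: down to the lane, and to the port. -/
theorem track_gate {t₆ : ℝ}
    (hbox : framePt (L.tel₂ k).O (L.tel₂ k).n (L.tel₂ k).v (-(L.lam k * Δ) - (L.tel k).c + 1 * t₆)
        (t₆ - L.lam k * Δ) ∈ (L.tel₂ k).box)
    (hfree : ∀ t, t₆ < t → ∀ B ∈ (L.tel₂ k).bars,
        framePt (L.tel₂ k).O (L.tel₂ k).n (L.tel₂ k).v (-(L.lam k * Δ) - (L.tel k).c + 1 * t)
          (t - L.lam k * Δ) ∉ B.pts ((L.tel₂ k).clock n t)) :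
    L.scene.Track L.ports ((L.tel₂ k).ball n (L.lam k * Δ) (-(L.lam k * Δ) - (L.tel k).c) 1 t₆) 1
      (L.laneBall (n + 1) (L.lam k * Δ + L.β k) (L.dst k) ((n + 1 : ℕ) * L.T +
        (L.lam k * Δ + L.β k))) := by
  obtain ⟨f1, f2, f3, f4, f5⟩ := L.real_facts k
  obtain ⟨l1, l2⟩ := L.lane_facts (L.src_le k)
  obtain ⟨l3, l4⟩ := L.lane_facts (L.dst_le k)
  set tg : ℝ := L.lam k * Δ + (L.tel k).c + (L.row k - lane (L.dst k)) / L.v with htg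
  set b := (L.tel₂ k).ball n (L.lam k * Δ) (-(L.lam k * Δ) - (L.tel k).c) 1 t₆ with hb
  have hgt := gate_time (n := n) (Δ := Δ) (k := k)
  rw [← htg] at hgt
  have hpos : ∀ t, framePt (L.tel₂ k).O (L.tel₂ k).n (L.tel₂ k).v
      (-(L.lam k * Δ) - (L.tel k).c + 1 * t) (t - L.lam k * Δ) =
      (-(L.col k : ℝ), lane (L.dst k) + L.v * (tg - t)) := by
    intro t
    rw [framePt_tel₂, htg]
    ext
    · simp only; ring
    · simp only; field_simp; ring
  have hzone : ∀ t, ((-(L.col k : ℝ), lane (L.dst k) + L.v * (tg - t)) : Plane) ∈ L.zone k := by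
    intro t
    refine .inr (.inl ?_)
    simp only [neg_add_cancel, abs_zero]
    linarith
  have hlt : t₆ < tg := by
    have := (abs_le.1 (mem_box₂ hbox).2).1
    rw [hpos] at this
    simp only at this
    have h0 : 0 < L.v * (tg - t₆) := by linarith
    exact sub_pos.1 (pos_of_mul_pos_right h0 f4.le)
  have hball : L.laneBall (n + 1) (L.lam k * Δ + L.β k) (L.dst k) ((L.tel₂ k).clock n tg) =
      ⟨(L.tel₂ k).clock n tg, b.posAt ((L.tel₂ k).clock n tg), (L.v, 0)⟩ := by
    rw [hb, Placement.posAt_ball, hpos, laneBall, hgt]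
    simp
  have hvel : b.vel = (0, -(L.v : ℝ)) := by
    rw [hb, Placement.ball]
    ext <;> simp [frameVel, tel₂]
    ring
  have hcross : cross (toPlane (L.gate k).snd - toPlane (L.gate k).fst) b.vel = 2 * L.v := by
    rw [hvel]
    simp [cross, gate, toPlane]
    ring
  have hrefl : reflect (toPlane (L.gate k).snd - toPlane (L.gate k).fst) 0 b.vel =
      ((L.v : ℝ), 0) := by
    have e : toPlane (L.gate k).snd - toPlane (L.gate k).fst = (2 : ℝ) • ((-1, 1) : Plane) := by
      ext <;> simp [toPlane, gate] <;> ring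
    rw [hvel, e, reflect_smul two_ne_zero]
    ext <;> simp [reflect, dot, normal] <;> ring
  have hbounce : L.scene.Bounce b
      (L.laneBall (n + 1) (L.lam k * Δ + L.β k) (L.dst k) ((L.tel₂ k).clock n tg)) := by
    rw [hball]
    refine Scene.bounce_of_leg ((L.tel₂ k).clock_lt.2 hlt) ?_ ?_ ?_
    · rintro t ⟨ht, -⟩ m hm hx
      exfalso
      obtain ⟨t, rfl⟩ := (L.tel₂ k).exists_clock n t
      rw [hb, Placement.posAt_ball] at hx
      have ht' : t₆ < t := (L.tel₂ k).clock_lt.1 ht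
      have hx' := hx
      rw [hpos] at hx
      rcases zone_walls (hzone t) hm hx with ⟨-, -, h, -⟩ | ⟨-, h, -⟩ | ⟨⟨B, hB, rfl⟩, -, -⟩
      · have h := (abs_le.1 h).1
        simp only at h
        linarith
      · have h := (abs_le.1 h).1
        simp only at h
        linarith
      · exact hfree t ht' B hB hx'
    · rintro t - g hg hx -
      obtain ⟨t, rfl⟩ := (L.tel₂ k).exists_clock n t
      rw [hb, Placement.posAt_ball, hpos] at hx
      obtain ⟨rfl, h, -, -⟩ := zone_gates (hzone t) hg hx
      simp only at h
      have h0 : (L.v : ℝ) * (tg - t) = 0 := by linarith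
      refine ⟨?_, hrefl⟩
      rw [(L.tel₂ k).clock_inj]
      rcases mul_eq_zero.1 h0 with h0 | h0 <;> linarith
    · refine .inr ⟨_, L.mem_gates.2 ⟨k, rfl⟩, ?_, ?_⟩
      · rw [hb, Placement.posAt_ball, hpos, segment_eq_image]
        refine ⟨1 / 2, ⟨by norm_num, by norm_num⟩, ?_⟩
        ext <;> simp [gate, toPlane] <;> ring
      · rw [hcross]; linarith
  have hle : (L.tel₂ k).clock n tg ≤ (n + 1 : ℕ) * L.T + (L.lam k * Δ + L.β k) := by
    rw [← sub_nonpos]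
    have h0 : ((L.tel₂ k).clock n tg - ((n + 1 : ℕ) * L.T + (L.lam k * Δ + L.β k))) * L.v ≤ 0 := by
      rw [hgt]; linarith
    by_contra hcon
    exact absurd (mul_pos (not_le.1 hcon) f4) h0.not_gt
  have h1 : L.scene.Track L.ports b 1
      (L.laneBall (n + 1) (L.lam k * Δ + L.β k) (L.dst k) ((L.tel₂ k).clock n tg)) := by
    refine Scene.Track.bounce hbounce ?_
    rintro t -
    obtain ⟨t, rfl⟩ := (L.tel₂ k).exists_clock n t
    rw [hb, Placement.posAt_ball, hpos]
    exact notMem_ports_of_zone (hzone t)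
  have h2 : L.scene.Track L.ports
      (L.laneBall (n + 1) (L.lam k * Δ + L.β k) (L.dst k) ((L.tel₂ k).clock n tg)) 0
      (L.laneBall (n + 1) (L.lam k * Δ + L.β k) (L.dst k) ((n + 1 : ℕ) * L.T +
        (L.lam k * Δ + L.β k))) := by
    have := Scene.Track.fly (S := L.scene) (Z := L.ports)
      (b := L.laneBall (n + 1) (L.lam k * Δ + L.β k) (L.dst k) ((L.tel₂ k).clock n tg)) hle
      (laneBall_free_of_le (L.dst_le k) fun s hs => hs.2) ?_
    · convert this using 1
      rw [posAt_laneBall]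
      rfl
    · rintro s ⟨-, hs⟩
      refine notMem_ports_of_ne ?_
      rw [posAt_laneBall]
      exact (mul_neg_of_neg_of_pos (sub_neg.2 hs) f4).ne
  refine h1.trans ?_ h2
  refine notMem_ports_of_ne ?_
  show ((L.tel₂ k).clock n tg - ((n + 1 : ℕ) * L.T + (L.lam k * Δ + L.β k))) * L.v ≠ 0
  rw [hgt]
  linarith

/-- The way of a ball through a module, from port to port: there is one reflection at the shutter,
three in each telescope, and one at the gate. -/
theorem track_module (hΔ : Δ ∈ Set.Icc (0 : ℝ) (1 / 2)) (hk : |Δ - L.cen k| ≤ L.h)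
    (huniq : ∀ k', L.src k' = L.src k → |Δ - L.cen k'| ≤ L.h → k' = k) :
    L.scene.Track L.ports (L.laneBall n Δ (L.src k) (n * L.T + Δ)) 8
      (L.laneBall (n + 1) (L.lam k * Δ + L.β k) (L.dst k) ((n + 1 : ℕ) * L.T +
        (L.lam k * Δ + L.β k))) := by
  obtain ⟨f1, f2, f3, f4, f5⟩ := L.real_facts k
  obtain ⟨t₃, h1, h2, h3, h4⟩ := L.track_tel₁ (n := n) (k := k) hΔ
  obtain ⟨t₆, h5, h6, h7⟩ := L.track_tel₂ hΔ h1 h3 h4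
  refine (((track_shutter hΔ hk huniq).trans ?_ h2).trans ?_ h5).trans ?_ (track_gate h6 h7)
  · refine notMem_ports_of_ne ?_
    show (L.col k : ℝ) ≠ 0
    linarith
  · exact notMem_ports_of_zone (k := k) (.inl (mem_box₁ h3).1)
  · exact notMem_ports_of_zone (k := k) (.inr (.inl (mem_box₂ h6).1))

end Layout

/-! ### The stack as a time offset -/

theorem bitsOffset_nonneg (l : List Bool) : 0 ≤ bitsOffset l := by
  induction l with
  | nil => simp [bitsOffset]
  | cons b l ih => simp only [bitsOffset]; split_ifs <;> linarith

theorem bitsOffset_le (l : List Bool) : bitsOffset l ≤ (1 - (1 / 4) ^ l.length) / 3 := by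
  induction l with
  | nil => simp [bitsOffset]
  | cons b l ih =>
    simp only [bitsOffset, List.length_cons, pow_succ]
    split_ifs <;> linarith

theorem bitsOffset_append (l l' : List Bool) :
    bitsOffset (l ++ l') = bitsOffset l + bitsOffset l' / 4 ^ l.length := by
  induction l with
  | nil => simp [bitsOffset]
  | cons b l ih =>
    simp only [List.cons_append, bitsOffset, List.length_cons, ih, pow_succ]
    field_simp
    ring

/-- Different lists of the same length have offsets that are clearly separated, since an offset
uses only half of the digits in base `4`. -/
theorem le_abs_bitsOffset_sub {l l' : List Bool} (hlen : l.length = l'.length) (hne : l ≠ l') :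
    (1 / 4) ^ l.length ≤ |bitsOffset l - bitsOffset l'| := by
  induction l generalizing l' with
  | nil =>
    cases l' with
    | nil => exact absurd rfl hne
    | cons => simp at hlen
  | cons b l ih =>
    cases l' with
    | nil => simp at hlen
    | cons b' l' =>
      have hlen' : l.length = l'.length := by simpa using hlen
      have h1 := bitsOffset_nonneg l
      have h2 := bitsOffset_nonneg l'
      have h3 := bitsOffset_le l
      have h4 := bitsOffset_le l'
      have h5 : (0 : ℝ) < (1 / 4) ^ l.length := by positivity
      have h6 : ((1 : ℝ) / 4) ^ l.length ≤ 1 := pow_le_one₀ (by norm_num) (by norm_num)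
      rw [← hlen'] at h4
      simp only [bitsOffset, List.length_cons, pow_succ]
      cases b <;> cases b'
      · have := ih hlen' (fun h => hne (by rw [h]))
        rw [← sub_div, abs_div, abs_of_pos (show (0 : ℝ) < 4 by norm_num)]
        simp only [Bool.false_eq_true, if_false, zero_add]
        linarith
      · rw [abs_sub_comm]
        refine le_trans ?_ (le_abs_self _)
        simp only [Bool.false_eq_true, if_false, if_true]
        linarith
      · refine le_trans ?_ (le_abs_self _)
        simp only [Bool.false_eq_true, if_false, if_true]
        linarith
      · have := ih hlen' (fun h => hne (by rw [h]))
        rw [← sub_div, abs_div, abs_of_pos (show (0 : ℝ) < 4 by norm_num)]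
        simp only [if_true, add_sub_add_left_eq_sub]
        linarith

/-- The time offset of a list of bits as a rational number. -/
def ratOffset : List Bool → ℚ
  | [] => 0
  | b :: l => ((if b then 1 else 0) + ratOffset l) / 4

theorem ratOffset_cast (l : List Bool) : (ratOffset l : ℝ) = bitsOffset l := by
  induction l with
  | nil => simp [ratOffset, bitsOffset]
  | cons b l ih =>
    cases b <;> simp [ratOffset, bitsOffset, ih]

section Stack

variable {Γ : Type*} {ℓ : ℕ} (code : Option Γ ↪ (Fin ℓ → Bool))

/-- Time offset of the code block of a symbol. -/
def blockOffset (X : Option Γ) : ℚ := ratOffset (List.ofFn (code X))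

/-- Time offset of the code of a word, without a bottom symbol. -/
def wordOffset (r : List Γ) : ℚ :=
  ratOffset ((r.map some).flatMap fun X => List.ofFn (code X))

/-- Factor by which the offset is scaled when the top symbol `X` is replaced by the word `r`. -/
def replaceScale (ℓ : ℕ) (X : Option Γ) (r : List Γ) : ℚ :=
  (if X.isSome then 4 ^ ℓ else 1) / 4 ^ (r.length * ℓ)

/-- Change of the offset, apart from the scaling, when the top symbol `X` is replaced by `r`. -/
def replaceShift (X : Option Γ) (r : List Γ) : ℚ :=
  wordOffset code r - (if X.isSome then replaceScale ℓ X r * blockOffset code X else 0)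

theorem blockOffset_cast (X : Option Γ) :
    (blockOffset code X : ℝ) = bitsOffset (List.ofFn (code X)) := ratOffset_cast _

theorem stackOffset_nil : stackOffset code [] = blockOffset code none := by
  simp [stackOffset, blockOffset_cast]

theorem stackOffset_append (r s : List Γ) :
    stackOffset code (r ++ s) = wordOffset code r + stackOffset code s / 4 ^ (r.length * ℓ) := by
  rw [stackOffset, List.map_append, List.append_assoc, List.flatMap_append, bitsOffset_append,
    wordOffset, ratOffset_cast, stackOffset]
  congr 3
  simp [List.length_flatMap, Function.comp_def]

theorem stackOffset_cons (X : Γ) (s : List Γ) :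
    stackOffset code (X :: s) = blockOffset code (some X) + stackOffset code s / 4 ^ ℓ := by
  have := stackOffset_append code [X] s
  simpa [wordOffset, blockOffset] using this

theorem stackOffset_nonneg (s : List Γ) : 0 ≤ stackOffset code s := bitsOffset_nonneg _

theorem stackOffset_le (s : List Γ) : stackOffset code s ≤ 1 / 3 := by
  refine (bitsOffset_le _).trans ?_
  have : (0 : ℝ) < (1 / 4) ^ ((s.map some ++ [none]).flatMap fun X =>
    List.ofFn (code X)).length := by positivity
  linarith

theorem blockOffset_nonneg (X : Option Γ) : 0 ≤ blockOffset code X := by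
  have : (0 : ℝ) ≤ blockOffset code X := by
    rw [blockOffset_cast]; exact bitsOffset_nonneg _
  exact_mod_cast this

theorem blockOffset_le (X : Option Γ) : blockOffset code X ≤ 1 / 2 := by
  have h := bitsOffset_le (List.ofFn (code X))
  have h' : (0 : ℝ) < (1 / 4) ^ (List.ofFn (code X)).length := by positivity
  have : (blockOffset code X : ℝ) ≤ ((1 / 2 : ℚ) : ℝ) := by
    rw [blockOffset_cast]; push_cast; linarith
  exact_mod_cast this

theorem stackOffset_sub_blockOffset (s : List Γ) :
    0 ≤ stackOffset code s - blockOffset code s.head? ∧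
    stackOffset code s - blockOffset code s.head? ≤ (1 / 4) ^ ℓ / 3 := by
  have h4 : (0 : ℝ) < (1 / 4) ^ ℓ := by positivity
  cases s with
  | nil =>
    rw [stackOffset_nil, List.head?_nil, sub_self]
    exact ⟨le_rfl, by linarith⟩
  | cons X s =>
    rw [stackOffset_cons, List.head?_cons, add_sub_cancel_left]
    have h1 := stackOffset_nonneg code s
    have h2 := stackOffset_le code s
    refine ⟨by positivity, ?_⟩
    have e : stackOffset code s / 4 ^ ℓ = (1 / 4) ^ ℓ * stackOffset code s := by
      rw [one_div, inv_pow]; ring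
    rw [e]
    linarith [mul_le_mul_of_nonneg_left h2 h4.le]

/-- The top symbol can be recognized from the time offset. -/
theorem abs_stackOffset_sub_le_iff (s : List Γ) (X : Option Γ) :
    |stackOffset code s - blockOffset code X| ≤ (1 / 4) ^ ℓ / 2 ↔ X = s.head? := by
  have h4 : (0 : ℝ) < (1 / 4) ^ ℓ := by positivity
  obtain ⟨h1, h2⟩ := stackOffset_sub_blockOffset code s
  constructor
  · intro h
    by_contra hne
    have h3 := le_abs_bitsOffset_sub (l := List.ofFn (code X)) (l' := List.ofFn (code s.head?))
      (by simp) (fun h => hne (code.injective (List.ofFn_injective h)))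
    rw [← blockOffset_cast, ← blockOffset_cast, List.length_ofFn] at h3
    rw [abs_le] at h
    rw [le_abs] at h3
    rcases h3 with h3 | h3 <;> linarith [h.1, h.2]
  · rintro rfl
    rw [abs_of_nonneg h1]
    linarith

/-- The replacement of the top symbol by a word is an affine map of the offset that depends on the
symbol and the word only. -/
theorem stackOffset_replace (s r : List Γ) : stackOffset code (r ++ s.tail) =
    replaceScale ℓ s.head? r * stackOffset code s + replaceShift code s.head? r := by
  rw [stackOffset_append, replaceShift]
  cases s with
  | nil => simp [replaceScale]; ring
  | cons X s =>
    rw [stackOffset_cons]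
    simp [replaceScale]
    field_simp
    ring

theorem replaceScale_pos (X : Option Γ) (r : List Γ) : 0 < replaceScale ℓ X r := by
  unfold replaceScale; split_ifs <;> positivity

theorem pow_div_pow_cases (a b : ℕ) : (4 : ℚ) ^ a / 4 ^ b = 1 ∨ (4 : ℚ) ^ a / 4 ^ b ≤ 1 / 4 ∨
    4 ≤ (4 : ℚ) ^ a / 4 ^ b := by
  rcases lt_trichotomy a b with h | rfl | h
  · right; left
    rw [div_le_div_iff₀ (by positivity) (by norm_num), one_mul, ← pow_succ]
    exact pow_le_pow_right₀ (by norm_num) h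
  · left; exact div_self (by positivity)
  · right; right
    rw [le_div_iff₀ (by positivity), ← pow_succ']
    exact pow_le_pow_right₀ (by norm_num) h

theorem replaceScale_cases (X : Option Γ) (r : List Γ) : replaceScale ℓ X r = 1 ∨
    replaceScale ℓ X r ≤ 1 / 4 ∨ 4 ≤ replaceScale ℓ X r := by
  unfold replaceScale
  split_ifs
  · exact pow_div_pow_cases _ _
  · simpa using pow_div_pow_cases 0 (r.length * ℓ)

end Stack

/-! ### The automaton -/

namespace PDA

variable {Q A Γ : Type*} (M : PDA Q A Γ) (w : List A)

/-- The transition in state `q` with top symbol `X` when `i` letters of the input word `w` remain: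
new state, new number of remaining letters, and the word that replaces `X`. -/
def trans (q : Q) (i : ℕ) (X : Option Γ) : Option (Q × ℕ × List Γ) :=
  match M.δ q none X with
  | some r => some (r.1, i, r.2)
  | none =>
    match w.drop (w.length - i) with
    | [] => none
    | a :: _ => (M.δ q (some a) X).map fun r => (r.1, i - 1, r.2)

variable {M w}

/-- The remaining input of a configuration is a suffix of `w`, so it is determined by its length. -/
theorem step_eq {c : Config Q A Γ} (hc : c.input <:+ w) :
    M.step c = (M.trans w c.state c.input.length c.stack.head?).map fun r =>
      ⟨r.1, w.drop (w.length - r.2.1), r.2.2 ++ c.stack.tail⟩ := by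
  have hd := List.suffix_iff_eq_drop.1 hc
  unfold step trans
  cases h : M.δ c.state none c.stack.head? with
  | some r =>
    simp only [Option.map_some]
    rw [← hd]
  | none =>
    simp only
    rw [← hd]
    cases hi : c.input with
    | nil => simp
    | cons a l =>
      have hl : l <:+ w := ((List.suffix_cons a l).trans (hi ▸ hc))
      simp only [Option.map_map, List.length_cons, Nat.add_sub_cancel]
      congr 1
      funext r
      simp only [Function.comp]
      rw [← List.suffix_iff_eq_drop.1 hl]

theorem trans_le {q : Q} {i : ℕ} {X : Option Γ} {r : Q × ℕ × List Γ}
    (h : M.trans w q i X = some r) :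
    r.2.1 ≤ i := by
  unfold trans at h
  split at h
  · obtain rfl := Option.some.inj h
    exact le_rfl
  · split at h
    · simp at h
    · obtain ⟨s, -, rfl⟩ := Option.map_eq_some_iff.1 h
      exact Nat.sub_le _ _

end PDA

/-! ### Simulation of the automaton by a circuit -/

/-- A ball that runs through a sequence of lanes with given offsets is in the ports of these lanes
at the corresponding times, and in a port at no other time. Here `ev n` is the lane and the offset
in the `n`-th period, until the ball stays on its lane for ever. -/
theorem Layout.ballAt_of_events (L : Layout) {ev : ℕ → Option (ℕ × ℝ)} {j₀ : ℕ} {Δ₀ : ℝ}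
    (h0 : ev 0 = some (j₀, Δ₀)) (hnone : ∀ n, ev n = none → ev (n + 1) = none)
    (hbd : ∀ n j Δ, ev n = some (j, Δ) → j ≤ L.J ∧ 0 ≤ Δ)
    (hstep : ∀ n j Δ j' Δ', ev n = some (j, Δ) → ev (n + 1) = some (j', Δ') →
      L.scene.Track L.ports (L.laneBall n Δ j (n * L.T + Δ)) 8
        (L.laneBall (n + 1) Δ' j' ((n + 1 : ℕ) * L.T + Δ')))
    (hhalt : ∀ n j Δ, ev n = some (j, Δ) → ev (n + 1) = none →
      L.scene.Free (L.laneBall n Δ j (n * L.T + Δ)) (Set.Ioi (n * L.T + Δ))) :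
    (∀ n j Δ, ev n = some (j, Δ) → L.scene.BallAt (L.laneBall 0 Δ₀ j₀ 0) (8 * n) (n * L.T + Δ)
      (toPlane (0, Layout.lane j)) (L.v, 0)) ∧
    ∀ k t z u, L.scene.BallAt (L.laneBall 0 Δ₀ j₀ 0) k t z u → z ∈ L.ports →
      ∃ n j Δ, ev n = some (j, Δ) ∧ t = n * L.T + Δ ∧ z = toPlane (0, Layout.lane j) := by
  have hv : (0 : ℝ) < L.v := by exact_mod_cast L.v_pos
  have hT : (8 : ℝ) ≤ L.T := by exact_mod_cast L.T_ge
  obtain ⟨hj₀, hΔ₀⟩ := hbd 0 _ _ h0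
  have entry : ∀ t, 0 ≤ t → t ≤ Δ₀ → L.scene.BallAt (L.laneBall 0 Δ₀ j₀ 0) 0 t
      ((L.laneBall 0 Δ₀ j₀ 0).posAt t) (L.v, 0) := by
    intro t ht ht'
    refine Scene.BallAt.fly (b := L.laneBall 0 Δ₀ j₀ 0) ht
      (Layout.laneBall_free_of_le hj₀ fun s hs => ?_)
    simpa using hs.2.trans ht'
  have main : ∀ n j Δ, ev n = some (j, Δ) → L.scene.BallAt (L.laneBall 0 Δ₀ j₀ 0) (8 * n)
      (n * L.T + Δ) (toPlane (0, Layout.lane j)) (L.v, 0) := by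
    intro n
    induction n with
    | zero =>
      intro j Δ h
      obtain ⟨rfl, rfl⟩ : j₀ = j ∧ Δ₀ = Δ := by simpa [h0] using h
      have := entry Δ₀ hΔ₀ le_rfl
      rw [Layout.posAt_laneBall] at this
      simpa [toPlane] using this
    | succ n ih =>
      intro j' Δ' h'
      obtain ⟨⟨j, Δ⟩, h⟩ := Option.ne_none_iff_exists'.1
        (fun h => by simp [hnone n h] at h' : ev n ≠ none)
      have h1 := (hstep n j Δ j' Δ' h h').1
      rw [Layout.laneBall_port, Layout.laneBall_port] at h1
      have := (ih j Δ h).trans h1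
      rwa [Nat.mul_succ]
  refine ⟨main, ?_⟩
  intro k t z u hz hp
  have ht0 : 0 ≤ t := hz.time_le
  by_cases hP0 : t < Δ₀
  · refine absurd hp (Layout.notMem_ports_of_ne ?_)
    rw [hz.unique (entry t ht0 hP0.le), Layout.posAt_laneBall]
    have : ((t - (((0 : ℕ) : ℝ) * L.T + Δ₀)) * L.v) < 0 := by
      push_cast; exact mul_neg_of_neg_of_pos (by linarith) hv
    exact this.ne
  -- the last event before or at the time `t`
  have hex : ∃ n, ¬ ∃ j Δ, ev n = some (j, Δ) ∧ n * L.T + Δ ≤ t := by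
    obtain ⟨n, hn⟩ := exists_nat_gt t
    refine ⟨n, ?_⟩
    rintro ⟨j, Δ, h, hle⟩
    have := (hbd n j Δ h).2
    have : (0 : ℝ) ≤ n := Nat.cast_nonneg n
    nlinarith
  classical
  obtain ⟨m, hm, hmin⟩ : ∃ m, (¬ ∃ j Δ, ev m = some (j, Δ) ∧ m * L.T + Δ ≤ t) ∧
      ∀ n < m, ∃ j Δ, ev n = some (j, Δ) ∧ n * L.T + Δ ≤ t :=
    ⟨Nat.find hex, Nat.find_spec hex, fun n hn => not_not.1 (Nat.find_min hex hn)⟩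
  cases m with
  | zero => exact absurd ⟨j₀, Δ₀, h0, by simpa using hP0⟩ hm
  | succ n =>
    obtain ⟨j, Δ, h, hle⟩ := hmin n n.lt_succ_self
    have hn := main n j Δ h
    rcases hle.eq_or_lt with rfl | hlt
    · exact ⟨n, j, Δ, h, rfl, hz.unique hn⟩
    · exfalso
      cases h' : ev (n + 1) with
      | none =>
        have hfree := hhalt n j Δ h h'
        have h1 : L.scene.BallAt (L.laneBall n Δ j (n * L.T + Δ)) 0 t
            ((L.laneBall n Δ j (n * L.T + Δ)).posAt t) (L.v, 0) :=
          Scene.BallAt.fly (b := L.laneBall n Δ j (n * L.T + Δ)) hle fun s hs => hfree s hs.1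
        rw [Layout.posAt_laneBall, Layout.laneBall_port] at h1
        refine absurd hp (Layout.notMem_ports_of_ne ?_)
        rw [hz.unique (hn.trans h1)]
        exact (mul_pos (sub_pos.2 hlt) hv).ne'
      | some p =>
        obtain ⟨j', Δ'⟩ := p
        have hlt' : t < (n + 1 : ℕ) * L.T + Δ' :=
          not_le.1 fun hle' => hm ⟨j', Δ', h', hle'⟩
        obtain ⟨i, x, u', h1, hx⟩ := (hstep n j Δ j' Δ' h h').2 t ⟨hlt, hlt'⟩
        rw [Layout.laneBall_port] at h1
        rw [hz.unique (hn.trans h1)] at hp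
        exact hx hp

theorem PDA.run_suffix {Q A Γ : Type*} (M : PDA Q A Γ) (w : List A) {c : Config Q A Γ} {n : ℕ}
    {s : List Γ} {q : Q}
    (h : M.run ⟨q, w, s⟩ n = some c) : c.input <:+ w := by
  induction n generalizing c with
  | zero =>
    obtain rfl := Option.some.inj h
    exact List.suffix_rfl
  | succ n ih =>
    obtain ⟨c', hc', hs⟩ := Option.bind_eq_some_iff.1 h
    rw [PDA.step_eq (ih hc')] at hs
    obtain ⟨r, -, rfl⟩ := Option.map_eq_some_iff.1 hs
    exact List.drop_suffix _ _

section Automaton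

variable {Q A Γ : Type*} [Finite Q] [Finite Γ] (M : PDA Q A Γ) {ℓ : ℕ}
  (code : Option Γ ↪ (Fin ℓ → Bool)) (w : List A)

/-- For every automaton and every input word there is a circuit with one lane for every pair of a
state and a number of remaining letters, and with one module for every transition. The module `k`
serves the state, the number of remaining letters and the top symbol that are given by `key k`. -/
theorem exists_layout {v : ℚ} (hv : 0 < v) :
    ∃ (L : Layout) (ln : Q → ℕ → ℕ) (key : Fin L.N → Q × ℕ × Option Γ),
      L.v = v ∧ L.h = (1 / 4) ^ ℓ / 2 ∧
      (∀ q i, i ≤ w.length → ln q i ≤ L.J) ∧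
      (∀ q i q' i', ln q i = ln q' i' → q = q' ∧ i = i') ∧
      (∀ k, L.src k = ln (key k).1 (key k).2.1) ∧
      (∀ k, L.cen k = blockOffset code (key k).2.2) ∧
      Function.Injective key ∧
      (∀ k, M.trans w (key k).1 (key k).2.1 (key k).2.2 ≠ none) ∧
      ∀ q i X r, i ≤ w.length → M.trans w q i X = some r → ∃ k, key k = (q, i, X) ∧
        L.dst k = ln r.1 r.2.1 ∧ L.lam k = replaceScale ℓ X r.2.2 ∧
        L.β k = replaceShift code X r.2.2 := by
  obtain ⟨m, ⟨eQ⟩⟩ := Finite.exists_equiv_fin Q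
  let ln : Q → ℕ → ℕ := fun q i => eQ q + m * i
  -- modules exist only for combinations that have a transition
  let ι := {p : Q × Fin (w.length + 1) × Option Γ //
    ∃ r, M.trans w p.1 p.2.1 p.2.2 = some r}
  obtain ⟨N, ⟨e⟩⟩ := Finite.exists_equiv_fin ι
  have hr : ∀ p : ι, ∃ r, M.trans w p.1.1 p.1.2.1 p.1.2.2 = some r := fun p => p.2
  choose r hr using hr
  have ht : ∀ p : ι, Nonempty (Telescope (replaceScale ℓ p.1.2.2 (r p).2.2)) := fun p =>
    nonempty_telescope (replaceScale_pos _ _) (replaceScale_cases _ _)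
  let tel : ∀ p : ι, Telescope (replaceScale ℓ p.1.2.2 (r p).2.2) := fun p => (ht p).some
  have hln : ∀ q i, i ≤ w.length → ln q i ≤ m * (w.length + 1) := by
    intro q i hi
    have h1 := (eQ q).2
    have h2 := Nat.mul_le_mul_left m hi
    simp only [ln, Nat.mul_add, Nat.mul_one]
    omega
  have hinj : ∀ q i q' i', ln q i = ln q' i' → q = q' ∧ i = i' := by
    intro q i q' i' h
    have hm : 0 < m := (Nat.zero_le _).trans_lt (eQ q).2
    have h1 : (eQ q : ℕ) = eQ q' := by
      have := congrArg (· % m) h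
      simpa [ln, Nat.add_mul_mod_self_left, Nat.mod_eq_of_lt (eQ q).2,
        Nat.mod_eq_of_lt (eQ q').2] using this
    have h2 : i = i' := by
      have h3 : (eQ q : ℕ) + m * i = eQ q' + m * i' := h
      rw [h1] at h3
      exact Nat.eq_of_mul_eq_mul_left hm (Nat.add_left_cancel h3)
    exact ⟨eQ.injective (Fin.ext h1), h2⟩
  have hpos : ∀ p : ι, (p.1.2.1 : ℕ) ≤ w.length := fun p => Nat.lt_succ_iff.1 p.1.2.1.2
  let src : Fin N → ℕ := fun k => ln (e.symm k).1.1 (e.symm k).1.2.1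
  let dst : Fin N → ℕ := fun k => ln (r (e.symm k)).1 (r (e.symm k)).2.1
  let β : Fin N → ℚ := fun k => replaceShift code (e.symm k).1.2.2 (r (e.symm k)).2.2
  let f : Fin N → ℚ := fun k => |v * (tel (e.symm k)).size| +
    |v * (β k - (tel (e.symm k)).c) + 10 * (src k + dst k)|
  have hf : ∀ k, 0 ≤ f k := fun k => by positivity
  have hsum : ∀ k, f k ≤ ∑ k, f k := fun k =>
    Finset.single_le_sum (fun i _ => hf i) (Finset.mem_univ k)
  have hsum0 : 0 ≤ ∑ k, f k := Finset.sum_nonneg fun i _ => hf i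
  have hJ : (0 : ℚ) ≤ (m * (w.length + 1) : ℕ) := Nat.cast_nonneg _
  let L : Layout :=
    { N := N
      J := m * (w.length + 1)
      v := v
      h := (1 / 4) ^ ℓ / 2
      W := 10 * (m * (w.length + 1) : ℕ) + 10 + v + ∑ k, f k
      src := src
      dst := dst
      cen := fun k => blockOffset code (e.symm k).1.2.2
      lam := fun k => replaceScale ℓ (e.symm k).1.2.2 (r (e.symm k)).2.2
      β := β
      tel := fun k => tel (e.symm k)
      v_pos := hv
      h_pos := by positivity
      h_le := by
        have : (1 / 4 : ℚ) ^ ℓ ≤ 1 := pow_le_one₀ (by norm_num) (by norm_num)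
        linarith
      src_le := fun k => hln _ _ (hpos _)
      dst_le := fun k => hln _ _ ((PDA.trans_le (hr (e.symm k))).trans (hpos _))
      cen_nonneg := fun k => blockOffset_nonneg _ _
      cen_le := fun k => blockOffset_le _ _
      lam_pos := fun k => replaceScale_pos _ _
      J_le := by linarith
      v_le := by linarith
      size_le := fun k => by
        have h1 := le_abs_self (v * (tel (e.symm k)).size)
        have h2 := abs_nonneg (v * (β k - (tel (e.symm k)).c) + 10 * (src k + dst k))
        have h3 := hsum k
        simp only [f] at h3 ⊢
        linarith
      corr_le := fun k => by
        have h1 := abs_nonneg (v * (tel (e.symm k)).size)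
        have h3 := hsum k
        simp only [f] at h3 hsum0 ⊢
        linarith }
  refine ⟨L, ln, fun k => ((e.symm k).1.1, (e.symm k).1.2.1, (e.symm k).1.2.2), rfl, rfl, hln,
    hinj, fun k => rfl, fun k => rfl, ?_, ?_, ?_⟩
  · intro k k' h
    simp only [Prod.mk.injEq] at h
    exact e.symm.injective (Subtype.ext (Prod.ext h.1 (Prod.ext (Fin.ext h.2.1) h.2.2)))
  · intro k
    simp only [hr (e.symm k)]
    exact Option.some_ne_none _
  · intro q i X s hi hs
    let p : ι := ⟨(q, ⟨i, Nat.lt_succ_iff.2 hi⟩, X), s, hs⟩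
    have hps : r p = s := Option.some.inj ((hr p).symm.trans hs)
    refine ⟨e p, ?_, ?_, ?_, ?_⟩
    · simp [p]
    · simp only [L, dst, Equiv.symm_apply_apply, hps]
    · simp only [L, Equiv.symm_apply_apply, hps, p]
    · simp only [L, β, Equiv.symm_apply_apply, hps, p]

/-- If there is no transition, then no shutter on the lane accepts the ball, and it stays on the
lane for ever. -/
theorem exists_simulation {v : ℚ} (hv : 0 < v) :
    ∃ (P : Machine) (T : ℚ) (port : Q → ℕ → ℚ × ℚ), 1 ≤ T ∧
      (∀ q i q' i', i ≤ w.length → i' ≤ w.length → port q i = port q' i' → q = q' ∧ i = i') ∧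
      Simulates P.toScene M code v w T port 8 := by
  obtain ⟨L, ln, key, rfl, hh, hJ, hinj, hsrc, hcen, hkey, hsome, hmod⟩ :=
    exists_layout M code w hv
  have hlane : ∀ {j j' : ℕ}, Layout.lane j = Layout.lane j' → j = j' := by
    intro j j' h
    have : (j : ℚ) = j' := mul_left_cancel₀ (by norm_num : (10 : ℚ) ≠ 0) h
    exact_mod_cast this
  refine ⟨L.machine, L.T, fun q i => (0, Layout.lane (ln q i)), by linarith [L.T_ge], ?_, ?_⟩
  · intro q i q' i' _ _ h
    exact hinj _ _ _ _ (hlane (congrArg Prod.snd h))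
  intro s₀ c₀ b₀
  have hh' : (L.h : ℝ) = (1 / 4) ^ ℓ / 2 := by rw [hh]; push_cast; rfl
  have hΔ : ∀ s : List Γ, stackOffset code s ∈ Set.Icc (0 : ℝ) (1 / 2) := fun s =>
    ⟨stackOffset_nonneg code s, (stackOffset_le code s).trans (by norm_num)⟩
  have hwin : ∀ (s : List Γ) k, |stackOffset code s - L.cen k| ≤ L.h ↔ (key k).2.2 = s.head? := by
    intro s k
    rw [hcen, hh', abs_stackOffset_sub_le_iff]
  have hsuf : ∀ {n c}, M.run c₀ n = some c → c.input <:+ w := fun h => M.run_suffix w h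
  let ev : ℕ → Option (ℕ × ℝ) := fun n =>
    (M.run c₀ n).map fun c => (ln c.state c.input.length, stackOffset code c.stack)
  have hev : ∀ {n j Δ}, ev n = some (j, Δ) → ∃ c, M.run c₀ n = some c ∧
      j = ln c.state c.input.length ∧ Δ = stackOffset code c.stack := by
    intro n j Δ h
    obtain ⟨c, hc, he⟩ := Option.map_eq_some_iff.1 h
    simp only [Prod.mk.injEq] at he
    exact ⟨c, hc, he.1.symm, he.2.symm⟩
  have hrun : ∀ {n c}, M.run c₀ n = some c → M.run c₀ (n + 1) =
      (M.trans w c.state c.input.length c.stack.head?).map fun r =>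
        ⟨r.1, w.drop (w.length - r.2.1), r.2.2 ++ c.stack.tail⟩ := by
    intro n c hc
    rw [PDA.run, hc, Option.bind_some, PDA.step_eq (hsuf hc)]
  have hb₀ : b₀ = L.laneBall 0 (stackOffset code s₀) (ln M.start w.length) 0 := by
    simp [b₀, Layout.laneBall, toPlane]
  have hnone : ∀ n, ev n = none → ev (n + 1) = none := by
    intro n h
    have : M.run c₀ n = none := Option.map_eq_none_iff.1 h
    simp [ev, PDA.run, this]
  have hbd : ∀ n j Δ, ev n = some (j, Δ) → j ≤ L.J ∧ 0 ≤ Δ := by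
    intro n j Δ h
    obtain ⟨c, hc, rfl, rfl⟩ := hev h
    exact ⟨hJ _ _ (hsuf hc).length_le, (hΔ _).1⟩
  have hstep : ∀ n j Δ j' Δ', ev n = some (j, Δ) → ev (n + 1) = some (j', Δ') →
      L.scene.Track L.ports (L.laneBall n Δ j (n * L.T + Δ)) 8
        (L.laneBall (n + 1) Δ' j' ((n + 1 : ℕ) * L.T + Δ')) := by
    intro n j Δ j' Δ' h h'
    obtain ⟨c, hc, rfl, rfl⟩ := hev h
    obtain ⟨c', hc', rfl, rfl⟩ := hev h'
    rw [hrun hc] at hc'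
    obtain ⟨r, hr, rfl⟩ := Option.map_eq_some_iff.1 hc'
    have hi := (hsuf hc).length_le
    obtain ⟨k, hk, hdst, hlam, hβ⟩ := hmod _ _ _ r hi hr
    have hsrck : L.src k = ln c.state c.input.length := by rw [hsrc, hk]
    have hlen : (w.drop (w.length - r.2.1)).length = r.2.1 := by
      have := PDA.trans_le hr
      rw [List.length_drop]; omega
    have htrack := Layout.track_module (n := n) (k := k) (hΔ c.stack)
      ((hwin _ _).2 (by rw [hk])) ?_
    · rw [hsrck, hdst, hlam, hβ, ← stackOffset_replace] at htrack
      simp only [hlen]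
      exact htrack
    · intro k' hk' hw'
      refine hkey (Prod.ext ?_ (Prod.ext ?_ ?_))
      · exact (hinj _ _ _ _ ((hsrc k').symm.trans (hk'.trans (hsrc k)))).1
      · exact (hinj _ _ _ _ ((hsrc k').symm.trans (hk'.trans (hsrc k)))).2
      · rw [(hwin _ _).1 hw', hk]
  have hhalt : ∀ n j Δ, ev n = some (j, Δ) → ev (n + 1) = none →
      L.scene.Free (L.laneBall n Δ j (n * L.T + Δ)) (Set.Ioi (n * L.T + Δ)) := by
    intro n j Δ h h'
    obtain ⟨c, hc, rfl, rfl⟩ := hev h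
    have h3 : M.run c₀ (n + 1) = none := Option.map_eq_none_iff.1 h'
    rw [hrun hc, Option.map_eq_none_iff] at h3
    refine Layout.laneBall_free (hJ _ _ (hsuf hc).length_le) ?_
    rintro t - k hk rfl hmem
    have hX := (hwin _ _).1 ((Layout.mem_shutter_iff (hΔ c.stack)).1 hmem)
    rw [hsrc] at hk
    obtain ⟨e1, e2⟩ := hinj _ _ _ _ hk
    exact hsome k (by rw [e1, e2, hX, h3])
  obtain ⟨h1, h2⟩ := L.ballAt_of_events (ev := ev) (j₀ := ln M.start w.length)
    (Δ₀ := stackOffset code s₀) rfl hnone hbd hstep hhalt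
  refine ⟨fun n => 8 * n, ?_, fun n => ⟨by simp only; omega, by simp only; omega⟩, ?_⟩
  · intro n c hc
    rw [hb₀]
    exact h1 n _ _ (by simp only [ev, hc, Option.map_some])
  · intro q i hi k t u hb
    rw [hb₀] at hb
    obtain ⟨n, j, Δ, he, rfl, hz⟩ := h2 k t _ u hb ⟨ln q i, hJ q i hi, rfl⟩
    obtain ⟨c, hc, rfl, rfl⟩ := hev he
    have h3 : Layout.lane (ln q i) = Layout.lane (ln c.state c.input.length) := by
      have := congrArg Prod.snd hz
      simp only [toPlane] at this
      exact_mod_cast this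
    obtain ⟨h4, h5⟩ := hinj _ _ _ _ (hlane h3)
    exact ⟨n, c, hc, h4.symm, h5.symm, rfl⟩

end Automaton

/-! ### Two accelerating walls -/

/-- Displacement of an accelerating wall at time `t`. -/
def accelShift (σ : ℝ) (a : ℝ → ℝ) (t : ℝ) : ℝ := ∫ x in (0 : ℝ)..max (t - σ) 0, x * a x

theorem mem_acceleratingWall {p σ : ℝ} {a : ℝ → ℝ} {t : ℝ} {z : Plane} :
    z ∈ (acceleratingWall p σ a).at t ↔ z.1 = p + accelShift σ a t ∧ |z.2| ≤ 1 := by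
  simp only [MovingSegment.at, acceleratingWall, Prod.mk_add_mk, add_zero, accelShift,
    segment_eq_image, Set.mem_image, abs_le]
  constructor
  · rintro ⟨θ, ⟨h0, h1⟩, rfl⟩
    simp only [Prod.smul_mk, Prod.mk_add_mk, smul_eq_mul]
    refine ⟨by ring, by linarith, by linarith⟩
  · rintro ⟨h, h1, h2⟩
    refine ⟨(z.2 + 1) / 2, ⟨by linarith, by linarith⟩, ?_⟩
    ext <;> simp only [Prod.smul_mk, Prod.mk_add_mk, smul_eq_mul]
    · rw [h]; ring
    · ring

theorem reflect_acceleratingWall (p σ : ℝ) (a : ℝ → ℝ) (t u : ℝ) :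
    reflect ((acceleratingWall p σ a).snd - (acceleratingWall p σ a).fst)
      ((acceleratingWall p σ a).vel t) (u, 0) =
    (2 * (max (t - σ) 0 * a (max (t - σ) 0)) - u, 0) := by
  generalize hw : max (t - σ) 0 * a (max (t - σ) 0) = w
  ext <;> simp [reflect, acceleratingWall, dot, normal, hw]
  ring

/-- A ball is reflected once at each of two walls, if it is faster than the walls at all times. -/
theorem twoWalls_ballAt {v d u s t₁ t₂ t₃ : ℝ} {a₁ a₂ : ℝ → ℝ} (hv : 0 < v) (hu : u ≤ -(v / 2))
    (h₁ : s < t₁) (h₂ : t₁ < t₂) (h₃ : t₂ ≤ t₃)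
    (hL₁ : ∀ t t', |accelShift (d / v) a₁ t - accelShift (d / v) a₁ t'| ≤ v / 4 * |t - t'|)
    (hL₂ : ∀ t t', |accelShift (3 * d / v) a₂ t - accelShift (3 * d / v) a₂ t'| ≤
      v / 4 * |t - t'|)
    (hpos : ∀ t, t ≤ t₃ → 0 < d + accelShift (d / v) a₁ t)
    (hneg : ∀ t, t ≤ t₁ → -d + accelShift (3 * d / v) a₂ t < 0)
    (e₁ : v * (t₁ - s) = d + accelShift (d / v) a₁ t₁)
    (e₂ : v * (t₁ - s) + u * (t₂ - t₁) = -d + accelShift (3 * d / v) a₂ t₂)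
    (e₃ : v * (t₁ - s) + u * (t₂ - t₁) + v * (t₃ - t₂) = 0)
    (w₁ : 2 * (max (t₁ - d / v) 0 * a₁ (max (t₁ - d / v) 0)) = v + u)
    (w₂ : 2 * (max (t₂ - 3 * d / v) 0 * a₂ (max (t₂ - 3 * d / v) 0)) = v + u) :
    (twoWalls v d a₁ a₂).BallAt ⟨s, (0, 0), (v, 0)⟩ 2 t₃ (0, 0) (v, 0) := by
  have mem : ∀ m, m ∈ (twoWalls v d a₁ a₂).walls ↔ m = acceleratingWall d (d / v) a₁ ∨
      m = acceleratingWall (-d) (3 * d / v) a₂ := by simp [twoWalls]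
  have gate : ∀ g, g ∉ (twoWalls v d a₁ a₂).gates := fun _ => List.not_mem_nil
  have b1 : (twoWalls v d a₁ a₂).Bounce ⟨s, (0, 0), (v, 0)⟩
      ⟨t₁, (v * (t₁ - s), 0), (u, 0)⟩ := by
    have e : (⟨s, (0, 0), (v, 0)⟩ : Ball).posAt t₁ = (v * (t₁ - s), 0) := by
      ext <;> simp only [Ball.posAt, Prod.smul_mk, Prod.mk_add_mk, smul_eq_mul] <;> ring
    suffices h : (twoWalls v d a₁ a₂).Bounce _ ⟨_, Ball.posAt _ _, _⟩ by rwa [e] at h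
    refine Scene.bounce_of_leg h₁ ?_ (fun _ _ g hg => absurd hg (gate g)) (.inl ?_)
    · rintro t ⟨ht, ht'⟩ m hm hx
      simp only at ht
      rcases (mem m).1 hm with rfl | rfl
      · have h := (mem_acceleratingWall.1 hx).1
        simp only [Ball.posAt, Prod.smul_mk, Prod.mk_add_mk, smul_eq_mul] at h
        have hL := (abs_le.1 (hL₁ t t₁)).1
        rw [abs_of_nonpos (by linarith)] at hL
        obtain rfl : t = t₁ := by
          refine le_antisymm ht' (not_lt.1 fun hlt => ?_)
          nlinarith [mul_pos hv (sub_pos.2 hlt)]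
        rw [reflect_acceleratingWall, w₁]
        exact ⟨rfl, by ext <;> simp⟩
      · have h := (mem_acceleratingWall.1 hx).1
        simp only [Ball.posAt, Prod.smul_mk, Prod.mk_add_mk, smul_eq_mul] at h
        have := hneg t ht'
        nlinarith [mul_pos hv (sub_pos.2 ht)]
    · refine ⟨_, (mem _).2 (.inl rfl), ?_⟩
      rw [e, mem_acceleratingWall]
      exact ⟨e₁, by simp⟩
  have b2 : (twoWalls v d a₁ a₂).Bounce ⟨t₁, (v * (t₁ - s), 0), (u, 0)⟩
      ⟨t₂, (v * (t₁ - s) + u * (t₂ - t₁), 0), (v, 0)⟩ := by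
    have e : (⟨t₁, (v * (t₁ - s), 0), (u, 0)⟩ : Ball).posAt t₂ =
        (v * (t₁ - s) + u * (t₂ - t₁), 0) := by
      ext <;> simp only [Ball.posAt, Prod.smul_mk, Prod.mk_add_mk, smul_eq_mul] <;> ring
    suffices h : (twoWalls v d a₁ a₂).Bounce _ ⟨_, Ball.posAt _ _, _⟩ by rwa [e] at h
    refine Scene.bounce_of_leg h₂ ?_ (fun _ _ g hg => absurd hg (gate g)) (.inl ?_)
    · rintro t ⟨ht, ht'⟩ m hm hx
      simp only at ht
      rcases (mem m).1 hm with rfl | rfl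
      · have h := (mem_acceleratingWall.1 hx).1
        simp only [Ball.posAt, Prod.smul_mk, Prod.mk_add_mk, smul_eq_mul] at h
        have hL := (abs_le.1 (hL₁ t t₁)).1
        rw [abs_of_pos (by linarith)] at hL
        have := mul_le_mul_of_nonneg_left hu (sub_pos.2 ht).le
        nlinarith [mul_pos hv (sub_pos.2 ht)]
      · have h := (mem_acceleratingWall.1 hx).1
        simp only [Ball.posAt, Prod.smul_mk, Prod.mk_add_mk, smul_eq_mul] at h
        have hL := (abs_le.1 (hL₂ t t₂)).2
        rw [abs_of_nonpos (by linarith)] at hL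
        obtain rfl : t = t₂ := by
          refine le_antisymm ht' (not_lt.1 fun hlt => ?_)
          have := mul_le_mul_of_nonneg_left hu (sub_pos.2 hlt).le
          nlinarith [mul_pos hv (sub_pos.2 hlt)]
        rw [reflect_acceleratingWall, w₂]
        exact ⟨rfl, by ext <;> simp⟩
    · refine ⟨_, (mem _).2 (.inr rfl), ?_⟩
      rw [e, mem_acceleratingWall]
      exact ⟨e₂, by simp⟩
  refine (Scene.BallAt.bounce b1).trans (k' := 1) ((Scene.BallAt.bounce b2).trans (k' := 0) ?_)
  have e : (⟨t₂, (v * (t₁ - s) + u * (t₂ - t₁), 0), (v, 0)⟩ : Ball).posAt t₃ = (0, 0) := by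
    ext <;> simp only [Ball.posAt, Prod.smul_mk, Prod.mk_add_mk, smul_eq_mul]
    · linarith
    · ring
  rw [← e]
  refine Scene.BallAt.fly h₃ (Scene.free_of_forall ?_ fun _ _ g hg => absurd hg (gate g))
  rintro t ⟨ht, ht'⟩ m hm hx
  simp only at ht
  have hvt := mul_pos hv (sub_pos.2 ht)
  have hvt' := mul_nonneg hv.le (sub_nonneg.2 ht')
  rcases (mem m).1 hm with rfl | rfl
  · have h := (mem_acceleratingWall.1 hx).1
    simp only [Ball.posAt, Prod.smul_mk, Prod.mk_add_mk, smul_eq_mul] at h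
    have := hpos t ht'
    linarith
  · have h := (mem_acceleratingWall.1 hx).1
    simp only [Ball.posAt, Prod.smul_mk, Prod.mk_add_mk, smul_eq_mul] at h
    have hL := (abs_le.1 (hL₂ t t₂)).2
    rw [abs_of_pos (by linarith)] at hL
    linarith

theorem accelShift_of_le {σ t : ℝ} (a : ℝ → ℝ) (h : t ≤ σ) : accelShift σ a t = 0 := by
  rw [accelShift, max_eq_right (by linarith), intervalIntegral.integral_same]

theorem abs_accelShift_sub_le {σ K : ℝ} {a : ℝ → ℝ} (ha : Continuous a)
    (hK : ∀ x, 0 ≤ x → |x * a x| ≤ K) (t t' : ℝ) :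
    |accelShift σ a t - accelShift σ a t'| ≤ K * |t - t'| := by
  have hc : Continuous fun x => x * a x := by fun_prop
  have hK0 : 0 ≤ K := (abs_nonneg _).trans (hK 0 le_rfl)
  rw [accelShift, accelShift, intervalIntegral.integral_interval_sub_left
    (hc.intervalIntegrable _ _) (hc.intervalIntegrable _ _)]
  refine (intervalIntegral.norm_integral_le_of_norm_le_const (f := fun x => x * a x) (C := K)
    fun x hx => hK x ?_).trans ?_
  · have := (Set.mem_uIoc.1 hx)
    rcases this with h | h
    · exact (le_max_right _ _).trans h.1.le
    · exact (le_max_right _ _).trans h.1.le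
  · refine mul_le_mul_of_nonneg_left ((abs_max_sub_max_le_abs _ _ _).trans ?_) hK0
    rw [sub_sub_sub_cancel_right]

/-- If the acceleration is rescaled, then the wall makes the same movement on another scale. -/
theorem accelShift_scale {σ lam τ : ℝ} (hlam : 0 < lam) (hτ : 0 ≤ τ) (a : ℝ → ℝ) :
    accelShift σ (fun x => a (x / lam) / lam) (σ + lam * τ) = lam * accelShift 0 a τ := by
  have h := intervalIntegral.integral_comp_div (a := 0) (b := lam * τ) (fun x => x * a x) hlam.ne'
  rw [zero_div, mul_div_cancel_left₀ _ hlam.ne', smul_eq_mul] at h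
  rw [accelShift, accelShift, add_sub_cancel_left, sub_zero, max_eq_left (by positivity),
    max_eq_left hτ, ← h]
  exact intervalIntegral.integral_congr fun x _ => by ring

/-- The acceleration function of the walls. During `3` time units, the wall moves in such a way
that `τ = s + e * s ^ 2` time units after its start it has the displacement `v * e * s ^ 2`; from
then on its speed is constant. -/
def accel (v e τ : ℝ) : ℝ :=
  4 * v * e / ((1 + √(1 + 4 * e * max 0 (min τ 3))) * √(1 + 4 * e * max 0 (min τ 3))) *
    (3 / max τ 3)

section Accel

variable {v e : ℝ}

theorem accel_root_pos (he : |e| ≤ 1 / 200) {x : ℝ} (h0 : 0 ≤ x) (h3 : x ≤ 3) :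
    9 / 10 ≤ 1 + 4 * e * x ∧ 9 / 10 ≤ √(1 + 4 * e * x) := by
  have h1 := (abs_le.1 he).1
  have h2 : 94 / 100 ≤ 1 + 4 * e * x := by nlinarith
  exact ⟨by linarith, Real.le_sqrt_of_sq_le (by linarith)⟩

theorem clamp_mem (x : ℝ) : 0 ≤ max 0 (min x 3) ∧ max 0 (min x 3) ≤ 3 :=
  ⟨le_max_left _ _, max_le (by norm_num) (min_le_right _ _)⟩

theorem continuous_accel (he : |e| ≤ 1 / 200) : Continuous (accel v e) := by
  unfold accel
  refine Continuous.mul (Continuous.div (by fun_prop) (by fun_prop) fun x => ?_)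
    (Continuous.div (by fun_prop) (by fun_prop) fun x => ?_)
  · have := (accel_root_pos he (clamp_mem x).1 (clamp_mem x).2).2
    positivity
  · have := le_max_right x 3
    linarith

theorem mul_accel (he : |e| ≤ 1 / 200) {x : ℝ} (h0 : 0 ≤ x) :
    x * accel v e x = v * (1 - 1 / √(1 + 4 * e * min x 3)) := by
  have hc : max 0 (min x 3) = min x 3 := max_eq_right (le_min h0 (by norm_num))
  obtain ⟨h1, h2⟩ := accel_root_pos he (hc ▸ (clamp_mem x).1) (min_le_right x 3)
  have hx : x * (3 / max x 3) = min x 3 := by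
    rcases le_total x 3 with h | h
    · rw [max_eq_right h, min_eq_left h]; ring
    · rw [max_eq_left h, min_eq_right h, mul_div_cancel₀ _ (by linarith)]
  have hs := Real.sq_sqrt (show 0 ≤ 1 + 4 * e * min x 3 by linarith)
  rw [accel, hc, mul_left_comm, hx]
  set q := √(1 + 4 * e * min x 3)
  have hq : q ≠ 0 := by linarith
  have hq' : 1 + q ≠ 0 := by linarith
  field_simp
  linear_combination -v * hs

/-- The walls are much slower than the ball, also long after the reflections. Hence the ball cannot
meet a wall a second time. -/
theorem abs_mul_accel_le (hv : 0 < v) (he : |e| ≤ 1 / 200) {x : ℝ} (h0 : 0 ≤ x) :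
    |x * accel v e x| ≤ v / 4 := by
  obtain ⟨h1, h2⟩ := accel_root_pos he (le_min h0 (by norm_num)) (min_le_right x 3)
  have h3 : √(1 + 4 * e * min x 3) ≤ 11 / 10 := by
    rw [Real.sqrt_le_left (by norm_num)]
    have := (abs_le.1 he).2
    have := min_le_right x 3
    have := le_min h0 (show (0 : ℝ) ≤ 3 by norm_num)
    nlinarith
  rw [mul_accel he h0, abs_mul, abs_of_pos hv, div_eq_mul_one_div v 4]
  refine mul_le_mul_of_nonneg_left (abs_le.2 ⟨?_, ?_⟩) hv.le
  · have : 1 / √(1 + 4 * e * min x 3) ≤ 5 / 4 := by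
      rw [div_le_div_iff₀ (by linarith) (by norm_num)]; linarith
    linarith
  · have : 3 / 4 ≤ 1 / √(1 + 4 * e * min x 3) := by
      rw [div_le_div_iff₀ (by norm_num) (by linarith)]; linarith
    linarith

theorem accelShift_accel (he : |e| ≤ 1 / 200) (he0 : e ≠ 0) {τ : ℝ} (h0 : 0 ≤ τ) (h3 : τ ≤ 3) :
    accelShift 0 (accel v e) τ = v * (√(1 + 4 * e * τ) - 1) ^ 2 / (4 * e) := by
  have hder : ∀ x ∈ Set.uIcc 0 τ, HasDerivAt
      (fun x => v * (√(1 + 4 * e * x) - 1) ^ 2 / (4 * e)) (x * accel v e x) x := by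
    intro x hx
    rw [Set.uIcc_of_le h0] at hx
    obtain ⟨h1, h2⟩ := accel_root_pos he hx.1 (hx.2.trans h3)
    have d1 : HasDerivAt (fun x => 1 + 4 * e * x) (4 * e) x := by
      simpa using ((hasDerivAt_id x).const_mul (4 * e)).const_add 1
    have d2 := ((((d1.sqrt (by linarith)).sub_const 1).pow 2).const_mul v).div_const (4 * e)
    refine d2.congr_deriv ?_
    rw [mul_accel he hx.1, min_eq_left (hx.2.trans h3)]
    have hq : √(1 + 4 * e * x) ≠ 0 := by linarith
    simp only [Nat.cast_ofNat, Nat.add_one_sub_one, pow_one]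
    field_simp
  have hc : Continuous fun x => x * accel v e x := by
    have := continuous_accel (v := v) he
    fun_prop
  rw [accelShift, sub_zero, max_eq_left h0, intervalIntegral.integral_eq_sub_of_hasDerivAt hder
    (hc.intervalIntegrable _ _)]
  simp

theorem accel_bounds (he : |e| ≤ 1 / 200) {s : ℝ} (hs : s ∈ Set.Icc (0 : ℝ) 2) :
    0 ≤ s + e * s ^ 2 ∧ s + e * s ^ 2 ≤ 3 ∧ -(1 / 50) ≤ e * s ^ 2 ∧ e * s ^ 2 ≤ 1 / 50 ∧
      9 / 10 ≤ 1 + 2 * e * s ∧ 1 + 2 * e * s ≤ 11 / 10 := by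
  obtain ⟨h1, h2⟩ := abs_le.1 he
  obtain ⟨hs0, hs2⟩ := hs
  have h3 : -(1 / 100) ≤ e * s := by nlinarith
  have h4 : e * s ≤ 1 / 100 := by nlinarith
  have h5 : e * s ^ 2 = e * s * s := by ring
  rw [h5]
  refine ⟨?_, ?_, ?_, ?_, ?_, ?_⟩ <;> nlinarith

end Accel

/-- For `e = (lam - 1) * v / (8 * d)`, the time offset is scaled by `lam`. A ball with the offset
`s` meets the first wall `s + e * s ^ 2` time units after the start of
this wall, and the second wall `lam * (s + e * s ^ 2)` time units after the start of that one. -/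
theorem twoWalls_scale {v d lam : ℝ} (hv : 0 < v) (hd : 25 * v ≤ d) (hlam : lam = 2 ∨ lam = 1 / 2)
    {s : ℝ} (hs : s ∈ Set.Icc (0 : ℝ) 2) {a₁ a₂ : ℝ → ℝ}
    (h₁ : a₁ = accel v ((lam - 1) * v / (8 * d))) (h₂ : a₂ = fun x => a₁ (x / lam) / lam) :
    (twoWalls v d a₁ a₂).BallAt ⟨s, (0, 0), (v, 0)⟩ 2 (lam * s + 4 * d / v) (0, 0) (v, 0) := by
  have hd0 : 0 < d := by linarith
  have hl : 0 < lam ∧ lam ≤ 2 ∧ |lam - 1| ≤ 1 ∧ lam ≠ 1 := by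
    rcases hlam with rfl | rfl <;> norm_num [abs_le]
  obtain ⟨hl0, hl2, hl1, hlne⟩ := hl
  set e := (lam - 1) * v / (8 * d) with hedef
  have hev : 8 * d * e = (lam - 1) * v := by rw [hedef]; field_simp
  have he : |e| ≤ 1 / 200 := by
    rw [hedef, abs_div, abs_mul, abs_of_pos hv, abs_of_pos (by linarith : 0 < 8 * d),
      div_le_div_iff₀ (by linarith) (by norm_num)]
    nlinarith
  have he0 : e ≠ 0 := div_ne_zero (mul_ne_zero (sub_ne_zero.2 hlne) hv.ne') (by linarith)
  obtain ⟨hτ0, hτ3, hesl, hesu, hq1, hq2⟩ := accel_bounds he hs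
  obtain ⟨hs0, hs2⟩ := hs
  set τ := s + e * s ^ 2 with hτ
  have hq : √(1 + 4 * e * τ) = 1 + 2 * e * s := by
    rw [show 1 + 4 * e * τ = (1 + 2 * e * s) ^ 2 by rw [hτ]; ring]
    exact Real.sqrt_sq (by linarith)
  have hdv : 25 ≤ d / v := by rwa [le_div_iff₀ hv]
  have h3dv : 3 * d / v = 3 * (d / v) := by ring
  have h4dv : 4 * d / v = 4 * (d / v) := by ring
  have hvd : v * (d / v) = d := by field_simp
  have hcont : Continuous a₁ := h₁ ▸ continuous_accel he
  have hcont' : Continuous a₂ := by rw [h₂]; fun_prop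
  have hb₁ : ∀ x, 0 ≤ x → |x * a₁ x| ≤ v / 4 := fun x hx => h₁ ▸ abs_mul_accel_le hv he hx
  have hb₂ : ∀ x, 0 ≤ x → |x * a₂ x| ≤ v / 4 := fun x hx => by
    have := hb₁ (x / lam) (by positivity)
    rw [h₂]
    convert this using 2
    ring
  have hL₁ := abs_accelShift_sub_le (σ := d / v) hcont hb₁
  have hL₂ := abs_accelShift_sub_le (σ := 3 * d / v) hcont' hb₂
  have hS : accelShift 0 a₁ τ = v * e * s ^ 2 := by
    rw [h₁, accelShift_accel he he0 hτ0 hτ3, hq]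
    field_simp
    ring
  have hS₁ : accelShift (d / v) a₁ (d / v + τ) = v * e * s ^ 2 := by
    rw [← hS, accelShift, accelShift, add_sub_cancel_left, sub_zero]
  have hS₂ : accelShift (3 * d / v) a₂ (3 * d / v + lam * τ) = lam * (v * e * s ^ 2) := by
    rw [h₂, accelShift_scale hl0 hτ0, hS]
  have hspeed : τ * a₁ τ = v * (1 - 1 / (1 + 2 * e * s)) := by
    rw [h₁, mul_accel he hτ0, min_eq_left hτ3, hq]
  have hlτ0 : 0 ≤ lam * τ := by positivity
  have hls : lam * s ≤ 4 := by linarith [mul_le_mul hl2 hs2 hs0 zero_le_two]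
  have hlesu : lam * (e * s ^ 2) ≤ 1 := by linarith [mul_le_mul_of_nonneg_left hesu hl0.le]
  -- the time between the reflections
  have hgap : 3 * d / v + lam * τ - (d / v + τ) = 2 * (d / v) * (1 + 2 * e * s) ^ 2 := by
    have hle : lam - 1 = 8 * (d / v) * e := by
      field_simp
      linarith
    rw [h3dv, hτ]
    linear_combination (s + e * s ^ 2) * hle
  have hu : v * ((1 + 2 * e * s) - 2) / (1 + 2 * e * s) * (2 * (d / v) * (1 + 2 * e * s) ^ 2) =
      -2 * d + (lam - 1) * v * e * s ^ 2 := by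
    rw [← hev]
    field_simp
    ring
  refine twoWalls_ballAt (u := v * ((1 + 2 * e * s) - 2) / (1 + 2 * e * s)) (t₁ := d / v + τ)
    (t₂ := 3 * d / v + lam * τ) hv ?_ ?_ ?_ ?_ hL₁ hL₂ ?_ ?_ ?_ ?_ ?_ ?_ ?_
  · rw [div_le_iff₀ (by linarith)]
    linarith [mul_le_mul_of_nonneg_left hq2 hv.le]
  · linarith
  · have : 0 < 2 * (d / v) * (1 + 2 * e * s) ^ 2 := by positivity
    linarith
  · rw [h3dv, h4dv, hτ]
    linarith
  · intro t ht
    rcases le_total t (d / v) with h | h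
    · rw [accelShift_of_le _ h]; linarith
    · have := (abs_le.1 (hL₁ t (d / v))).1
      rw [accelShift_of_le _ le_rfl, abs_of_nonneg (by linarith)] at this
      have h5 : t - d / v ≤ 3 * (d / v) + 4 := by linarith
      have h6 := mul_le_mul_of_nonneg_left h5 hv.le
      linarith
  · intro t ht
    rw [accelShift_of_le _ (by linarith)]
    linarith
  · rw [hS₁, hτ]
    linear_combination hvd
  · rw [hS₂, hgap, hu, hτ]
    linear_combination hvd
  · rw [hgap, hu, h3dv, h4dv, hτ]
    linear_combination 2 * hvd
  · rw [add_sub_cancel_left, max_eq_left hτ0, hspeed]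
    have : 1 + 2 * e * s ≠ 0 := by linarith
    field_simp
    ring
  · have h7 : lam * τ * a₂ (lam * τ) = τ * a₁ τ := by
      rw [h₂]
      simp only
      rw [mul_div_cancel_left₀ _ hl0.ne']
      field_simp
    rw [add_sub_cancel_left, max_eq_left hlτ0, h7, hspeed]
    have : 1 + 2 * e * s ≠ 0 := by linarith
    field_simp
    ring

theorem exists_twoWalls {v : ℝ} (hv : 0 < v) : ∃ d₀ : ℝ, 0 < d₀ ∧ ∀ d : ℝ, d₀ ≤ d →
    (∃ a₁ a₂ : ℝ → ℝ, ContinuousOn a₁ (Set.Ici 0) ∧ ContinuousOn a₂ (Set.Ici 0) ∧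
      (∀ t, 0 ≤ t → a₂ t = a₁ (t / 2) / 2) ∧
      ∀ s ∈ Set.Icc (0 : ℝ) 2, (twoWalls v d a₁ a₂).BallAt ⟨s, (0, 0), (v, 0)⟩ 2
        (2 * s + 4 * d / v) (0, 0) (v, 0)) ∧
    (∃ a₁ a₂ : ℝ → ℝ, ContinuousOn a₁ (Set.Ici 0) ∧ ContinuousOn a₂ (Set.Ici 0) ∧
      (∀ t, 0 ≤ t → a₁ t = a₂ (t / 2) / 2) ∧
      ∀ s ∈ Set.Icc (0 : ℝ) 2, (twoWalls v d a₁ a₂).BallAt ⟨s, (0, 0), (v, 0)⟩ 2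
        (s / 2 + 4 * d / v) (0, 0) (v, 0)) := by
  refine ⟨25 * v, by linarith, fun d hd => ?_⟩
  have hc : ∀ lam : ℝ, lam = 2 ∨ lam = 1 / 2 → Continuous (accel v ((lam - 1) * v / (8 * d))) := by
    intro lam hlam
    refine continuous_accel ?_
    have : |lam - 1| ≤ 1 := by rcases hlam with rfl | rfl <;> norm_num [abs_le]
    rw [abs_div, abs_mul, abs_of_pos hv, abs_of_pos (by linarith : 0 < 8 * d),
      div_le_div_iff₀ (by linarith) (by norm_num)]
    nlinarith
  have hc2 := hc 2 (.inl rfl)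
  have hc3 := hc (1 / 2) (.inr rfl)
  refine ⟨⟨_, _, hc2.continuousOn, ?_, fun t _ => rfl, fun s hs =>
    twoWalls_scale hv hd (.inl rfl) hs rfl rfl⟩,
    ⟨_, fun x => accel v ((1 / 2 - 1) * v / (8 * d)) (x / (1 / 2)) / (1 / 2),
      hc3.continuousOn, ?_, fun t _ => ?_, fun s hs => ?_⟩⟩
  · exact Continuous.continuousOn (by fun_prop)
  · exact Continuous.continuousOn (by fun_prop)
  · simp only
    rw [div_div, show (1 / 2 : ℝ) * 2 = 1 by norm_num, div_one]
    congr 1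
    ring
  · have := twoWalls_scale hv hd (.inr rfl) hs rfl rfl
    rwa [one_div_mul_eq_div] at this

/-! ### Separation of two ranges of offsets -/

namespace Separator

variable {v : ℚ} (hv : 0 < v)

/-- A wall on the line `x - y = v` that slides along this line. In each period of length `4` it
covers the point `(v, 0)` at the times in `[1, 3/2]`, but not at those in `[2, 5/2]`. -/
def slider : Bar where
  base := (v, 0)
  d := (v / 16, v / 16)
  d_ne := by
    intro h
    have := congrArg Prod.fst h
    simp only [Prod.fst_zero] at this
    linarith
  lo := -(7 / 4)
  hi := -(1 / 2)
  lo_lt := by norm_num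
  dir := (v / 16, v / 16)
  start := 0
  start_nonneg := le_rfl
  β := 1
  γ := 0
  t₁ := 3
  t₂ := 4
  t₁_pos := by norm_num
  t₁_lt := by norm_num

/-- A wall on the line `x = y` that turns a ball that moves up in `(v, v)` to the right. -/
def mirror : RatSegment where
  fst := (7 / 8 * v, 7 / 8 * v)
  snd := (9 / 8 * v, 9 / 8 * v)
  ne := by
    intro h
    have := congrArg Prod.fst h
    simp only at this
    linarith

/-- The machine that consists of these two walls. -/
def machine : Machine where
  walls := [mirror hv]
  gates := []
  movingWalls := [(slider hv).wall]

theorem mem_slider {t : ℝ} {z : Plane} (h : z ∈ (slider hv).pts t) :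
    z.1 - z.2 = v ∧ z.2 ≤ v / 2 := by
  have hv' : (0 : ℝ) < v := by exact_mod_cast hv
  obtain ⟨l, ⟨-, h1⟩, rfl⟩ := Bar.mem_pts.1 h
  obtain ⟨θ, ⟨h2, h3⟩, τ, ⟨h4, h5⟩, e⟩ := (slider hv).exists_disp_eq t
  rw [e]
  simp only [slider] at h1 h5 ⊢
  push_cast at h1 h5 ⊢
  refine ⟨by ring, ?_⟩
  have h6 : θ * (1 * τ + 0 * τ ^ 2) ≤ 3 := by nlinarith
  nlinarith

theorem slider_iff (n : ℕ) {τ : ℝ} (h0 : 0 ≤ τ) (h3 : τ < 3) :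
    ((v : ℝ), (0 : ℝ)) ∈ (slider hv).pts (n * 4 + τ) ↔ 1 / 2 ≤ τ ∧ τ ≤ 7 / 4 := by
  have hv' : (0 : ℝ) < v := by exact_mod_cast hv
  have hd : (slider hv).wall.disp (n * 4 + τ) = τ := by
    have := (slider hv).disp_eq n h0 (by simpa [slider] using h3)
    simpa [slider] using this
  rw [Bar.mem_pts, hd]
  simp only [slider, Set.mem_Icc, Prod.mk.injEq]
  push_cast
  constructor
  · rintro ⟨l, ⟨h1, h2⟩, h, -⟩
    have : l = -τ := by
      have : (l + τ) * (v / 16 : ℝ) = 0 := by linarith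
      rcases mul_eq_zero.1 this with h | h <;> linarith
    constructor <;> linarith
  · rintro ⟨h1, h2⟩
    exact ⟨-τ, ⟨by linarith, by linarith⟩, by ring, by ring⟩

theorem mem_mirror {t : ℝ} {z : Plane} : z ∈ (mirror hv).toMovingSegment.at t ↔
    z.1 = z.2 ∧ 7 / 8 * (v : ℝ) ≤ z.2 ∧ z.2 ≤ 9 / 8 * v := by
  have hv' : (0 : ℝ) < v := by exact_mod_cast hv
  simp only [MovingSegment.at, RatSegment.toMovingSegment, mirror, toPlane, add_zero,
    segment_eq_image]
  push_cast
  constructor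
  · rintro ⟨θ, ⟨h0, h1⟩, rfl⟩
    simp only [Prod.smul_mk, Prod.mk_add_mk, smul_eq_mul]
    refine ⟨trivial, ?_, ?_⟩ <;> nlinarith
  · rintro ⟨h, h1, h2⟩
    refine ⟨(z.2 - 7 / 8 * v) / (v / 4), ⟨div_nonneg (by linarith) (by linarith), ?_⟩, ?_⟩
    · rw [div_le_one (by linarith)]; linarith
    · ext <;> simp only [Prod.smul_mk, Prod.mk_add_mk, smul_eq_mul]
      · rw [h]; field_simp; ring
      · field_simp; ring

theorem mem_walls {m : MovingSegment} : m ∈ (machine hv).toScene.walls ↔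
    m = (mirror hv).toMovingSegment ∨ m = (slider hv).wall.toMovingSegment := by
  simp [machine, Machine.toScene]

theorem notMem_gates {g : Plane × Plane} : g ∉ (machine hv).toScene.gates := List.not_mem_nil

theorem reflect_slider (t : ℝ) : reflect
    ((slider hv).wall.toMovingSegment.snd - (slider hv).wall.toMovingSegment.fst)
    ((slider hv).wall.toMovingSegment.vel t) ((v : ℝ), 0) = (0, (v : ℝ)) := by
  have hv' : (v : ℝ) ≠ 0 := by exact_mod_cast hv.ne'
  rw [Bar.reflect_eq]
  generalize (slider hv).wall.speed t = a
  ext <;> simp [reflect, dot, normal, toPlane, slider] <;> field_simp <;> ring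

theorem reflect_mirror (t : ℝ) : reflect
    ((mirror hv).toMovingSegment.snd - (mirror hv).toMovingSegment.fst)
    ((mirror hv).toMovingSegment.vel t) (0, (v : ℝ)) = ((v : ℝ), 0) := by
  have hv' : (v : ℝ) ≠ 0 := by exact_mod_cast hv.ne'
  ext <;> simp [reflect, dot, normal, toPlane, mirror, RatSegment.toMovingSegment] <;>
    field_simp <;> ring

theorem lane_mem {t₀ t : ℝ} {m : MovingSegment} (hm : m ∈ (machine hv).toScene.walls)
    (h : (⟨t₀, (0, 0), ((v : ℝ), 0)⟩ : Ball).posAt t ∈ m.at t) :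
    m = (slider hv).wall.toMovingSegment ∧ t = t₀ + 1 := by
  have hv' : (0 : ℝ) < v := by exact_mod_cast hv
  rcases (mem_walls hv).1 hm with rfl | rfl
  · obtain ⟨-, h1, -⟩ := (mem_mirror hv).1 h
    simp [Ball.posAt] at h1
    linarith
  · obtain ⟨h1, -⟩ := mem_slider hv h
    simp [Ball.posAt] at h1
    refine ⟨rfl, ?_⟩
    have : (t - t₀ - 1) * (v : ℝ) = 0 := by linarith
    rcases mul_eq_zero.1 this with h | h <;> linarith

/-- A ball with an early offset is reflected at the slider and at the mirror. -/
theorem early (n : ℕ) {s : ℝ} (h0 : 0 ≤ s) (h1 : s < 1 / 2) :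
    (machine hv).toScene.BallAt ⟨n * 4 + s, (0, 0), ((v : ℝ), 0)⟩ 2 (n * 4 + s + 5 / 2)
      (3 / 2 * v, v) ((v : ℝ), 0) := by
  have hv' : (0 : ℝ) < v := by exact_mod_cast hv
  have b1 : (machine hv).toScene.Bounce ⟨n * 4 + s, (0, 0), ((v : ℝ), 0)⟩
      ⟨n * 4 + s + 1, (v, 0), (0, (v : ℝ))⟩ := by
    have e : (⟨n * 4 + s, (0, 0), ((v : ℝ), 0)⟩ : Ball).posAt (n * 4 + s + 1) =
        ((v : ℝ), (0 : ℝ)) := by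
      ext <;> simp only [Ball.posAt, Prod.smul_mk, Prod.mk_add_mk, smul_eq_mul] <;> ring
    suffices h : (machine hv).toScene.Bounce _ ⟨_, Ball.posAt _ _, _⟩ by rwa [e] at h
    refine Scene.bounce_of_leg ?_ ?_ (fun _ _ g hg => absurd hg (notMem_gates hv)) (.inl ?_)
    · simp only; linarith
    · intro t _ m hm hx
      obtain ⟨rfl, rfl⟩ := lane_mem hv hm hx
      exact ⟨rfl, reflect_slider hv _⟩
    · refine ⟨_, (mem_walls hv).2 (.inr rfl), ?_⟩
      rw [e, add_assoc]
      exact (slider_iff hv n (by linarith) (by linarith)).2 ⟨by linarith, by linarith⟩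
  have b2 : (machine hv).toScene.Bounce ⟨n * 4 + s + 1, (v, 0), (0, (v : ℝ))⟩
      ⟨n * 4 + s + 2, (v, v), ((v : ℝ), 0)⟩ := by
    have e : ((v : ℝ), (v : ℝ)) =
        (⟨n * 4 + s + 1, (v, 0), (0, (v : ℝ))⟩ : Ball).posAt (n * 4 + s + 2) := by
      ext <;> simp only [Ball.posAt, Prod.smul_mk, Prod.mk_add_mk, smul_eq_mul] <;> ring
    rw [e]
    refine Scene.bounce_of_leg ?_ ?_ (fun _ _ g hg => absurd hg (notMem_gates hv)) (.inl ?_)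
    · simp only; linarith
    · rintro t ⟨ht, -⟩ m hm hx
      simp only at ht
      rcases (mem_walls hv).1 hm with rfl | rfl
      · obtain ⟨h2, -⟩ := (mem_mirror hv).1 hx
        simp [Ball.posAt] at h2
        refine ⟨?_, reflect_mirror hv _⟩
        have : (t - (n * 4 + s + 1) - 1) * (v : ℝ) = 0 := by linarith
        rcases mul_eq_zero.1 this with h | h <;> linarith
      · obtain ⟨h2, -⟩ := mem_slider hv hx
        simp [Ball.posAt] at h2
        rcases h2 with h2 | h2
        · linarith
        · exact absurd h2 hv.ne'
    · refine ⟨_, (mem_walls hv).2 (.inl rfl), ?_⟩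
      rw [← e, mem_mirror]
      exact ⟨rfl, by simp only; linarith, by simp only; linarith⟩
  refine (Scene.BallAt.bounce b1).trans (k' := 1) ((Scene.BallAt.bounce b2).trans (k' := 0) ?_)
  have e : ((3 / 2 * v : ℝ), (v : ℝ)) =
      (⟨n * 4 + s + 2, (v, v), ((v : ℝ), 0)⟩ : Ball).posAt (n * 4 + s + 5 / 2) := by
    ext <;> simp only [Ball.posAt, Prod.smul_mk, Prod.mk_add_mk, smul_eq_mul] <;> ring
  rw [e]
  refine Scene.BallAt.fly (by simp only; linarith)
    (Scene.free_of_forall ?_ fun _ _ g hg => absurd hg (notMem_gates hv))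
  rintro t ⟨ht, -⟩ m hm hx
  simp only at ht
  have hpos : 0 < (t - (n * 4 + s + 2)) * (v : ℝ) := mul_pos (by linarith) hv'
  rcases (mem_walls hv).1 hm with rfl | rfl
  · obtain ⟨h2, -⟩ := (mem_mirror hv).1 hx
    simp only [Ball.posAt, Prod.smul_mk, Prod.mk_add_mk, smul_eq_mul] at h2
    linarith
  · obtain ⟨-, h2⟩ := mem_slider hv hx
    simp only [Ball.posAt, Prod.smul_mk, Prod.mk_add_mk, smul_eq_mul] at h2
    linarith

/-- A ball with a late offset passes without any reflection. -/
theorem late (n : ℕ) {s : ℝ} (h0 : 1 ≤ s) (h1 : s < 3 / 2) :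
    (machine hv).toScene.BallAt ⟨n * 4 + s, (0, 0), ((v : ℝ), 0)⟩ 0 (n * 4 + (s - 1) + 5 / 2)
      (3 / 2 * v, 0) ((v : ℝ), 0) := by
  have hv' : (0 : ℝ) < v := by exact_mod_cast hv
  have e : ((3 / 2 * v : ℝ), (0 : ℝ)) =
      (⟨n * 4 + s, (0, 0), ((v : ℝ), 0)⟩ : Ball).posAt (n * 4 + (s - 1) + 5 / 2) := by
    ext <;> simp only [Ball.posAt, Prod.smul_mk, Prod.mk_add_mk, smul_eq_mul] <;> ring
  rw [e]
  refine Scene.BallAt.fly (by simp only; linarith)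
    (Scene.free_of_forall ?_ fun _ _ g hg => absurd hg (notMem_gates hv))
  intro t _ m hm hx
  obtain ⟨rfl, rfl⟩ := lane_mem hv hm hx
  have e' : (⟨n * 4 + s, (0, 0), ((v : ℝ), 0)⟩ : Ball).posAt (n * 4 + s + 1) =
      ((v : ℝ), (0 : ℝ)) := by
    ext <;> simp only [Ball.posAt, Prod.smul_mk, Prod.mk_add_mk, smul_eq_mul] <;> ring
  rw [e', add_assoc] at hx
  have := ((slider_iff hv n (by linarith) (by linarith)).1 hx).2
  linarith

end Separator

theorem exists_separator {v : ℚ} (hv : 0 < v) :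
    ∃ (P : Machine) (T c : ℚ) (inp out₀ out₁ : ℚ × ℚ) (k₀ k₁ : ℕ),
      2 ≤ T ∧ out₀.2 ≠ out₁.2 ∧
      (∀ n : ℕ, ∀ s ∈ Set.Ico (0 : ℝ) (1 / 2),
        P.toScene.BallAt ⟨n * T + s, toPlane inp, ((v : ℝ), 0)⟩ k₀
          (n * T + s + c) (toPlane out₀) ((v : ℝ), 0)) ∧
      (∀ n : ℕ, ∀ s ∈ Set.Ico (1 : ℝ) (3 / 2),
        P.toScene.BallAt ⟨n * T + s, toPlane inp, ((v : ℝ), 0)⟩ k₁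
          (n * T + (s - 1) + c) (toPlane out₁) ((v : ℝ), 0)) := by
  refine ⟨Separator.machine hv, 4, 5 / 2, (0, 0), (3 / 2 * v, v), (3 / 2 * v, 0), 2, 0,
    by norm_num, hv.ne', fun n s hs => ?_, fun n s hs => ?_⟩
  · simpa [toPlane] using Separator.early hv n hs.1 hs.2
  · simpa [toPlane] using Separator.late hv n hs.1 hs.2

end Pinball

end

theorem mainTheorem6 {Q A Γ : Type*} [Finite Q] [Finite A] [Finite Γ]
    (M : Pinball.PDA Q A Γ) {ℓ : ℕ} (code : Option Γ ↪ (Fin ℓ → Bool)) :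
    -- simulation of the pushdown automaton
    (∃ C : ℕ, ∀ v : ℚ, 0 < v → ∀ w : List A,
      ∃ (P : Pinball.Machine) (T : ℚ) (port : Q → ℕ → ℚ × ℚ),
        1 ≤ T ∧
        (∀ q i q' i', i ≤ w.length → i' ≤ w.length → port q i = port q' i' →
          q = q' ∧ i = i') ∧
        Pinball.Simulates P.toScene M code v w T port C) ∧
    -- two accelerating moving walls double or halve the time offset
    (∀ v : ℝ, 0 < v → ∃ d₀ : ℝ, 0 < d₀ ∧ ∀ d : ℝ, d₀ ≤ d →
      (∃ a₁ a₂ : ℝ → ℝ, ContinuousOn a₁ (Set.Ici 0) ∧ ContinuousOn a₂ (Set.Ici 0) ∧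
        (∀ t, 0 ≤ t → a₂ t = a₁ (t / 2) / 2) ∧
        ∀ s ∈ Set.Icc (0 : ℝ) 2,
          (Pinball.twoWalls v d a₁ a₂).BallAt ⟨s, (0, 0), (v, 0)⟩ 2
            (2 * s + 4 * d / v) (0, 0) (v, 0)) ∧
      (∃ a₁ a₂ : ℝ → ℝ, ContinuousOn a₁ (Set.Ici 0) ∧ ContinuousOn a₂ (Set.Ici 0) ∧
        (∀ t, 0 ≤ t → a₁ t = a₂ (t / 2) / 2) ∧
        ∀ s ∈ Set.Icc (0 : ℝ) 2,
          (Pinball.twoWalls v d a₁ a₂).BallAt ⟨s, (0, 0), (v, 0)⟩ 2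
            (s / 2 + 4 * d / v) (0, 0) (v, 0))) ∧
    -- separation of the time offsets in [0, 1/2) from those in [1, 3/2)
    (∀ v : ℚ, 0 < v →
      ∃ (P : Pinball.Machine) (T c : ℚ) (inp out₀ out₁ : ℚ × ℚ) (k₀ k₁ : ℕ),
        2 ≤ T ∧ out₀.2 ≠ out₁.2 ∧
        (∀ n : ℕ, ∀ s ∈ Set.Ico (0 : ℝ) (1 / 2),
          P.toScene.BallAt ⟨n * T + s, Pinball.toPlane inp, ((v : ℝ), 0)⟩ k₀
            (n * T + s + c) (Pinball.toPlane out₀) ((v : ℝ), 0)) ∧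
        (∀ n : ℕ, ∀ s ∈ Set.Ico (1 : ℝ) (3 / 2),
          P.toScene.BallAt ⟨n * T + s, Pinball.toPlane inp, ((v : ℝ), 0)⟩ k₁
            (n * T + (s - 1) + c) (Pinball.toPlane out₁) ((v : ℝ), 0))) := by
  exact ⟨⟨8, fun v hv w => Pinball.exists_simulation M code w hv⟩,
    fun v hv => Pinball.exists_twoWalls hv, fun v hv => Pinball.exists_separator hv⟩
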